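/- Let $P\in C^1([0,\infty))$ with $P(t)>p_0>0$ for $t\ge 0$, let $c\in C^1([0,\pi])$ with $c(\xi)>c_0>0$, let $M\in W^{2,2}(0,K)$ for every $K>0$, and put $N(t)=1+\int_0^tM(s)\,ds$. Let $-\lambda_1^2>-\lambda_2^2>\cdots$ ($\lambda_n>0$) be the list of all eigenvalues of $A\phi=(c\phi')'$ with Dirichlet conditions on $(0,\pi)$, and let $\phi_n$ be real eigenfunctions with $\|\phi_n\|_{L^2(0,\pi)}=1$. For $T\ge 0$ let $z_n(\cdot\,;T)$ be the solution on $[0,T]$ of $$z_n'(t;T)=-\lambda_n^2P(T-t)\int_0^tN(t-s)z_n(s;T)\,ds,\qquad z_n(0;T)=1 .$$ Consider the viscoelastic string $w_t=\int_0^tN(t-s)P(s)(c\,w_\xi)_\xi(s)\,ds+b\,g(t)$, $g(t)=\int_0^t\sigma(s)\,ds$, $w(\cdot,0)=0$, where the solutions are defined by their eigenfunction expansions: * (boundary control) for $b=0$, $w(0,t)=f(t)/(c(0)P(t))$, $w(\pi,t)=0$: $\ w(\cdot,T)=\sum_n\phi_n\int_0^Tf(T-s)\Big[\phi_n'(0)\int_0^sN(s-r)z_n(r;T)\,dr\Big]ds$.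 We say that $f\in L^2(0,T)$ steers the state to $W\in L^2(0,\pi)$ at time $T$ if this series converges to $W$ in $L^2(0,\pi)$; * (source) for $w(0,t)=w(\pi,t)=0$, $b\in L^2(0,\pi)$, $b_n=\langle b,\phi_n\rangle$: $\ w(\xi,t)=\sum_n\phi_n(\xi)\,b_n\int_0^tz_n(t-s;t)g(s)\,ds$, with boundary output $\eta(t)=w_\xi(0,t)$. Then: 1. For every $S\ge0$, $\sigma\in L^2(0,S)$ and $b\in L^2(0,\pi)$, for each $t\in[0,S]$ the series for $w(\xi,t)$ converges at every $\xi\in[0,\pi]$, $w(\cdot,t)$ has a (one-sided) derivative at $\xi=0$, $\eta(t)=\sum_nb_n\phi_n'(0)\int_0^tz_n(t-r;t)g(r)\,dr$, and $\eta$ is continuous on $[0,S]$. 2. Let $T\ge T_0$, where $\int_0^{T_0}\sqrt{P(T-s)}\,ds=\int_0^\pi c(\xi)^{-1/2}\,d\xi$ (this number is $\pi$ under the normalization $\lambda_n=n+O(1/n)$). Then: * (a) for every $W\in L^2(0,\pi)$ there is $f\in L^2(0,T)$ steering the state to $W$ at time $T$; * (b) for every $f\in L^2(0,T)$ the input $\sigma(t)=f(t)+\int_0^tN'(t-s)f(s)\,ds$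 belongs to $L^2(0,T)$ and its primitive is $g(t)=\int_0^tN(t-s)f(s)\,ds$ on $[0,T]$; * (c) if, for each $k$, $f_k\in L^2(0,T)$ steers the state to $\phi_k$ at time $T$ and $\sigma_k\in L^2(0,T)$ satisfies $\int_0^t\sigma_k=\int_0^tN(t-s)f_k(s)\,ds$ on $[0,T]$, then for every $b\in L^2(0,\pi)$ the output $\eta_{(k)}$ produced by the input $\sigma_k$ satisfies $\eta_{(k)}(T)=\langle\phi_k,b\rangle=b_k$ for all $k$, and $b=\sum_k\eta_{(k)}(T)\,\phi_k$ in $L^2(0,\pi)$. The same holds with $\{\phi_k\}$ replaced, as targets and in the reconstruction formula, by any orthonormal basis $\{e_k\}$ of $L^2(0,\pi)$. -/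

import Mathlib

open MeasureTheory Set Filter Topology

noncomputable section

namespace ViscoString

/-- Lebesgue measure on the space interval `(0, π)`. -/
abbrev spaceMeasure : Measure ℝ := volume.restrict (Ioo 0 Real.pi)

/-- Lebesgue measure on the time interval `(0, T)`. -/
abbrev timeMeasure (T : ℝ) : Measure ℝ := volume.restrict (Ioo 0 T)

/-- `M ∈ W^{2,2}(0, K)` for every `K > 0` (continuous representative): `M` has a derivative `M₁`
which is absolutely continuous, and the derivative `M₂` of `M₁` is square integrable on every
bounded interval `(0, K)`. -/
def IsW22Loc (M : ℝ → ℝ) : Prop :=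
  ∃ M₁ M₂ : ℝ → ℝ,
    (∀ K : ℝ, MemLp M₂ 2 (timeMeasure K)) ∧
    (∀ t : ℝ, 0 ≤ t → M₁ t = M₁ 0 + ∫ s in (0 : ℝ)..t, M₂ s) ∧
    (∀ t : ℝ, 0 ≤ t → M t = M 0 + ∫ s in (0 : ℝ)..t, M₁ s)

/-- `N(t) = 1 + ∫₀ᵗ M(s) ds`. -/
def memoryPrimitive (M : ℝ → ℝ) (t : ℝ) : ℝ := 1 + ∫ s in (0 : ℝ)..t, M s

/-- The `L²(0, π)` inner product of two functions. -/
def innerL2 (u v : ℝ → ℝ) : ℝ := ∫ ξ, u ξ * v ξ ∂spaceMeasure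

/-- The series `∑ aₙ eₙ` converges (unconditionally) to `W` in the norm of `L²(0, π)`. -/
def ConvergesInL2 (a : ℕ → ℝ) (e : ℕ → ℝ → ℝ) (W : ℝ → ℝ) : Prop :=
  Tendsto (fun s : Finset ℕ => eLpNorm (fun ξ => W ξ - ∑ n ∈ s, a n * e n ξ) 2 spaceMeasure)
    atTop (𝓝 0)

/-- `e` is an orthonormal basis of `L²(0, π)`. -/
structure IsL2OrthonormalBasis (e : ℕ → ℝ → ℝ) : Prop where
  memLp : ∀ n, MemLp (e n) 2 spaceMeasure
  orthonormal : ∀ m n, innerL2 (e m) (e n) = if m = n then 1 else 0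
  total : ∀ h : ℝ → ℝ, MemLp h 2 spaceMeasure → (∀ n, innerL2 (e n) h = 0) →
    h =ᵐ[spaceMeasure] 0

/-- The derivative in the space variable on `[0, π]` (one-sided at the end points). -/
def spaceDeriv (ψ : ℝ → ℝ) (ξ : ℝ) : ℝ := derivWithin ψ (Icc 0 Real.pi) ξ

/-- `(c ψ')' = μ ψ` on `[0, π]` with `ψ(0) = ψ(π) = 0`. Since `c` is continuously differentiable
and positive, solutions in `H² ∩ H¹₀` are of class `C²` up to the boundary, so nothing is lost by
asking for the equation in the classical sense. -/
structure SolvesEigenProblem (c : ℝ → ℝ) (μ : ℝ) (ψ : ℝ → ℝ) : Prop where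
  contDiffOn : ContDiffOn ℝ 2 ψ (Icc 0 Real.pi)
  left : ψ 0 = 0
  right : ψ Real.pi = 0
  eqn : ∀ ξ ∈ Icc 0 Real.pi,
    HasDerivWithinAt (fun x => c x * spaceDeriv ψ x) (μ * ψ ξ) (Icc 0 Real.pi) ξ

/-- `-λ₀² > -λ₁² > ⋯` (with `λₙ > 0`) is the list of all eigenvalues of the Dirichlet operator
`A φ = (c φ')'` on `(0, π)`, and `φₙ` is a real normalized eigenfunction for `-λₙ²`.
Indices start from `0` instead of `1`. -/
structure IsDirichletEigensystem (c : ℝ → ℝ) (lam : ℕ → ℝ) (φ : ℕ → ℝ → ℝ) : Prop where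
  pos : ∀ n, 0 < lam n
  strictMono : StrictMono lam
  eigen : ∀ n, SolvesEigenProblem c (-(lam n) ^ 2) (φ n)
  normalized : ∀ n, innerL2 (φ n) (φ n) = 1
  exhaustive : ∀ (μ : ℝ) (ψ : ℝ → ℝ), SolvesEigenProblem c μ ψ →
    (∃ ξ ∈ Icc 0 Real.pi, ψ ξ ≠ 0) → ∃ n, μ = -(lam n) ^ 2

/-- `z' (t) = -l² P(T - t) ∫₀ᵗ N(t - s) z(s) ds` on `[0, T]`, `z(0) = 1`. -/
def IsModalKernel (P N : ℝ → ℝ) (l T : ℝ) (z : ℝ → ℝ) : Prop :=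
  z 0 = 1 ∧ ∀ t ∈ Icc 0 T,
    HasDerivWithinAt z (-l ^ 2 * P (T - t) * ∫ s in (0 : ℝ)..t, N (t - s) * z s) (Icc 0 T) t

/-- The function `t ↦ z(t; T)`: the solution on `[0, T]` of the linear Volterra problem
`IsModalKernel` (the solution exists and its values on `[0, T]` are unique). -/
def modalKernel (P N : ℝ → ℝ) (l T : ℝ) : ℝ → ℝ :=
  Classical.epsilon (IsModalKernel P N l T)

/-- The `n`-th Fourier coefficient at time `T` of the state produced by the boundary control `f`
(with `b = 0`):
`∫₀ᵀ f(T - s) [φₙ'(0) ∫₀ˢ N(s - r) zₙ(r; T) dr] ds`. -/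
def controlCoeff (P N : ℝ → ℝ) (lam : ℕ → ℝ) (φ : ℕ → ℝ → ℝ) (T : ℝ) (f : ℝ → ℝ) (n : ℕ) : ℝ :=
  ∫ s in (0 : ℝ)..T, f (T - s) *
    (spaceDeriv (φ n) 0 * ∫ r in (0 : ℝ)..s, N (s - r) * modalKernel P N (lam n) T r)

/-- The boundary control `f`, i.e. `w(0,t) = f(t) / (c(0) P(t))`, `w(π,t) = 0`, with `b = 0` and
zero initial data, steers the state to `W` at time `T`: `w(·, T) = W` in `L²(0, π)`. -/
def SteersTo (P N : ℝ → ℝ) (lam : ℕ → ℝ) (φ : ℕ → ℝ → ℝ) (T : ℝ) (f W : ℝ → ℝ) : Prop :=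
  ConvergesInL2 (controlCoeff P N lam φ T f) φ W

/-- `∫₀ᵗ zₙ(t - s; t) g(s) ds`, with `g(s) = ∫₀ˢ σ`. -/
def sourceCoeff (P N : ℝ → ℝ) (lam : ℕ → ℝ) (σ : ℝ → ℝ) (t : ℝ) (n : ℕ) : ℝ :=
  ∫ s in (0 : ℝ)..t, modalKernel P N (lam n) t (t - s) * ∫ r in (0 : ℝ)..s, σ r

/-- The deformation `w(ξ, t) = ∑ₙ φₙ(ξ) bₙ ∫₀ᵗ zₙ(t - s; t) g(s) ds` of the string with zero
initial data and zero boundary data under the distributed source `b(ξ) σ(t)`. -/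
def sourceState (P N : ℝ → ℝ) (lam : ℕ → ℝ) (φ : ℕ → ℝ → ℝ) (b σ : ℝ → ℝ) (t ξ : ℝ) : ℝ :=
  ∑' n, φ n ξ * innerL2 b (φ n) * sourceCoeff P N lam σ t n

/-- The boundary output `η(t) = w_ξ(0, t)`. -/
def output (P N : ℝ → ℝ) (lam : ℕ → ℝ) (φ : ℕ → ℝ → ℝ) (b σ : ℝ → ℝ) (t : ℝ) : ℝ :=
  spaceDeriv (sourceState P N lam φ b σ t) 0

/-- `σ(t) = f(t) + ∫₀ᵗ N'(t - s) f(s) ds`, where `N' = M`. -/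
def inputSignal (M f : ℝ → ℝ) (t : ℝ) : ℝ :=
  f t + ∫ s in (0 : ℝ)..t, M (t - s) * f s

end ViscoString

end

/-! With a_n = φ_n and flux b_n = c φ_n', a finite sum ζ = Σ w_n a_n(ξ) z_n(t) and its companion q =
Σ w_n b_n(ξ) (N*z_n)(t) satisfy ζ_t = P(T-t) q_ξ and q_t = c ζ_ξ + ρ, with ζ = 0 at ξ = 0, q = 0 at
t = 0 and ρ = Σ w_n b_n (M*z_n). This is a wave equation in first order form. The memory sits in ρ,
and a Volterra argument (`exists_volterra_bounds`) bounds ρ² by q² and its past integral, without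
loss of derivatives. Everything rests on the trace q(0,t) = c(0) Σ w_n φ_n'(0) (N*z_n)(t).

Two estimates for this trace come from integrating energy identities sideways, in ξ. The upper one
(`exists_trace_bound`, `exists_bessel_bound`) bounds its L² norm by Σ w_n², uniformly in the final
time. The lower one (`exists_observability`, `exists_riesz_lower_bound`) bounds Σ w_n² by its norm
on (0, T₀). It reaches the critical time exactly, because the weight is constant along
characteristics and the constant does not depend on the weight.

The lower bound makes the moment problem for a control solvable (`exists_moment_solution`), so every
target is reached. Tested on the source coefficients s_n, the upper bound shows that φ_n'(0) s_n is
square summable. Since λ_n ≤ C |φ_n'(0)| and |φ_n(ξ)| ≤ C λ_n ξ, the series for w is dominated by ξ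
times a summable sequence. It can be differentiated at ξ = 0, and the output is continuous in time.

Reconstruction is associativity and commutativity of convolution: if g = N*f, then φ_n'(0) (z_n *
g)(T) equals φ_n'(0) (f * (N*z_n))(T), the n-th coefficient of the state steered by f. Hence the
output at T is the inner product of b with the target, and expansion in an orthonormal basis returns
b.

Completeness of the eigenfunctions is proved as well: the Green operator has the form D*D with D
compact and injective, and the spectral theorem combines with simplicity and exhaustiveness of the
eigenvalue list. -/

noncomputable section

namespace ViscoString

/-! ### Convolution calculus. -/

/-- Convolution on the half line. -/
def conv (a b : ℝ → ℝ) (t : ℝ) : ℝ := ∫ s in (0 : ℝ)..t, a (t - s) * b s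

/-- Cutting F off with the indicator of the triangle r < s reduces this to Fubini on a square. -/
theorem integral_triangle_swap {F : ℝ → ℝ → ℝ} {t : ℝ} (ht : 0 ≤ t)
    (hF : IntegrableOn (Function.uncurry F) (Icc 0 t ×ˢ Icc 0 t)) :
    (∫ s in (0 : ℝ)..t, ∫ r in (0 : ℝ)..s, F s r) =
      ∫ r in (0 : ℝ)..t, ∫ s in r..t, F s r := by
  set G : ℝ → ℝ → ℝ := fun s r => if r < s then F s r else 0 with hG
  have hGint : IntegrableOn (Function.uncurry G) (uIoc 0 t ×ˢ uIoc 0 t) := by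
    have h1 : Function.uncurry G = {p : ℝ × ℝ | p.2 < p.1}.indicator (Function.uncurry F) := by
      ext p
      simp only [hG, Function.uncurry, indicator, mem_ofPred_eq]
    rw [h1]
    refine IntegrableOn.indicator (hF.mono_set ?_) (measurableSet_lt measurable_snd measurable_fst)
    rw [uIoc_of_le ht]
    exact prod_mono Ioc_subset_Icc_self Ioc_subset_Icc_self
  have hswap := intervalIntegral_intervalIntegral_swap hGint
  have hL : (∫ s in (0 : ℝ)..t, ∫ r in (0 : ℝ)..s, F s r) =
      ∫ s in (0 : ℝ)..t, ∫ r in (0 : ℝ)..t, G s r := by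
    refine intervalIntegral.integral_congr fun s hs => ?_
    rw [uIcc_of_le ht] at hs
    rw [intervalIntegral.integral_of_le hs.1, intervalIntegral.integral_of_le ht,
      integral_Ioc_eq_integral_Ioo]
    have : ∀ r, G s r = (Iio s).indicator (F s) r := fun r => by simp [hG, indicator]
    simp only [this]
    rw [setIntegral_indicator measurableSet_Iio]
    congr 2
    ext r
    simp only [mem_Ioo, mem_inter_iff, mem_Ioc, mem_Iio]
    exact ⟨fun h => ⟨⟨h.1, by linarith [h.2, hs.2]⟩, h.2⟩, fun h => ⟨h.1.1, h.2⟩⟩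
  have hR : (∫ r in (0 : ℝ)..t, ∫ s in r..t, F s r) =
      ∫ r in (0 : ℝ)..t, ∫ s in (0 : ℝ)..t, G s r := by
    refine intervalIntegral.integral_congr fun r hr => ?_
    rw [uIcc_of_le ht] at hr
    rw [intervalIntegral.integral_of_le hr.2, intervalIntegral.integral_of_le ht]
    have : ∀ s, G s r = (Ioi r).indicator (fun s => F s r) s := fun s => by simp [hG, indicator]
    simp only [this]
    rw [setIntegral_indicator measurableSet_Ioi]
    congr 2
    ext s
    simp only [mem_inter_iff, mem_Ioc, mem_Ioi]
    exact ⟨fun h => ⟨⟨by linarith [h.1, hr.1], h.2⟩, h.1⟩, fun h => ⟨h.2, h.1.2⟩⟩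
  rw [hL, hR, hswap]

/-- Fubini on the triangle 0 ≤ r ≤ s ≤ t followed by the shift s ↦ s - r. The last factor need only
be integrable because it will be a control or an input. -/
theorem conv_assoc {a b f : ℝ → ℝ} (ha : Continuous a) (hb : Continuous b) {t : ℝ} (ht : 0 ≤ t)
    (hf : IntegrableOn f (Icc 0 t)) : conv a (conv b f) t = conv (conv a b) f t := by
  have h1 : conv a (conv b f) t =
      ∫ s in (0 : ℝ)..t, ∫ r in (0 : ℝ)..s, a (t - s) * b (s - r) * f r := by
    refine intervalIntegral.integral_congr fun s _ => ?_
    simp only [conv]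
    rw [← intervalIntegral.integral_const_mul]
    exact intervalIntegral.integral_congr fun r _ => by ring
  rw [h1, integral_triangle_swap (F := fun s r => a (t - s) * b (s - r) * f r) ht]
  · refine intervalIntegral.integral_congr fun r _ => ?_
    simp only [conv]
    rw [intervalIntegral.integral_mul_const]
    congr 1
    have := intervalIntegral.integral_comp_sub_right (a := r) (b := t)
      (fun s => a (t - r - s) * b s) r
    simp only [sub_self] at this
    rw [← this]
    refine intervalIntegral.integral_congr fun s _ => ?_
    congr 2
    ring
  · have h2 : IntegrableOn (fun p : ℝ × ℝ => f p.2) (Icc 0 t ×ˢ Icc 0 t) := by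
      have : Integrable (fun p : ℝ × ℝ => f p.2)
          ((volume.restrict (Icc 0 t)).prod (volume.restrict (Icc 0 t))) :=
        Integrable.comp_snd hf _
      rwa [Measure.prod_restrict] at this
    have h3 : ContinuousOn (fun p : ℝ × ℝ => a (t - p.1) * b (p.1 - p.2)) (Icc 0 t ×ˢ Icc 0 t) := by
      fun_prop
    exact IntegrableOn.continuousOn_mul h3 h2 (isCompact_Icc.prod isCompact_Icc)

theorem conv_comm (a b : ℝ → ℝ) (t : ℝ) : conv a b t = conv b a t := by
  have := intervalIntegral.integral_comp_sub_left (a := 0) (b := t)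
      (fun s => b (t - s) * a s) t
  simp only [sub_self, sub_zero] at this
  rw [conv, conv, ← this]
  refine intervalIntegral.integral_congr fun s _ => ?_
  simp only [sub_sub_cancel]
  ring

theorem continuous_primitive_of_continuous {a : ℝ → ℝ} (ha : Continuous a) :
    Continuous fun t => ∫ s in (0 : ℝ)..t, a s :=
  intervalIntegral.continuous_primitive (fun _ _ => ha.intervalIntegrable _ _) 0

theorem continuous_conv {a b : ℝ → ℝ} (ha : Continuous a) (hb : Continuous b) :
    Continuous (conv a b) := by
  unfold conv
  exact intervalIntegral.continuous_parametric_intervalIntegral_of_continuous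
    (f := fun t s => a (t - s) * b s) (by fun_prop) continuous_id

theorem conv_one (b : ℝ → ℝ) (t : ℝ) : conv (fun _ => 1) b t = ∫ s in (0 : ℝ)..t, b s := by
  simp [conv]

theorem conv_zero (a b : ℝ → ℝ) : conv a b 0 = 0 := by simp [conv]

theorem conv_sum {ι : Type*} (F : Finset ι) (a : ℝ → ℝ) (w : ι → ℝ) (b : ι → ℝ → ℝ)
    (ha : Continuous a) (hb : ∀ i ∈ F, Continuous (b i)) (t : ℝ) :
    conv a (fun s => ∑ i ∈ F, w i * b i s) t = ∑ i ∈ F, w i * conv a (b i) t := by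
  simp only [conv, Finset.mul_sum]
  rw [intervalIntegral.integral_finsetSum]
  · refine Finset.sum_congr rfl fun i _ => ?_
    rw [← intervalIntegral.integral_const_mul]
    exact intervalIntegral.integral_congr fun s _ => by ring
  · intro i hi
    have := hb i hi
    exact Continuous.intervalIntegrable (by fun_prop) _ _

theorem conv_congr {a a' b b' : ℝ → ℝ} {t : ℝ} (ht : 0 ≤ t)
    (ha : ∀ s ∈ Icc 0 t, a s = a' s) (hb : ∀ s ∈ Icc 0 t, b s = b' s) :
    conv a b t = conv a' b' t := by
  refine intervalIntegral.integral_congr fun s hs => ?_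
  rw [uIcc_of_le ht] at hs
  rw [ha _ ⟨by linarith [hs.2], by linarith [hs.1]⟩, hb _ hs]

/-! ### Grönwall, Cauchy–Schwarz and elementary bounds. -/

/-- Grönwall's inequality in differential form. -/
theorem le_mul_exp_of_deriv_le {f f' : ℝ → ℝ} {K a b : ℝ} (hf : ContinuousOn f (Icc a b))
    (hd : ∀ x ∈ Ioo a b, HasDerivAt f (f' x) x) (hle : ∀ x ∈ Ioo a b, f' x ≤ K * f x) :
    ∀ x ∈ Icc a b, f x ≤ f a * Real.exp (K * (x - a)) := by
  have hanti : AntitoneOn (fun x => f x * Real.exp (-K * (x - a))) (Icc a b) := by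
    have hder : ∀ x ∈ Ioo a b, HasDerivAt (fun x => f x * Real.exp (-K * (x - a)))
        ((f' x - K * f x) * Real.exp (-K * (x - a))) x := by
      intro x hx
      have h2 : HasDerivAt (fun x : ℝ => Real.exp (-K * (x - a)))
          (Real.exp (-K * (x - a)) * (-K * 1)) x :=
        (((hasDerivAt_id x).sub_const a).const_mul (-K)).exp
      exact ((hd x hx).mul h2).congr_deriv (by ring)
    refine antitoneOn_of_deriv_nonpos (convex_Icc a b) (by fun_prop) ?_ ?_
    · rw [interior_Icc]
      exact fun x hx => (hder x hx).differentiableAt.differentiableWithinAt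
    · rw [interior_Icc]
      intro x hx
      rw [(hder x hx).deriv]
      exact mul_nonpos_of_nonpos_of_nonneg (by linarith [hle x hx]) (Real.exp_pos _).le
  intro x hx
  have h := hanti (left_mem_Icc.2 (hx.1.trans hx.2)) hx hx.1
  simp only [sub_self, mul_zero, Real.exp_zero, mul_one] at h
  calc f x = f x * Real.exp (-K * (x - a)) * Real.exp (K * (x - a)) := by
        rw [mul_assoc, ← Real.exp_add]; simp
    _ ≤ _ := by gcongr

/-- Grönwall's inequality in integral form. -/
theorem le_add_mul_integral_of_le_integral {f a : ℝ → ℝ} {C T : ℝ} (hf : Continuous f)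
    (ha : Continuous a) (hC : 0 ≤ C) (ha0 : ∀ t, 0 ≤ a t)
    (h : ∀ t ∈ Icc 0 T, f t ≤ a t + C * ∫ s in (0 : ℝ)..t, f s) :
    ∀ t ∈ Icc 0 T, f t ≤ a t + C * Real.exp (C * T) * ∫ s in (0 : ℝ)..t, a s := by
  -- By the hypothesis on f the derivative is at most (exp(-Ct) - 1) a(t), which is nonpositive.
  have hanti : AntitoneOn (fun t => Real.exp (-C * t) * (∫ s in (0 : ℝ)..t, f s) -
      ∫ s in (0 : ℝ)..t, a s) (Icc 0 T) := by
    have hder : ∀ t, HasDerivAt (fun t => Real.exp (-C * t) * (∫ s in (0 : ℝ)..t, f s) -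
      ∫ s in (0 : ℝ)..t, a s) (Real.exp (-C * t) * (f t - C * ∫ s in (0 : ℝ)..t, f s) - a t) t := by
      intro t
      have h1 := intervalIntegral.integral_hasDerivAt_right (hf.intervalIntegrable 0 t)
        (hf.stronglyMeasurableAtFilter _ _) hf.continuousAt
      have h2 := intervalIntegral.integral_hasDerivAt_right (ha.intervalIntegrable 0 t)
        (ha.stronglyMeasurableAtFilter _ _) ha.continuousAt
      have h3 : HasDerivAt (fun x : ℝ => Real.exp (-C * x)) (Real.exp (-C * t) * (-C * 1)) t :=
        ((hasDerivAt_id t).const_mul (-C)).exp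
      exact ((h3.mul h1).sub h2).congr_deriv (by ring)
    refine antitoneOn_of_deriv_nonpos (convex_Icc 0 T)
      (fun t _ => (hder t).continuousAt.continuousWithinAt)
      (fun t _ => (hder t).differentiableAt.differentiableWithinAt) ?_
    rw [interior_Icc]
    intro t ht
    rw [(hder t).deriv]
    have h1 := h t ⟨ht.1.le, ht.2.le⟩
    have h2 : Real.exp (-C * t) ≤ 1 := Real.exp_le_one_iff.2 (by nlinarith [ht.1])
    have h3 : Real.exp (-C * t) * (f t - C * ∫ s in (0 : ℝ)..t, f s) ≤ Real.exp (-C * t) * a t :=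
      mul_le_mul_of_nonneg_left (by linarith) (Real.exp_pos _).le
    have h4 := mul_le_mul_of_nonneg_right h2 (ha0 t)
    linarith
  intro t ht
  have h0 := hanti (left_mem_Icc.2 (ht.1.trans ht.2)) ht ht.1
  simp only [intervalIntegral.integral_same, mul_zero, sub_zero] at h0
  have hint : 0 ≤ ∫ s in (0 : ℝ)..t, a s := intervalIntegral.integral_nonneg ht.1 fun s _ => ha0 s
  have h5 : (∫ s in (0 : ℝ)..t, f s) ≤ Real.exp (C * T) * ∫ s in (0 : ℝ)..t, a s := by
    calc (∫ s in (0 : ℝ)..t, f s)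
        = Real.exp (C * t) * (Real.exp (-C * t) * ∫ s in (0 : ℝ)..t, f s) := by
          rw [← mul_assoc, ← Real.exp_add]; simp
      _ ≤ Real.exp (C * t) * ∫ s in (0 : ℝ)..t, a s := by
          gcongr; linarith
      _ ≤ _ := by
          gcongr; exact ht.2
  have := h t ht
  nlinarith

theorem sq_integral_mul_le {α : Type*} [MeasurableSpace α] {μ : Measure α} {f g : α → ℝ}
    (hf : MemLp f 2 μ) (hg : MemLp g 2 μ) :
    (∫ x, f x * g x ∂μ) ^ 2 ≤ (∫ x, f x ^ 2 ∂μ) * ∫ x, g x ^ 2 ∂μ := by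
  have hfg : Integrable (fun x => f x * g x) μ := hf.integrable_mul hg
  have hff : Integrable (fun x => f x ^ 2) μ := hf.integrable_sq
  have hgg : Integrable (fun x => g x ^ 2) μ := hg.integrable_sq
  have key : ∀ s : ℝ, 0 ≤ (∫ x, g x ^ 2 ∂μ) * (s * s) + (-2 * ∫ x, f x * g x ∂μ) * s +
      ∫ x, f x ^ 2 ∂μ := by
    intro s
    have h0 : 0 ≤ ∫ x, (f x - s * g x) ^ 2 ∂μ := integral_nonneg fun x => sq_nonneg _
    have h1 : (∫ x, (f x - s * g x) ^ 2 ∂μ) =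
        ∫ x, (f x ^ 2 - 2 * s * (f x * g x)) + s * s * g x ^ 2 ∂μ :=
      integral_congr_ae (ae_of_all _ fun x => by simp only; ring)
    have h2 : Integrable (fun x => f x ^ 2 - 2 * s * (f x * g x)) μ := hff.sub (hfg.const_mul _)
    rw [h1, integral_add h2 (hgg.const_mul _), integral_sub hff (hfg.const_mul _),
      integral_const_mul, integral_const_mul] at h0
    linarith
  have := discrim_le_zero key
  rw [discrim] at this
  nlinarith

theorem memLp_two_of_continuous {f : ℝ → ℝ} (hf : Continuous f) (a b : ℝ) :
    MemLp f 2 (volume.restrict (Ioc a b)) := by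
  refine (memLp_two_iff_integrable_sq hf.aestronglyMeasurable).2 ?_
  exact ((hf.pow 2).continuousOn.integrableOn_compact isCompact_Icc).mono_set Ioc_subset_Icc_self

theorem sq_integral_mul_le_of_continuous {f g : ℝ → ℝ} (hf : Continuous f) (hg : Continuous g)
    {a b : ℝ} (hab : a ≤ b) :
    (∫ x in a..b, f x * g x) ^ 2 ≤ (∫ x in a..b, f x ^ 2) * ∫ x in a..b, g x ^ 2 := by
  simp only [intervalIntegral.integral_of_le hab]
  exact sq_integral_mul_le (memLp_two_of_continuous hf a b) (memLp_two_of_continuous hg a b)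

theorem sq_integral_abs_le {q : ℝ → ℝ} (hq : Continuous q) {t : ℝ} (ht : 0 ≤ t) :
    (∫ s in (0 : ℝ)..t, |q s|) ^ 2 ≤ t * ∫ s in (0 : ℝ)..t, q s ^ 2 := by
  have := sq_integral_mul_le_of_continuous (continuous_const (y := (1 : ℝ))) hq.abs ht
  simpa using this

theorem abs_conv_le {a b : ℝ → ℝ} (hb : Continuous b) {t K C : ℝ}
    (hC : ∀ s ∈ Icc 0 K, |a s| ≤ C) (ht : t ∈ Icc 0 K) :
    |conv a b t| ≤ C * ∫ s in (0 : ℝ)..t, |b s| := by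
  rw [conv, ← intervalIntegral.integral_const_mul, ← Real.norm_eq_abs]
  refine intervalIntegral.norm_integral_le_of_norm_le ht.1 ?_
    (Continuous.intervalIntegrable (by fun_prop) _ _)
  refine ae_of_all _ fun s hs => ?_
  rw [Real.norm_eq_abs, abs_mul]
  exact mul_le_mul_of_nonneg_right (hC _ ⟨by linarith [hs.2], by linarith [hs.1, ht.2]⟩)
    (abs_nonneg _)

theorem exists_abs_le_of_continuousOn {f : ℝ → ℝ} {a b : ℝ} (hf : ContinuousOn f (Icc a b)) :
    ∃ C, 0 ≤ C ∧ ∀ x ∈ Icc a b, |f x| ≤ C := by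
  obtain ⟨C, hC⟩ := isCompact_Icc.exists_bound_of_continuousOn hf
  exact ⟨max C 0, le_max_right _ _, fun x hx => (hC x hx).trans (le_max_left _ _)⟩

/-! ### The memory kernel and Volterra bounds. -/

theorem memoryPrimitive_eq (M : ℝ → ℝ) (t : ℝ) :
    memoryPrimitive M t = 1 + conv (fun _ => 1) M t := by
  rw [conv_one, memoryPrimitive]

theorem continuous_memoryPrimitive {M : ℝ → ℝ} (hM : Continuous M) :
    Continuous (memoryPrimitive M) :=
  continuous_const.add (continuous_primitive_of_continuous hM)

theorem conv_add_left {a a' b : ℝ → ℝ} {t : ℝ}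
    (h : IntervalIntegrable (fun s => a (t - s) * b s) volume 0 t)
    (h' : IntervalIntegrable (fun s => a' (t - s) * b s) volume 0 t) :
    conv (fun s => a s + a' s) b t = conv a b t + conv a' b t := by
  simp only [conv, add_mul]
  exact intervalIntegral.integral_add h h'

theorem conv_const_left (k : ℝ) (b : ℝ → ℝ) (t : ℝ) :
    conv (fun _ => k) b t = k * ∫ s in (0 : ℝ)..t, b s := by
  simp [conv]

theorem intervalIntegrable_conv_integrand {a b : ℝ → ℝ} {t : ℝ} (ha : Continuous a) (ht : 0 ≤ t)
    (hb : IntegrableOn b (Icc 0 t)) :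
    IntervalIntegrable (fun s => a (t - s) * b s) volume 0 t := by
  rw [intervalIntegrable_iff_integrableOn_Icc_of_le ht]
  exact IntegrableOn.continuousOn_mul (by fun_prop) hb isCompact_Icc

/-- `N * f = 1 * (f + M * f)`. -/
theorem conv_memoryPrimitive {M f : ℝ → ℝ} (hM : Continuous M) {t : ℝ} (ht : 0 ≤ t)
    (hf : IntegrableOn f (Icc 0 t)) :
    conv (memoryPrimitive M) f t = (∫ s in (0 : ℝ)..t, f s) + ∫ s in (0 : ℝ)..t, conv M f s := by
  have h1 : memoryPrimitive M = fun s => 1 + conv (fun _ => 1) M s :=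
    funext fun s => memoryPrimitive_eq M s
  rw [h1, conv_add_left (intervalIntegrable_conv_integrand continuous_const ht hf)
    (intervalIntegrable_conv_integrand (continuous_conv continuous_const hM) ht hf), conv_one,
    ← conv_assoc continuous_const hM ht hf, conv_one]

theorem hasDerivAt_primitive {a : ℝ → ℝ} (ha : Continuous a) (t : ℝ) :
    HasDerivAt (fun t => ∫ s in (0 : ℝ)..t, a s) (a t) t :=
  intervalIntegral.integral_hasDerivAt_right (ha.intervalIntegrable 0 t)
    (ha.stronglyMeasurableAtFilter _ _) ha.continuousAt

theorem hasDerivAt_conv_memoryPrimitive {M X : ℝ → ℝ} (hM : Continuous M) (hX : Continuous X)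
    {t : ℝ} (ht : 0 < t) :
    HasDerivAt (conv (memoryPrimitive M) X) (X t + conv M X t) t := by
  refine ((hasDerivAt_primitive hX t).add
    (hasDerivAt_primitive (continuous_conv hM hX) t)).congr_of_eventuallyEq ?_
  filter_upwards [lt_mem_nhds ht] with s hs
  exact conv_memoryPrimitive hM hs.le (hX.continuousOn.integrableOn_compact isCompact_Icc)

/-- Associativity moves the integration in N = 1 + 1*M onto X. The result is a Volterra equation of
the second kind for the primitive of X, to which Grönwall applies. -/
theorem conv_memoryPrimitive_eq_add_conv {M X : ℝ → ℝ} (hM : Continuous M) (hX : Continuous X)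
    {t : ℝ} (ht : 0 ≤ t) :
    conv (memoryPrimitive M) X t =
      (∫ s in (0 : ℝ)..t, X s) + conv M (fun t => ∫ s in (0 : ℝ)..t, X s) t := by
  have hXi : IntegrableOn X (Icc 0 t) := hX.continuousOn.integrableOn_compact isCompact_Icc
  rw [conv_memoryPrimitive hM ht hXi, ← conv_one (conv M X), conv_assoc continuous_const hM ht hXi,
    funext fun s => conv_comm (fun _ => 1) M s, ← conv_assoc hM continuous_const ht hXi]
  simp only [funext fun s => conv_one X s]

/-- Integration by parts: the derivative falls on the kernel, and X enters only through its
primitive. -/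
theorem conv_eq_mul_add_conv {M M₁ X : ℝ → ℝ} (hM₁ : Continuous M₁)
    (h : ∀ t, 0 ≤ t → M t = M 0 + ∫ s in (0 : ℝ)..t, M₁ s) (hX : Continuous X)
    {t : ℝ} (ht : 0 ≤ t) :
    conv M X t = M 0 * (∫ s in (0 : ℝ)..t, X s) +
      conv M₁ (fun t => ∫ s in (0 : ℝ)..t, X s) t := by
  have hXi : IntegrableOn X (Icc 0 t) := hX.continuousOn.integrableOn_compact isCompact_Icc
  have h1 : conv M X t = conv (fun s => M 0 + conv (fun _ => 1) M₁ s) X t :=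
    conv_congr ht (fun s hs => by rw [h s hs.1, conv_one]) fun _ _ => rfl
  rw [h1, conv_add_left (intervalIntegrable_conv_integrand continuous_const ht hXi)
    (intervalIntegrable_conv_integrand (continuous_conv continuous_const hM₁) ht hXi),
    conv_const_left, funext fun s => conv_comm (fun _ => 1) M₁ s,
    ← conv_assoc hM₁ continuous_const ht hXi]
  simp only [funext fun s => conv_one X s]

/-- The primitive of `X` and `M * X` are controlled by `N * X`. -/
theorem exists_volterra_bounds {M M₁ : ℝ → ℝ} (hM : Continuous M) (hM₁ : Continuous M₁)
    (h : ∀ t, 0 ≤ t → M t = M 0 + ∫ s in (0 : ℝ)..t, M₁ s) (K : ℝ) :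
    ∃ C, 0 ≤ C ∧ ∀ X, Continuous X → ∀ t ∈ Icc 0 K,
      (∫ s in (0 : ℝ)..t, X s) ^ 2 ≤ C * (conv (memoryPrimitive M) X t ^ 2 +
        ∫ s in (0 : ℝ)..t, conv (memoryPrimitive M) X s ^ 2) ∧
      conv M X t ^ 2 ≤ C * (conv (memoryPrimitive M) X t ^ 2 +
        ∫ s in (0 : ℝ)..t, conv (memoryPrimitive M) X s ^ 2) := by
  rcases lt_or_ge K 0 with hK | hK
  · exact ⟨0, le_rfl, fun X _ t ht => absurd (ht.1.trans ht.2) (not_le.2 hK)⟩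
  obtain ⟨C₀, hC₀, hMb⟩ := exists_abs_le_of_continuousOn (hM.continuousOn (s := Icc 0 K))
  obtain ⟨C₁, hC₁, hM₁b⟩ := exists_abs_le_of_continuousOn (hM₁.continuousOn (s := Icc 0 K))
  -- With I the primitive of X and q = N*X, D is the Grönwall constant in |I| ≤ |q| + D ∫|q|. The
  -- constant B below is generous, so that both I and M*X are bounded by B (|q| + ∫|q|).
  set D := C₀ * Real.exp (C₀ * K) with hD
  have hD0 : 0 ≤ D := by positivity
  set B := C₀ + C₀ * D + C₁ * (1 + D * K) + 1 + D with hB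
  have hB0 : 0 ≤ B := by positivity
  refine ⟨2 * B ^ 2 * (1 + K), by positivity, fun X hX => ?_⟩
  set q := conv (memoryPrimitive M) X with hq
  have hqc : Continuous q := continuous_conv (continuous_memoryPrimitive hM) hX
  set I : ℝ → ℝ := fun t => ∫ s in (0 : ℝ)..t, X s with hI
  have hIc : Continuous I := continuous_primitive_of_continuous hX
  have hqI : ∀ t ∈ Icc 0 K, q t = I t + conv M I t := fun t ht =>
    conv_memoryPrimitive_eq_add_conv hM hX ht.1
  have hIb : ∀ t ∈ Icc 0 K, |I t| ≤ |q t| + D * ∫ s in (0 : ℝ)..t, |q s| := by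
    refine le_add_mul_integral_of_le_integral hIc.abs hqc.abs hC₀ (fun t => abs_nonneg _) ?_
    intro t ht
    have h1 := abs_conv_le hIc hMb ht
    have h2 : I t = q t - conv M I t := by linarith [hqI t ht]
    calc |I t| = |q t - conv M I t| := by rw [← h2]
      _ ≤ |q t| + |conv M I t| := abs_sub _ _
      _ ≤ _ := by linarith
  have hsq : ∀ t ∈ Icc 0 K, ∀ y : ℝ, |y| ≤ B * (|q t| + ∫ s in (0 : ℝ)..t, |q s|) →
      y ^ 2 ≤ 2 * B ^ 2 * (1 + K) * (q t ^ 2 + ∫ s in (0 : ℝ)..t, q s ^ 2) := by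
    intro t ht y hy
    have hJ := sq_integral_abs_le hqc ht.1
    have hJ0 : 0 ≤ ∫ s in (0 : ℝ)..t, q s ^ 2 :=
      intervalIntegral.integral_nonneg ht.1 fun s _ => sq_nonneg _
    set J := ∫ s in (0 : ℝ)..t, |q s|
    set J₂ := ∫ s in (0 : ℝ)..t, q s ^ 2
    have h1 : y ^ 2 ≤ (B * (|q t| + J)) ^ 2 := by
      rw [← sq_abs y]
      exact pow_le_pow_left₀ (abs_nonneg _) hy 2
    have h2 : (|q t| + J) ^ 2 ≤ 2 * (q t ^ 2 + J ^ 2) := by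
      rw [← sq_abs (q t)]; nlinarith [sq_nonneg (|q t| - J)]
    have h3 : t * J₂ ≤ K * J₂ := mul_le_mul_of_nonneg_right ht.2 hJ0
    have h4 : (|q t| + J) ^ 2 ≤ 2 * ((1 + K) * (q t ^ 2 + J₂)) := by
      nlinarith [mul_nonneg hK (sq_nonneg (q t))]
    calc y ^ 2 ≤ B ^ 2 * (|q t| + J) ^ 2 := by rw [← mul_pow]; exact h1
      _ ≤ B ^ 2 * (2 * ((1 + K) * (q t ^ 2 + J₂))) := by gcongr
      _ = _ := by ring
  intro t ht
  have hJ0 : 0 ≤ ∫ s in (0 : ℝ)..t, |q s| :=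
    intervalIntegral.integral_nonneg ht.1 fun s _ => abs_nonneg _
  have hIt := hIb t ht
  constructor
  · refine hsq t ht _ (hIt.trans ?_)
    have : 0 ≤ C₀ + C₀ * D + C₁ * (1 + D * K) := by positivity
    nlinarith [abs_nonneg (q t)]
  · refine hsq t ht _ ?_
    have h1 : conv M X t = M 0 * I t + conv M₁ I t := conv_eq_mul_add_conv hM₁ h hX ht.1
    have h2 := abs_conv_le hIc hM₁b ht
    have h3 : |M 0| ≤ C₀ := hMb 0 (left_mem_Icc.2 hK)
    have h4 : (∫ s in (0 : ℝ)..t, |I s|) ≤ (1 + D * K) * ∫ s in (0 : ℝ)..t, |q s| := by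
      calc (∫ s in (0 : ℝ)..t, |I s|)
          ≤ ∫ s in (0 : ℝ)..t, (|q s| + D * ∫ r in (0 : ℝ)..t, |q r|) := by
            refine intervalIntegral.integral_mono_on ht.1 (hIc.abs.intervalIntegrable _ _)
              (Continuous.intervalIntegrable (by fun_prop) _ _) fun s hs => ?_
            refine (hIb s ⟨hs.1, hs.2.trans ht.2⟩).trans ?_
            gcongr
            exact intervalIntegral.integral_mono_interval le_rfl hs.1 hs.2
              (ae_of_all _ fun _ => abs_nonneg _) (hqc.abs.intervalIntegrable _ _)
        _ = (1 + D * t) * ∫ s in (0 : ℝ)..t, |q s| := by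
            rw [intervalIntegral.integral_add (hqc.abs.intervalIntegrable _ _)
              (by simp), intervalIntegral.integral_const]
            simp only [sub_zero, smul_eq_mul]
            ring
        _ ≤ _ := by
            gcongr
            exact ht.2
    rw [h1]
    calc |M 0 * I t + conv M₁ I t| ≤ |M 0| * |I t| + |conv M₁ I t| := by
          rw [← abs_mul]; exact abs_add_le _ _
      _ ≤ C₀ * (|q t| + D * ∫ s in (0 : ℝ)..t, |q s|) +
          C₁ * ((1 + D * K) * ∫ s in (0 : ℝ)..t, |q s|) := by
          gcongr
          exact h2.trans (by gcongr)
      _ ≤ _ := by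
          have h5 : 0 ≤ C₀ * D + C₁ * (1 + D * K) + 1 + D := by positivity
          have h6 : 0 ≤ C₀ + 1 + D := by positivity
          rw [hB]
          nlinarith [mul_nonneg h5 (abs_nonneg (q t)), mul_nonneg h6 hJ0]

/-! ### The modal equation: energy bound and existence. -/

section

/-- The coefficients depending on time, extended to the whole line: `P` is of class `C¹` on the
positive half line with derivative `P₁` and bounded below, and `M` is of class `C¹` there with
derivative `M₁`. -/
structure TimeData (P P₁ M M₁ : ℝ → ℝ) (p₀ : ℝ) : Prop where
  contP : Continuous P
  contP₁ : Continuous P₁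
  deriv : ∀ t, 0 < t → HasDerivAt P (P₁ t) t
  pos : 0 < p₀
  lower : ∀ t, p₀ ≤ P t
  contM : Continuous M
  contM₁ : Continuous M₁
  M_eq : ∀ t, 0 ≤ t → M t = M 0 + ∫ s in (0 : ℝ)..t, M₁ s

/-- `z' = -l² P(T - t) (N * z)` on `(0, T)` for a continuous function `z` on the line. -/
structure ModalSol (P M : ℝ → ℝ) (l T : ℝ) (z : ℝ → ℝ) : Prop where
  cont : Continuous z
  deriv : ∀ t ∈ Ioo 0 T, HasDerivAt z (-l ^ 2 * P (T - t) * conv (memoryPrimitive M) z t) t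

variable {P P₁ M M₁ : ℝ → ℝ} {p₀ : ℝ}

theorem TimeData.P_pos (h : TimeData P P₁ M M₁ p₀) (t : ℝ) : 0 < P t := h.pos.trans_le (h.lower t)

theorem TimeData.hasDerivAt_reverse (h : TimeData P P₁ M M₁ p₀) {T t : ℝ} (ht : t < T) :
    HasDerivAt (fun t => P (T - t)) (-P₁ (T - t)) t := by
  have := (h.deriv (T - t) (by linarith)).comp t ((hasDerivAt_id t).const_sub T)
  exact this.congr_deriv (by ring)

/-- Uniform energy bound for the modal equation. -/
theorem TimeData.exists_energy_bound (h : TimeData P P₁ M M₁ p₀) (S : ℝ) :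
    ∃ C, 0 ≤ C ∧ ∀ l, ∀ T ∈ Icc 0 S, ∀ z, ModalSol P M l T z → ∀ t ∈ Icc 0 T,
      z t ^ 2 + l ^ 2 * P (T - t) * conv (memoryPrimitive M) z t ^ 2 ≤ C * z 0 ^ 2 := by
  obtain ⟨A, hA, hPb⟩ := exists_abs_le_of_continuousOn (h.contP.continuousOn (s := Icc 0 S))
  obtain ⟨A₁, hA₁, hP₁b⟩ := exists_abs_le_of_continuousOn (h.contP₁.continuousOn (s := Icc 0 S))
  obtain ⟨B, hB, hv⟩ := exists_volterra_bounds h.contM h.contM₁ h.M_eq S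
  have hp := h.pos
  set D := (A₁ + A + A * B) / p₀ with hD
  have hD0 : 0 ≤ D := by positivity
  refine ⟨Real.exp ((D + 1) * S), (Real.exp_pos _).le, fun l T hT z hz t ht => ?_⟩
  set q := conv (memoryPrimitive M) z with hq
  have hqc : Continuous q := continuous_conv (continuous_memoryPrimitive h.contM) hz.cont
  set e : ℝ → ℝ := fun t => z t ^ 2 + l ^ 2 * P (T - t) * q t ^ 2 with he
  have hzc := hz.cont
  have hPc := h.contP
  have hec : Continuous e := by fun_prop
  have he0 : ∀ t, 0 ≤ e t := fun t => by have := (h.P_pos (T - t)).le; positivity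
  have hqe : ∀ t, l ^ 2 * q t ^ 2 ≤ e t / p₀ := by
    intro t
    rw [le_div_iff₀ hp]
    have h1 := mul_le_mul_of_nonneg_right (h.lower (T - t)) (by positivity : 0 ≤ l ^ 2 * q t ^ 2)
    simp only [he]
    nlinarith [sq_nonneg (z t)]
  -- The bound on M*z involves the past of q as well as its present value. Adding the past integral
  -- of e makes the differential inequality close.
  set w : ℝ → ℝ := fun t => e t + ∫ s in (0 : ℝ)..t, e s with hw
  have hwc : Continuous w := hec.add (continuous_primitive_of_continuous hec)
  have hint : ∀ t, 0 ≤ t → 0 ≤ ∫ s in (0 : ℝ)..t, e s := fun t ht =>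
    intervalIntegral.integral_nonneg ht fun s _ => he0 s
  -- The terms ∓2 l² P z q coming from z' = -l² P q and q' = z + M*z cancel. The remaining ones are
  -- controlled through l² q² ≤ e/p₀ with constants independent of l.
  have hwd : ∀ t ∈ Ioo 0 T, HasDerivAt w
      (l ^ 2 * (-P₁ (T - t)) * q t ^ 2 + 2 * l ^ 2 * P (T - t) * q t * conv M z t + e t) t := by
    intro t ht
    have h1 := hz.deriv t ht
    have h2 := hasDerivAt_conv_memoryPrimitive h.contM hz.cont ht.1
    have h3 := h.hasDerivAt_reverse ht.2
    have h4 := ((h1.pow 2).add ((h3.const_mul (l ^ 2)).mul (h2.pow 2))).add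
      (hasDerivAt_primitive hec t)
    refine h4.congr_deriv ?_
    simp only [← hq, Pi.pow_apply]
    ring
  have hle : ∀ t ∈ Ioo 0 T, l ^ 2 * (-P₁ (T - t)) * q t ^ 2 +
      2 * l ^ 2 * P (T - t) * q t * conv M z t + e t ≤ (D + 1) * w t := by
    intro t ht
    have htS : T - t ∈ Icc 0 S := ⟨by linarith [ht.2], by linarith [ht.1, hT.2]⟩
    have h1 := (hv z hz.cont t ⟨ht.1.le, by linarith [ht.2, hT.2]⟩).2
    have h2 : -P₁ (T - t) ≤ A₁ := (neg_le_abs _).trans (hP₁b _ htS)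
    have h3 : P (T - t) ≤ A := (le_abs_self _).trans (hPb _ htS)
    have h4 : (∫ s in (0 : ℝ)..t, l ^ 2 * q s ^ 2) ≤ ∫ s in (0 : ℝ)..t, e s / p₀ :=
      intervalIntegral.integral_mono_on ht.1.le (Continuous.intervalIntegrable (by fun_prop) _ _)
        (Continuous.intervalIntegrable (by fun_prop) _ _) fun s _ => hqe s
    rw [intervalIntegral.integral_const_mul, intervalIntegral.integral_div] at h4
    set J := ∫ s in (0 : ℝ)..t, q s ^ 2
    have hl := sq_nonneg l
    have hq2 := mul_nonneg hl (sq_nonneg (q t))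
    have h5 : l ^ 2 * (-P₁ (T - t)) * q t ^ 2 ≤ A₁ * (l ^ 2 * q t ^ 2) := by nlinarith
    have h6 : 2 * l ^ 2 * P (T - t) * q t * conv M z t ≤
        A * (l ^ 2 * q t ^ 2 + l ^ 2 * conv M z t ^ 2) := by
      have hP := (h.P_pos (T - t)).le
      calc 2 * l ^ 2 * P (T - t) * q t * conv M z t
          ≤ P (T - t) * (l ^ 2 * q t ^ 2 + l ^ 2 * conv M z t ^ 2) := by
            nlinarith [mul_nonneg (mul_nonneg hP hl) (sq_nonneg (q t - conv M z t))]
        _ ≤ _ := mul_le_mul_of_nonneg_right h3 (by positivity)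
    have h7 : l ^ 2 * conv M z t ^ 2 ≤ B * (l ^ 2 * q t ^ 2 + l ^ 2 * J) := by nlinarith
    have h8 : l ^ 2 * q t ^ 2 + l ^ 2 * J ≤ w t / p₀ := by
      have := hqe t
      simp only [hw, add_div]
      linarith
    have h9 : l ^ 2 * q t ^ 2 ≤ w t / p₀ := by
      refine (hqe t).trans (div_le_div_of_nonneg_right ?_ hp.le)
      simp only [hw]; linarith [hint t ht.1.le]
    have h10 : e t ≤ w t := by simp only [hw]; linarith [hint t ht.1.le]
    have h11 : D * w t = A₁ * (w t / p₀) + A * (w t / p₀ + B * (w t / p₀)) := by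
      rw [hD]; ring
    have h12 : A₁ * (l ^ 2 * q t ^ 2) ≤ A₁ * (w t / p₀) := by gcongr
    have h13 : A * (l ^ 2 * q t ^ 2 + l ^ 2 * conv M z t ^ 2) ≤ A * (w t / p₀ + B * (w t / p₀)) :=
      mul_le_mul_of_nonneg_left (add_le_add h9 (h7.trans (mul_le_mul_of_nonneg_left h8 hB))) hA
    linarith
  have hfin := le_mul_exp_of_deriv_le hwc.continuousOn hwd hle t ht
  have hw0 : w 0 = z 0 ^ 2 := by simp [hw, he, hq, conv_zero]
  rw [hw0, sub_zero] at hfin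
  calc e t ≤ w t := by simp only [hw]; linarith [hint t ht.1]
    _ ≤ _ := hfin
    _ ≤ z 0 ^ 2 * Real.exp ((D + 1) * S) := by
        gcongr
        exact ht.2.trans hT.2
    _ = _ := mul_comm _ _

theorem continuous_parametric_primitive {f : ℝ → ℝ → ℝ → ℝ}
    (hf : Continuous fun p : ℝ × ℝ × ℝ => f p.1 p.2.1 p.2.2) :
    Continuous fun p : ℝ × ℝ => ∫ s in (0 : ℝ)..p.2, f p.1 p.2 s := by
  refine intervalIntegral.continuous_parametric_intervalIntegral_of_continuous
    (f := fun (p : ℝ × ℝ) s => f p.1 p.2 s) ?_ continuous_snd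
  exact hf.comp (f := fun p : (ℝ × ℝ) × ℝ => (p.1.1, p.1.2, p.2)) (by fun_prop)

theorem integral_exp_mul_le {μ : ℝ} (hμ : 0 < μ) (t : ℝ) :
    (∫ s in (0 : ℝ)..t, Real.exp (μ * s)) ≤ Real.exp (μ * t) / μ := by
  rw [intervalIntegral.integral_comp_mul_left (fun x => Real.exp x) hμ.ne', integral_exp]
  simp only [mul_zero, Real.exp_zero, smul_eq_mul]
  rw [inv_mul_eq_div]
  gcongr
  linarith

/-- The Volterra form of the modal equation has a solution which is jointly continuous in the
final time and the time. -/
theorem exists_volterra_solution {P N : ℝ → ℝ} (hP : Continuous P) (hN : Continuous N) (l S : ℝ)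
    (hS : 0 ≤ S) :
    ∃ Z : ℝ → ℝ → ℝ, (Continuous fun p : ℝ × ℝ => Z p.1 p.2) ∧
      ∀ T ∈ Icc 0 S, ∀ t ∈ Icc 0 S,
        Z T t = 1 - l ^ 2 * ∫ r in (0 : ℝ)..t, P (T - r) * conv N (Z T) r := by
  -- T and r run independently over [0, S], without r ≤ T, so T - r ranges over [-S, S].
  obtain ⟨A, hA, hPb⟩ := exists_abs_le_of_continuousOn (hP.continuousOn (s := Icc (-S) S))
  obtain ⟨B, hB, hNb⟩ := exists_abs_le_of_continuousOn (hN.continuousOn (s := Icc 0 S))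
  -- The fixed point is sought for u = exp(-μt) Z. Each of the two nested integrals gains a factor
  -- 1/μ against exp(μt), so the Lipschitz constant is κ/μ², and μ = κ + 2 brings it below 1/2.
  -- Taking u continuous in both T and t gives joint continuity at once.
  set κ := l ^ 2 * A * B with hκ
  have hκ0 : 0 ≤ κ := by positivity
  set μ := κ + 2 with hμ
  have hμ0 : 0 < μ := by linarith
  have hκμ : κ / μ ^ 2 ≤ 1 / 2 := by
    rw [div_le_iff₀ (by positivity)]; nlinarith
  let I := Icc (0 : ℝ) S
  let ext : C(I × I, ℝ) → ℝ → ℝ → ℝ := fun u T t =>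
    u (projIcc 0 S hS T, projIcc 0 S hS t)
  have hext : ∀ u, Continuous fun p : ℝ × ℝ => ext u p.1 p.2 := fun u => by
    refine u.continuous.comp (Continuous.prodMk ?_ ?_)
    · exact continuous_projIcc.comp continuous_fst
    · exact continuous_projIcc.comp continuous_snd
  let Z : C(I × I, ℝ) → ℝ → ℝ → ℝ := fun u T t => Real.exp (μ * t) * ext u T t
  have hZ : ∀ u, Continuous fun p : ℝ × ℝ => Z u p.1 p.2 := fun u =>
    Continuous.mul (by fun_prop) (hext u)
  let Y : C(I × I, ℝ) → ℝ → ℝ → ℝ := fun u T r => conv N (Z u T) r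
  have hY : ∀ u, Continuous fun p : ℝ × ℝ => Y u p.1 p.2 := fun u => by
    refine continuous_parametric_primitive (f := fun T r s => N (r - s) * Z u T s) ?_
    refine Continuous.mul (by fun_prop) ?_
    exact (hZ u).comp (f := fun p : ℝ × ℝ × ℝ => (p.1, p.2.2)) (by fun_prop)
  let Φ : C(I × I, ℝ) → ℝ → ℝ → ℝ := fun u T t =>
    Real.exp (-μ * t) * (1 - l ^ 2 * ∫ r in (0 : ℝ)..t, P (T - r) * Y u T r)
  have hΦ : ∀ u, Continuous fun p : ℝ × ℝ => Φ u p.1 p.2 := fun u => by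
    refine Continuous.mul (by fun_prop) (continuous_const.sub (continuous_const.mul ?_))
    refine continuous_parametric_primitive (f := fun T t r => P (T - r) * Y u T r) ?_
    refine Continuous.mul (by fun_prop) ?_
    exact (hY u).comp (f := fun p : ℝ × ℝ × ℝ => (p.1, p.2.2)) (by fun_prop)
  let F : C(I × I, ℝ) → C(I × I, ℝ) := fun u =>
    ⟨fun p => Φ u p.1 p.2, (hΦ u).comp (f := fun p : I × I => ((p.1 : ℝ), (p.2 : ℝ))) (by fun_prop)⟩
  have hF : ContractingWith (1 / 2) F := by
    refine ⟨by rw [← NNReal.coe_lt_coe]; norm_num, LipschitzWith.of_dist_le_mul fun u v => ?_⟩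
    rw [ContinuousMap.dist_le (by positivity)]
    rintro ⟨⟨T, hT⟩, ⟨t, ht⟩⟩
    set d := dist u v with hd
    have hd0 : 0 ≤ d := dist_nonneg
    have hZd : ∀ s, |Z u T s - Z v T s| ≤ Real.exp (μ * s) * d := by
      intro s
      simp only [Z, ← mul_sub, abs_mul, abs_of_pos (Real.exp_pos _)]
      gcongr
      exact ContinuousMap.dist_apply_le_dist (f := u) (g := v) _
    have hZc : ∀ u, Continuous (Z u T) := fun u =>
      (hZ u).comp (f := fun s : ℝ => (T, s)) (by fun_prop)
    have hYc : ∀ u, Continuous (Y u T) := fun u =>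
      (hY u).comp (f := fun s : ℝ => (T, s)) (by fun_prop)
    have hYd : ∀ r ∈ Icc 0 S, |Y u T r - Y v T r| ≤ B * (Real.exp (μ * r) / μ * d) := by
      intro r hr
      have h1 : Y u T r - Y v T r = conv N (fun s => Z u T s - Z v T s) r := by
        simp only [Y, conv, mul_sub]
        rw [intervalIntegral.integral_sub] <;>
        · have := hZc u
          have := hZc v
          exact Continuous.intervalIntegrable (by fun_prop) _ _
      rw [h1]
      refine (abs_conv_le ((hZc u).sub (hZc v)) hNb hr).trans ?_
      gcongr
      calc (∫ s in (0 : ℝ)..r, |Z u T s - Z v T s|)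
          ≤ ∫ s in (0 : ℝ)..r, Real.exp (μ * s) * d :=
            intervalIntegral.integral_mono_on hr.1
              (((hZc u).sub (hZc v)).abs.intervalIntegrable _ _)
              (Continuous.intervalIntegrable (by fun_prop) _ _) fun s _ => hZd s
        _ ≤ _ := by
            rw [intervalIntegral.integral_mul_const]
            gcongr
            exact integral_exp_mul_le hμ0 r
    have hdiff : Φ u T t - Φ v T t = -(Real.exp (-μ * t) * l ^ 2) *
        ∫ r in (0 : ℝ)..t, P (T - r) * (Y u T r - Y v T r) := by
      have hc := hYc u
      have hc' := hYc v
      simp only [Φ, mul_sub]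
      rw [intervalIntegral.integral_sub (Continuous.intervalIntegrable (by fun_prop) _ _)
        (Continuous.intervalIntegrable (by fun_prop) _ _)]
      ring
    have hint : |∫ r in (0 : ℝ)..t, P (T - r) * (Y u T r - Y v T r)| ≤
        A * B * d / μ * (Real.exp (μ * t) / μ) := by
      calc |∫ r in (0 : ℝ)..t, P (T - r) * (Y u T r - Y v T r)|
          ≤ ∫ r in (0 : ℝ)..t, A * B * d / μ * Real.exp (μ * r) := by
            rw [← Real.norm_eq_abs]
            refine intervalIntegral.norm_integral_le_of_norm_le ht.1 (ae_of_all _ fun r hr => ?_)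
              (Continuous.intervalIntegrable (by fun_prop) _ _)
            have hr' : r ∈ Icc 0 S := ⟨hr.1.le, hr.2.trans ht.2⟩
            rw [Real.norm_eq_abs, abs_mul]
            calc |P (T - r)| * |Y u T r - Y v T r| ≤ A * (B * (Real.exp (μ * r) / μ * d)) := by
                  gcongr
                  · exact hPb _ ⟨by linarith [hT.1, hr'.2], by linarith [hT.2, hr'.1]⟩
                  · exact hYd r hr'
              _ = _ := by ring
        _ ≤ _ := by
            rw [intervalIntegral.integral_const_mul]
            gcongr
            exact integral_exp_mul_le hμ0 t
    calc dist (F u (⟨T, hT⟩, ⟨t, ht⟩)) (F v (⟨T, hT⟩, ⟨t, ht⟩)) = |Φ u T t - Φ v T t| := rfl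
      _ ≤ Real.exp (-μ * t) * l ^ 2 * (A * B * d / μ * (Real.exp (μ * t) / μ)) := by
          rw [hdiff, abs_mul, abs_neg, abs_of_nonneg (by positivity)]
          gcongr
      _ = κ / μ ^ 2 * d * (Real.exp (-μ * t) * Real.exp (μ * t)) := by
          rw [hκ]; field_simp
      _ = κ / μ ^ 2 * d := by rw [← Real.exp_add]; simp
      _ ≤ _ := by
          simp only [NNReal.coe_div, NNReal.coe_one, NNReal.coe_ofNat]
          gcongr
  set u := hF.fixedPoint F with hu
  have hfix : F u = u := hF.fixedPoint_isFixedPt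
  refine ⟨Z u, hZ u, fun T hT t ht => ?_⟩
  have h1 : ext u T t = Φ u T t := by
    have h2 : u (⟨T, hT⟩, ⟨t, ht⟩) = Φ u T t := by
      conv_lhs => rw [← hfix]
      rfl
    rw [← h2]
    simp only [ext, projIcc_of_mem hS hT, projIcc_of_mem hS ht]
  simp only [Z] at *
  rw [h1]
  simp only [Φ]
  rw [← mul_assoc, ← Real.exp_add]
  simp [Y, Z]

end

section

variable {P P₁ M M₁ : ℝ → ℝ} {p₀ : ℝ}

/-- The equation on [0, T] evaluates its coefficients only at nonnegative arguments, so the two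
predicates are equal and the choice operator picks the same function. -/
theorem modalKernel_congr {P P' N N' : ℝ → ℝ} (hP : ∀ t, 0 ≤ t → P t = P' t)
    (hN : ∀ t, 0 ≤ t → N t = N' t) (l T : ℝ) :
    modalKernel P N l T = modalKernel P' N' l T := by
  have : IsModalKernel P N l T = IsModalKernel P' N' l T := by
    funext z
    simp only [IsModalKernel, eq_iff_iff]
    refine and_congr_right fun _ => forall₂_congr fun t ht => ?_
    rw [hP _ (by linarith [ht.2])]
    have : (∫ s in (0 : ℝ)..t, N (t - s) * z s) = ∫ s in (0 : ℝ)..t, N' (t - s) * z s :=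
      conv_congr ht.1 (fun s hs => hN s hs.1) fun _ _ => rfl
    rw [this]
  rw [modalKernel, modalKernel, this]

theorem modalSol_of_isModalKernel {l T : ℝ} {z : ℝ → ℝ}
    (hT : 0 ≤ T) (hz : IsModalKernel P (memoryPrimitive M) l T z) :
    ModalSol P M l T (IccExtend hT ((Icc 0 T).domRestrict z)) := by
  have hzc : ContinuousOn z (Icc 0 T) := fun t ht => (hz.2 t ht).continuousWithinAt
  have hext : ∀ t ∈ Icc 0 T, IccExtend hT ((Icc 0 T).domRestrict z) t = z t := fun t ht => by
    rw [IccExtend_of_mem hT _ ht]; rfl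
  refine ⟨(continuousOn_iff_continuous_domRestrict.1 hzc).Icc_extend', fun t ht => ?_⟩
  have hnhds : Icc 0 T ∈ 𝓝 t := Icc_mem_nhds ht.1 ht.2
  have h1 := (hz.2 t ⟨ht.1.le, ht.2.le⟩).hasDerivAt hnhds
  have h2 : conv (memoryPrimitive M) (IccExtend hT ((Icc 0 T).domRestrict z)) t =
      ∫ s in (0 : ℝ)..t, memoryPrimitive M (t - s) * z s :=
    conv_congr ht.1.le (fun _ _ => rfl) fun s hs => hext s ⟨hs.1, hs.2.trans ht.2.le⟩
  rw [h2]
  refine h1.congr_of_eventuallyEq ?_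
  filter_upwards [hnhds] with s hs using hext s hs

/-- Uniqueness: the energy bound is proportional to the square of the initial value. -/
theorem TimeData.eq_zero_of_modalSol (h : TimeData P P₁ M M₁ p₀) {l T : ℝ} {z : ℝ → ℝ}
    (hT : 0 ≤ T) (hz : ModalSol P M l T z) (hz0 : z 0 = 0) : ∀ t ∈ Icc 0 T, z t = 0 := by
  intro t ht
  obtain ⟨C, hC, hb⟩ := h.exists_energy_bound T
  have h1 := hb l T ⟨hT, le_rfl⟩ z hz t ht
  rw [hz0] at h1
  have h2 := (h.P_pos (T - t)).le
  have h3 : 0 ≤ l ^ 2 * P (T - t) * conv (memoryPrimitive M) z t ^ 2 := by positivity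
  nlinarith [sq_nonneg (z t)]

theorem ModalSol.sub {l T : ℝ} {z z' : ℝ → ℝ} (hM : Continuous M) (hz : ModalSol P M l T z)
    (hz' : ModalSol P M l T z') : ModalSol P M l T (fun t => z t - z' t) := by
  refine ⟨hz.cont.sub hz'.cont, fun t ht => ((hz.deriv t ht).sub (hz'.deriv t ht)).congr_deriv ?_⟩
  have h1 : conv (memoryPrimitive M) (fun t => z t - z' t) t =
      conv (memoryPrimitive M) z t - conv (memoryPrimitive M) z' t := by
    have hN := continuous_memoryPrimitive hM
    have := hz.cont
    have := hz'.cont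
    simp only [conv, mul_sub]
    rw [intervalIntegral.integral_sub] <;> exact Continuous.intervalIntegrable (by fun_prop) _ _
  rw [h1]
  ring

/-- The modal kernels for all final times in `[0, S]` form a jointly continuous family. -/
theorem TimeData.exists_modalKernel_family (h : TimeData P P₁ M M₁ p₀) (l S : ℝ) (hS : 0 ≤ S) :
    ∃ Z : ℝ → ℝ → ℝ, (Continuous fun p : ℝ × ℝ => Z p.1 p.2) ∧
      ∀ T ∈ Icc 0 S, Z T 0 = 1 ∧ ModalSol P M l T (Z T) ∧
        ∀ t ∈ Icc 0 T, modalKernel P (memoryPrimitive M) l T t = Z T t := by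
  have hN := continuous_memoryPrimitive h.contM
  obtain ⟨Z, hZ, hZeq⟩ := exists_volterra_solution h.contP hN l S hS
  refine ⟨Z, hZ, fun T hT => ?_⟩
  have hZT : Continuous (Z T) := hZ.comp (f := fun s : ℝ => (T, s)) (by fun_prop)
  have hZ0 : Z T 0 = 1 := by
    rw [hZeq T hT 0 ⟨le_rfl, hS⟩]; simp
  have hPc := h.contP
  have hcc : Continuous fun r => P (T - r) * conv (memoryPrimitive M) (Z T) r := by
    have := continuous_conv hN hZT
    fun_prop
  have hder : ∀ t, HasDerivAt
      (fun t => 1 - l ^ 2 * ∫ r in (0 : ℝ)..t, P (T - r) * conv (memoryPrimitive M) (Z T) r)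
      (-l ^ 2 * P (T - t) * conv (memoryPrimitive M) (Z T) t) t := fun t =>
    (((hasDerivAt_primitive hcc t).const_mul (l ^ 2)).const_sub 1).congr_deriv (by ring)
  have hkernel : IsModalKernel P (memoryPrimitive M) l T (Z T) := by
    refine ⟨hZ0, fun t ht => ?_⟩
    exact (hder t).hasDerivWithinAt.congr (fun s hs => hZeq T hT s ⟨hs.1, hs.2.trans hT.2⟩)
      (hZeq T hT t ⟨ht.1, ht.2.trans hT.2⟩)
  have hsol : ModalSol P M l T (Z T) := by
    refine ⟨hZT, fun t ht => (hder t).congr_of_eventuallyEq ?_⟩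
    filter_upwards [Icc_mem_nhds ht.1 ht.2] with s hs
      using hZeq T hT s ⟨hs.1, hs.2.trans hT.2⟩
  refine ⟨hZ0, hsol, fun t ht => ?_⟩
  -- The fixed point shows that a solution exists, so the chosen function is one too. Uniqueness
  -- then identifies them on [0, T].
  have hmk : IsModalKernel P (memoryPrimitive M) l T (modalKernel P (memoryPrimitive M) l T) :=
    Classical.epsilon_spec ⟨Z T, hkernel⟩
  have h1 := modalSol_of_isModalKernel hT.1 hmk
  have h2 := h.eq_zero_of_modalSol hT.1 (h1.sub h.contM hsol) (by
    rw [IccExtend_of_mem hT.1 _ (left_mem_Icc.2 hT.1), hZ0]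
    change modalKernel P (memoryPrimitive M) l T 0 - 1 = 0
    rw [hmk.1, sub_self]) t ht
  rw [IccExtend_of_mem hT.1 _ ht] at h2
  exact sub_eq_zero.1 h2

end

/-! ### Sideways energy estimates for the wave system: the trace bound. -/

/-- A (continuous) solution of the first order system `ζ_t = p² q_ξ`, `q_t = k² ζ_ξ + ρ` on
`(0, π) × (0, T)` with `ζ = 0` at `ξ = 0` and `q = 0` at `t = 0`; `v` and `r` are the time
derivatives of `ζ` and `q`. -/
structure WaveSystem (k p : ℝ → ℝ) (T : ℝ) (ζ q v r ρ : ℝ → ℝ → ℝ) : Prop where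
  cont_ζ : Continuous fun x : ℝ × ℝ => ζ x.1 x.2
  cont_q : Continuous fun x : ℝ × ℝ => q x.1 x.2
  cont_v : Continuous fun x : ℝ × ℝ => v x.1 x.2
  cont_r : Continuous fun x : ℝ × ℝ => r x.1 x.2
  cont_ρ : Continuous fun x : ℝ × ℝ => ρ x.1 x.2
  ζ_space : ∀ t, ∀ ξ ∈ Ioo 0 Real.pi,
    HasDerivAt (fun ξ => ζ ξ t) ((r ξ t - ρ ξ t) / k ξ ^ 2) ξ
  q_space : ∀ t, ∀ ξ ∈ Ioo 0 Real.pi, HasDerivAt (fun ξ => q ξ t) (v ξ t / p t ^ 2) ξ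
  ζ_time : ∀ ξ, ∀ t ∈ Ioo 0 T, HasDerivAt (ζ ξ) (v ξ t) t
  q_time : ∀ ξ, ∀ t ∈ Ioo 0 T, HasDerivAt (q ξ) (r ξ t) t
  ζ_left : ∀ t, ζ 0 t = 0
  q_init : ∀ ξ, q ξ 0 = 0

/-- The sideways energy balance, in which ξ plays the role of time: fundamental theorem of calculus
in ξ, then Fubini. -/
theorem integral_sub_eq_integral_integral_deriv {G G' : ℝ → ℝ → ℝ} {a b T : ℝ} (hab : a ≤ b)
    (hG : Continuous fun x : ℝ × ℝ => G x.1 x.2) (hG' : Continuous fun x : ℝ × ℝ => G' x.1 x.2)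
    (hd : ∀ t, ∀ ξ ∈ Ioo a b, HasDerivAt (fun ξ => G ξ t) (G' ξ t) ξ) :
    (∫ t in (0 : ℝ)..T, (G b t - G a t)) = ∫ ξ in a..b, ∫ t in (0 : ℝ)..T, G' ξ t := by
  rw [intervalIntegral_intervalIntegral_swap]
  · refine intervalIntegral.integral_congr fun t _ => ?_
    refine (intervalIntegral.integral_eq_sub_of_hasDerivAt_of_le hab ?_ (hd t) ?_).symm
    · exact (hG.comp (f := fun ξ : ℝ => (ξ, t)) (by fun_prop)).continuousOn
    · exact (hG'.comp (f := fun ξ : ℝ => (ξ, t)) (by fun_prop)).intervalIntegrable _ _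
  · have : IntegrableOn (fun x : ℝ × ℝ => G' x.1 x.2) (uIcc a b ×ˢ uIcc 0 T) :=
      hG'.continuousOn.integrableOn_compact (isCompact_uIcc.prod isCompact_uIcc)
    exact this.mono_set (prod_mono uIoc_subset_uIcc uIoc_subset_uIcc)

/-- A nonincreasing weight satisfies W(t) ∫₀ᵗ q² ≤ ∫₀ᵗ W q², so the memory costs only the factor 1 +
T. It serves with W = 1 and with the characteristic weight. -/
theorem integral_weight_mul_sq_le {W q ρ : ℝ → ℝ} {T K : ℝ} (hT : 0 ≤ T) (hW : Continuous W)
    (hq : Continuous q) (hρ : Continuous ρ) (hW0 : ∀ t ∈ Icc 0 T, 0 ≤ W t)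
    (hanti : AntitoneOn W (Icc 0 T)) (hK : 0 ≤ K)
    (h : ∀ t ∈ Icc 0 T, ρ t ^ 2 ≤ K * (q t ^ 2 + ∫ s in (0 : ℝ)..t, q s ^ 2)) :
    (∫ t in (0 : ℝ)..T, W t * ρ t ^ 2) ≤ K * (1 + T) * ∫ t in (0 : ℝ)..T, W t * q t ^ 2 := by
  set J := ∫ t in (0 : ℝ)..T, W t * q t ^ 2 with hJ
  calc (∫ t in (0 : ℝ)..T, W t * ρ t ^ 2)
      ≤ ∫ t in (0 : ℝ)..T, (K * (W t * q t ^ 2) + K * J) := by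
        refine intervalIntegral.integral_mono_on hT (Continuous.intervalIntegrable (by fun_prop) _ _)
          (Continuous.intervalIntegrable (by fun_prop) _ _) fun t ht => ?_
        have h1 : W t * (∫ s in (0 : ℝ)..t, q s ^ 2) ≤ J := by
          rw [← intervalIntegral.integral_const_mul]
          calc (∫ s in (0 : ℝ)..t, W t * q s ^ 2) ≤ ∫ s in (0 : ℝ)..t, W s * q s ^ 2 := by
                refine intervalIntegral.integral_mono_on ht.1
                  (Continuous.intervalIntegrable (by fun_prop) _ _)
                  (Continuous.intervalIntegrable (by fun_prop) _ _) fun s hs => ?_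
                exact mul_le_mul_of_nonneg_right (hanti ⟨hs.1, hs.2.trans ht.2⟩ ht hs.2)
                  (sq_nonneg _)
            _ ≤ J := by
                rw [intervalIntegral.integral_of_le ht.1, hJ, intervalIntegral.integral_of_le hT]
                refine setIntegral_mono_set ?_ ?_ (Ioc_subset_Ioc_right ht.2).eventuallyLE
                · exact (Continuous.integrableOn_Icc (by fun_prop)).mono_set Ioc_subset_Icc_self
                · refine (ae_restrict_iff' measurableSet_Ioc).2 (ae_of_all _ fun s hs => ?_)
                  exact mul_nonneg (hW0 s ⟨hs.1.le, hs.2⟩) (sq_nonneg _)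
        have h2 := mul_le_mul_of_nonneg_left (h t ht) (hW0 t ht)
        have h3 := mul_le_mul_of_nonneg_left h1 hK
        linarith
    _ = K * (1 + T) * J := by
        rw [intervalIntegral.integral_add (Continuous.intervalIntegrable (by fun_prop) _ _)
          (by simp), intervalIntegral.integral_const_mul, intervalIntegral.integral_const, ← hJ]
        simp only [sub_zero, smul_eq_mul]
        ring

/-- Hidden regularity: the trace of `q` at `ξ = 0` is controlled by the energy. -/
theorem exists_trace_bound {k k₁ : ℝ → ℝ} (hk : Continuous k) (hk₁ : Continuous k₁)
    (hkd : ∀ ξ ∈ Ioo 0 Real.pi, HasDerivAt k (k₁ ξ) ξ) (hkpos : ∀ ξ, 0 < k ξ)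
    {S K A p₀ : ℝ} (hK : 0 ≤ K) (hp₀ : 0 < p₀) :
    ∃ C, 0 ≤ C ∧ ∀ T ∈ Icc 0 S, ∀ p : ℝ → ℝ, Continuous p → (∀ t, p₀ ≤ p t ^ 2) →
      (∀ t ∈ Icc 0 T, p t ^ 2 ≤ A) →
      ∀ ζ q v r ρ : ℝ → ℝ → ℝ, WaveSystem k p T ζ q v r ρ →
      (∀ ξ, ∀ t ∈ Icc 0 T, ρ ξ t ^ 2 ≤ K * (q ξ t ^ 2 + ∫ s in (0 : ℝ)..t, q ξ s ^ 2)) →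
      ∀ E, (∀ t ∈ Icc 0 T, (∫ ξ in (0 : ℝ)..Real.pi, (ζ ξ t ^ 2 + q ξ t ^ 2)) ≤ E) →
        (∫ t in (0 : ℝ)..T, q 0 t ^ 2) ≤ C * E := by
  rcases lt_or_ge S 0 with hS | hS
  · exact ⟨0, le_rfl, fun T hT => absurd (hT.1.trans hT.2) (not_le.2 hS)⟩
  have hπ := Real.pi_pos
  obtain ⟨B, hB, hkb⟩ := exists_abs_le_of_continuousOn (hk.continuousOn (s := Icc 0 Real.pi))
  obtain ⟨B₁, hB₁, hk₁b⟩ := exists_abs_le_of_continuousOn (hk₁.continuousOn (s := Icc 0 Real.pi))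
  set D := (B ^ 2 + |A|) / Real.pi + 2 * B * B₁ + 1 with hD
  have hD0 : 0 ≤ D := by positivity
  set D' := D + K * (1 + S) with hD'
  have hD'0 : 0 ≤ D' := by positivity
  -- The 1 pays for 2mζq at the final time, D'S for the remainder R integrated over time, and 1/p₀
  -- for the coefficient p² of the trace.
  refine ⟨(1 + D' * S) / p₀, by positivity, ?_⟩
  intro T hT p hp hp0 hpA ζ q v r ρ hs hρ E hE
  have hζc := hs.cont_ζ
  have hqc := hs.cont_q
  have hvc := hs.cont_v
  have hrc := hs.cont_r
  have hρc := hs.cont_ρ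
  -- The multiplier is 1 at ξ = 0 and 0 at ξ = π, so only the wanted trace survives on the boundary.
  set m : ℝ → ℝ := fun ξ => 1 - ξ / Real.pi with hm
  have hmc : Continuous m := by fun_prop
  have hmd : ∀ ξ, HasDerivAt m (-(1 / Real.pi)) ξ := fun ξ =>
    ((hasDerivAt_id ξ).div_const Real.pi).const_sub 1
  have hm01 : ∀ ξ ∈ Icc 0 Real.pi, 0 ≤ m ξ ∧ m ξ ≤ 1 := fun ξ hξ => by
    have h1 : ξ / Real.pi ≤ 1 := (div_le_one hπ).2 hξ.2
    have h2 : 0 ≤ ξ / Real.pi := div_nonneg hξ.1 hπ.le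
    constructor <;> simp only [hm] <;> linarith
  set R : ℝ → ℝ → ℝ := fun ξ t => (k ξ ^ 2 * ζ ξ t ^ 2 + p t ^ 2 * q ξ t ^ 2) / Real.pi -
    m ξ * (2 * k ξ * k₁ ξ * ζ ξ t ^ 2 - 2 * ζ ξ t * ρ ξ t) with hR
  have hRc : Continuous fun x : ℝ × ℝ => R x.1 x.2 := by fun_prop
  set H' : ℝ → ℝ → ℝ := fun ξ t => 2 * m ξ * (v ξ t * q ξ t + ζ ξ t * r ξ t) with hH'
  have hH'c : Continuous fun x : ℝ × ℝ => H' x.1 x.2 := by fun_prop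
  have hslice : ∀ {f : ℝ → ℝ → ℝ}, (Continuous fun x : ℝ × ℝ => f x.1 x.2) → ∀ ξ,
      Continuous (f ξ) := fun hf ξ => hf.comp (f := fun t : ℝ => (ξ, t)) (by fun_prop)
  have hslice' : ∀ {f : ℝ → ℝ → ℝ}, (Continuous fun x : ℝ × ℝ => f x.1 x.2) → ∀ t,
      Continuous (fun ξ => f ξ t) := fun hf t => hf.comp (f := fun ξ : ℝ => (ξ, t)) (by fun_prop)
  -- The ξ-derivative of m (k²ζ² + p²q²) is the exact time derivative H' of 2mζq minus R, which is
  -- quadratic in ζ, q, ρ and contains no derivatives of them.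
  have hmain := integral_sub_eq_integral_integral_deriv (T := T)
    (G := fun ξ t => m ξ * (k ξ ^ 2 * ζ ξ t ^ 2 + p t ^ 2 * q ξ t ^ 2))
    (G' := fun ξ t => H' ξ t - R ξ t) hπ.le (by fun_prop) (by fun_prop) (by
      intro t ξ hξ
      have h1 := (hmd ξ).mul ((((hkd ξ hξ).pow 2).mul ((hs.ζ_space t ξ hξ).pow 2)).add
        (((hs.q_space t ξ hξ).pow 2).const_mul (p t ^ 2)))
      refine h1.congr_deriv ?_
      have hk0 := (hkpos ξ).ne'
      have hp1 : p t ≠ 0 := fun h0 => by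
        have := hp0 t
        rw [h0] at this
        norm_num at this
        linarith
      simp only [hH', hR, Pi.pow_apply, Pi.mul_apply, Pi.add_apply]
      field_simp
      ring)
  have hinner : ∀ ξ ∈ Icc 0 Real.pi, -(ζ ξ T ^ 2 + q ξ T ^ 2) -
      D' * (∫ t in (0 : ℝ)..T, (ζ ξ t ^ 2 + q ξ t ^ 2)) ≤
      ∫ t in (0 : ℝ)..T, (H' ξ t - R ξ t) := by
    intro ξ hξ
    have hζξ := hslice hζc ξ
    have hqξ := hslice hqc ξ
    have hρξ := hslice hρc ξ
    have hRξ := hslice hRc ξ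
    have hH'ξ := hslice hH'c ξ
    rw [intervalIntegral.integral_sub (hH'ξ.intervalIntegrable _ _) (hRξ.intervalIntegrable _ _)]
    have h1 : (∫ t in (0 : ℝ)..T, H' ξ t) = 2 * m ξ * (ζ ξ T * q ξ T) := by
      rw [intervalIntegral.integral_eq_sub_of_hasDerivAt_of_le
        (f := fun t => 2 * m ξ * (ζ ξ t * q ξ t)) hT.1 (by fun_prop) _
        (hH'ξ.intervalIntegrable _ _), hs.q_init]
      · simp
      · exact fun t ht => ((hs.ζ_time ξ t ht).mul (hs.q_time ξ t ht)).const_mul _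
    obtain ⟨hm0, hm1⟩ := hm01 ξ hξ
    have hkB := hkb ξ hξ
    have hk₁B := hk₁b ξ hξ
    have h2 : (∫ t in (0 : ℝ)..T, R ξ t) ≤ ∫ t in (0 : ℝ)..T,
        (D * (ζ ξ t ^ 2 + q ξ t ^ 2) + 1 * ρ ξ t ^ 2) := by
      refine intervalIntegral.integral_mono_on hT.1 (hRξ.intervalIntegrable _ _)
        (Continuous.intervalIntegrable (by fun_prop) _ _) fun t ht => ?_
      have e1 : k ξ ^ 2 ≤ B ^ 2 := by
        rw [← sq_abs]; exact pow_le_pow_left₀ (abs_nonneg _) hkB 2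
      have e2 : p t ^ 2 ≤ |A| := (hpA t ht).trans (le_abs_self A)
      have e3 : |k ξ * k₁ ξ| ≤ B * B₁ := by rw [abs_mul]; gcongr
      have e4 : (k ξ ^ 2 * ζ ξ t ^ 2 + p t ^ 2 * q ξ t ^ 2) / Real.pi ≤
          (B ^ 2 + |A|) / Real.pi * (ζ ξ t ^ 2 + q ξ t ^ 2) := by
        rw [div_mul_eq_mul_div]
        gcongr
        nlinarith [mul_le_mul_of_nonneg_right e1 (sq_nonneg (ζ ξ t)),
          mul_le_mul_of_nonneg_right e2 (sq_nonneg (q ξ t)),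
          mul_nonneg (sq_nonneg B) (sq_nonneg (q ξ t)),
          mul_nonneg (abs_nonneg A) (sq_nonneg (ζ ξ t))]
      have e5 : -(2 * k ξ * k₁ ξ * ζ ξ t ^ 2 - 2 * ζ ξ t * ρ ξ t) ≤
          (2 * B * B₁ + 1) * ζ ξ t ^ 2 + ρ ξ t ^ 2 := by
        have := mul_le_mul_of_nonneg_right ((neg_le_abs _).trans e3) (sq_nonneg (ζ ξ t))
        nlinarith [sq_nonneg (ζ ξ t - ρ ξ t)]
      have e6 : m ξ * -(2 * k ξ * k₁ ξ * ζ ξ t ^ 2 - 2 * ζ ξ t * ρ ξ t) ≤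
          (2 * B * B₁ + 1) * ζ ξ t ^ 2 + ρ ξ t ^ 2 := by
        have e7 : 0 ≤ (2 * B * B₁ + 1) * ζ ξ t ^ 2 + ρ ξ t ^ 2 := by positivity
        calc _ ≤ m ξ * ((2 * B * B₁ + 1) * ζ ξ t ^ 2 + ρ ξ t ^ 2) := by gcongr
          _ ≤ 1 * ((2 * B * B₁ + 1) * ζ ξ t ^ 2 + ρ ξ t ^ 2) := by gcongr
          _ = _ := one_mul _
      have e8 : 0 ≤ (2 * B * B₁ + 1) * q ξ t ^ 2 := by positivity
      simp only [hR, hD]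
      linarith
    have h3 := integral_weight_mul_sq_le hT.1 (continuous_const (y := (1 : ℝ))) hqξ hρξ
      (fun _ _ => zero_le_one) (fun _ _ _ _ _ => le_rfl) hK (hρ ξ)
    have h4 : (∫ t in (0 : ℝ)..T, 1 * q ξ t ^ 2) ≤ ∫ t in (0 : ℝ)..T, (ζ ξ t ^ 2 + q ξ t ^ 2) :=
      intervalIntegral.integral_mono_on hT.1 (Continuous.intervalIntegrable (by fun_prop) _ _)
        (Continuous.intervalIntegrable (by fun_prop) _ _) fun t _ => by nlinarith [sq_nonneg (ζ ξ t)]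
    rw [intervalIntegral.integral_add (Continuous.intervalIntegrable (by fun_prop) _ _)
      (Continuous.intervalIntegrable (by fun_prop) _ _), intervalIntegral.integral_const_mul] at h2
    have h40 : 0 ≤ ∫ t in (0 : ℝ)..T, (ζ ξ t ^ 2 + q ξ t ^ 2) :=
      intervalIntegral.integral_nonneg hT.1 fun t _ => by positivity
    have h5 : K * (1 + T) * (∫ t in (0 : ℝ)..T, 1 * q ξ t ^ 2) ≤
        K * (1 + S) * ∫ t in (0 : ℝ)..T, (ζ ξ t ^ 2 + q ξ t ^ 2) := by
      have := hT.2
      gcongr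
      exact intervalIntegral.integral_nonneg hT.1 fun t _ => by positivity
    have h6 : -(ζ ξ T ^ 2 + q ξ T ^ 2) ≤ 2 * m ξ * (ζ ξ T * q ξ T) := by
      nlinarith [mul_nonneg hm0 (sq_nonneg (ζ ξ T + q ξ T)),
        mul_nonneg (sub_nonneg.2 hm1) (add_nonneg (sq_nonneg (ζ ξ T)) (sq_nonneg (q ξ T)))]
    rw [h1, hD']
    linarith
  have hEc : Continuous fun x : ℝ × ℝ => ζ x.1 x.2 ^ 2 + q x.1 x.2 ^ 2 := by fun_prop
  have hEξ : Continuous fun ξ => ∫ t in (0 : ℝ)..T, (ζ ξ t ^ 2 + q ξ t ^ 2) :=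
    intervalIntegral.continuous_parametric_intervalIntegral_of_continuous
      (f := fun ξ t => ζ ξ t ^ 2 + q ξ t ^ 2) hEc continuous_const
  have hζT := hslice' hζc T
  have hqT := hslice' hqc T
  have hlow : (∫ ξ in (0 : ℝ)..Real.pi, (-(ζ ξ T ^ 2 + q ξ T ^ 2) -
      D' * (∫ t in (0 : ℝ)..T, (ζ ξ t ^ 2 + q ξ t ^ 2)))) ≤
      ∫ ξ in (0 : ℝ)..Real.pi, ∫ t in (0 : ℝ)..T, (H' ξ t - R ξ t) := by
    refine intervalIntegral.integral_mono_on hπ.le (Continuous.intervalIntegrable (by fun_prop) _ _)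
      (Continuous.intervalIntegrable ?_ _ _) hinner
    exact intervalIntegral.continuous_parametric_intervalIntegral_of_continuous
      (f := fun ξ t => H' ξ t - R ξ t) (by fun_prop) continuous_const
  rw [← hmain, intervalIntegral.integral_sub (Continuous.intervalIntegrable (by fun_prop) _ _)
    (Continuous.intervalIntegrable (by fun_prop) _ _), intervalIntegral.integral_neg,
    intervalIntegral.integral_const_mul] at hlow
  have hswap : (∫ ξ in (0 : ℝ)..Real.pi, ∫ t in (0 : ℝ)..T, (ζ ξ t ^ 2 + q ξ t ^ 2)) =
      ∫ t in (0 : ℝ)..T, ∫ ξ in (0 : ℝ)..Real.pi, (ζ ξ t ^ 2 + q ξ t ^ 2) := by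
    refine intervalIntegral_intervalIntegral_swap ?_
    have : IntegrableOn (fun x : ℝ × ℝ => ζ x.1 x.2 ^ 2 + q x.1 x.2 ^ 2)
      (uIcc 0 Real.pi ×ˢ uIcc 0 T) :=
      hEc.continuousOn.integrableOn_compact (isCompact_uIcc.prod isCompact_uIcc)
    exact this.mono_set (prod_mono uIoc_subset_uIcc uIoc_subset_uIcc)
  have hEt : Continuous fun t => ∫ ξ in (0 : ℝ)..Real.pi, (ζ ξ t ^ 2 + q ξ t ^ 2) :=
    intervalIntegral.continuous_parametric_intervalIntegral_of_continuous
      (f := fun t ξ => ζ ξ t ^ 2 + q ξ t ^ 2)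
      (hEc.comp (f := fun x : ℝ × ℝ => (x.2, x.1)) (by fun_prop)) continuous_const
  have hE0 : 0 ≤ E := le_trans (intervalIntegral.integral_nonneg hπ.le fun ξ _ => by positivity)
    (hE T ⟨hT.1, le_rfl⟩)
  have hEint : (∫ t in (0 : ℝ)..T, ∫ ξ in (0 : ℝ)..Real.pi, (ζ ξ t ^ 2 + q ξ t ^ 2)) ≤ S * E := by
    calc _ ≤ ∫ t in (0 : ℝ)..T, E :=
          intervalIntegral.integral_mono_on hT.1 (hEt.intervalIntegrable _ _) (by simp) hE
      _ = T * E := by simp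
      _ ≤ S * E := by have := hT.2; gcongr
  have hleft : (∫ t in (0 : ℝ)..T, (m Real.pi * (k Real.pi ^ 2 * ζ Real.pi t ^ 2 +
      p t ^ 2 * q Real.pi t ^ 2) - m 0 * (k 0 ^ 2 * ζ 0 t ^ 2 + p t ^ 2 * q 0 t ^ 2))) ≤
      -(p₀ * ∫ t in (0 : ℝ)..T, q 0 t ^ 2) := by
    have hq0 := hslice hqc 0
    have hm0 : m Real.pi = 0 := by simp [hm, hπ.ne']
    have hm1 : m 0 = 1 := by simp [hm]
    simp only [hm0, hm1, hs.ζ_left]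
    rw [← intervalIntegral.integral_const_mul, ← intervalIntegral.integral_neg]
    have := hslice hqc Real.pi
    have := hslice hζc Real.pi
    refine intervalIntegral.integral_mono_on hT.1 (Continuous.intervalIntegrable (by fun_prop) _ _)
      (Continuous.intervalIntegrable (by fun_prop) _ _) fun t _ => ?_
    nlinarith [mul_le_mul_of_nonneg_right (hp0 t) (sq_nonneg (q 0 t))]
  rw [hswap] at hlow
  have h1 := mul_le_mul_of_nonneg_left hEint hD'0
  have h2 := hE T ⟨hT.1, le_rfl⟩
  rw [div_mul_eq_mul_div, le_div_iff₀ hp₀]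
  nlinarith

/-! ### Observability in the critical time. -/

theorem quadratic_lower_bound {a₁ a₂ a₃ a₄ a₅ z q ρ D : ℝ} (h1 : |a₁| ≤ D) (h2 : |a₂| ≤ D)
    (h3 : |a₃| ≤ D) (h4 : |a₄| ≤ D) (h5 : |a₅| ≤ D) :
    -(3 * D + 1) * (z ^ 2 + q ^ 2) - (D + 1) * ρ ^ 2 ≤
      -a₁ * z ^ 2 + a₂ * q ^ 2 - a₃ * z ^ 2 + 2 * z * ρ - a₄ * z * q + a₅ * ρ * q := by
  have hD : 0 ≤ D := (abs_nonneg _).trans h1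
  have key : ∀ {a x y : ℝ}, |a| ≤ D → -(D * (x ^ 2 + y ^ 2) / 2) ≤ a * (x * y) := by
    intro a x y ha
    have h6 : |a * (x * y)| ≤ D * ((x ^ 2 + y ^ 2) / 2) := by
      rw [abs_mul]
      gcongr
      rw [abs_mul]
      nlinarith [sq_nonneg (|x| - |y|), sq_abs x, sq_abs y]
    have := neg_abs_le (a * (x * y))
    linarith
  have f1 := key (x := z) (y := z) ((abs_neg _).trans_le h1)
  have f2 := key (x := q) (y := q) h2
  have f3 := key (x := z) (y := z) ((abs_neg _).trans_le h3)
  have f4 := key (x := z) (y := q) ((abs_neg _).trans_le h4)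
  have f5 := key (x := ρ) (y := q) h5
  have f6 : -(z ^ 2 + ρ ^ 2) ≤ 2 * z * ρ := by nlinarith [sq_nonneg (z + ρ)]
  linarith [mul_nonneg hD (sq_nonneg z), mul_nonneg hD (sq_nonneg q),
    mul_nonneg hD (sq_nonneg ρ), sq_nonneg q]

/-- The pointwise inequality behind the weighted energy estimate. -/
theorem weighted_energy_pointwise {k p k₁ p₁ w w' z q ρ C D m : ℝ} (hk : 0 < k)
    (hw : 0 ≤ w) (hw' : w' ≤ 0) (hC : 0 ≤ C) (hmk : m ≤ k ^ 2) (hmp : m ≤ p ^ 2)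
    (h1 : |k * p₁ / (2 * p ^ 2)| ≤ D) (h2 : |p₁ / (2 * k)| ≤ D) (h3 : |2 * k * k₁| ≤ D)
    (h4 : |k₁ * p| ≤ D) (h5 : |p / k| ≤ D) :
    w * ((C * m / 2 - (3 * D + 1)) * (z ^ 2 + q ^ 2) - (D + 1) * ρ ^ 2) ≤
      C * w * (k ^ 2 * z ^ 2 + p ^ 2 * q ^ 2 + k * p * z * q) - w' / (2 * k) * (k * z - p * q) ^ 2 +
      w * (-(k * p₁ / (2 * p ^ 2)) * z ^ 2 + p₁ / (2 * k) * q ^ 2 - 2 * k * k₁ * z ^ 2 +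
        2 * z * ρ - k₁ * p * z * q + p / k * ρ * q) := by
  have e0 : w' / (2 * k) * (k * z - p * q) ^ 2 ≤ 0 :=
    mul_nonpos_of_nonpos_of_nonneg (div_nonpos_of_nonpos_of_nonneg hw' (by positivity))
      (sq_nonneg _)
  -- Twice the form is k²z² + p²q² + (kz + pq)², so the cross term costs at most half of the energy.
  have e1 : C * (m / 2 * (z ^ 2 + q ^ 2)) ≤
      C * (k ^ 2 * z ^ 2 + p ^ 2 * q ^ 2 + k * p * z * q) := by
    refine mul_le_mul_of_nonneg_left ?_ hC
    have := sq_nonneg (k * z + p * q)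
    have := mul_le_mul_of_nonneg_right hmk (sq_nonneg z)
    have := mul_le_mul_of_nonneg_right hmp (sq_nonneg q)
    linarith
  have e2 := quadratic_lower_bound (z := z) (q := q) (ρ := ρ) h1 h2 h3 h4 h5
  have e3 := mul_le_mul_of_nonneg_left (add_le_add e1 e2) hw
  linarith

set_option maxHeartbeats 1000000 in
/-- Weighted observability inequality, with a constant which does not depend on the weight. -/
theorem exists_weighted_observability {k k₁ p p₁ : ℝ → ℝ} (hk : Continuous k)
    (hk₁ : Continuous k₁) (hkd : ∀ ξ ∈ Ioo 0 Real.pi, HasDerivAt k (k₁ ξ) ξ) (hkpos : ∀ ξ, 0 < k ξ)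
    {T K m : ℝ} (hT : 0 ≤ T) (hp : Continuous p) (hp₁ : Continuous p₁)
    (hpd : ∀ t ∈ Ioo 0 T, HasDerivAt p (p₁ t) t) (hppos : ∀ t, 0 < p t) (hK : 0 ≤ K)
    (hm : 0 < m) (hmk : ∀ ξ, m ≤ k ξ ^ 2) (hmp : ∀ t, m ≤ p t ^ 2)
    (hTπ : (∫ t in (0 : ℝ)..T, p t) = ∫ ξ in (0 : ℝ)..Real.pi, 1 / k ξ) :
    ∃ C, 0 ≤ C ∧ ∀ ω ω' : ℝ → ℝ, Continuous ω → Continuous ω' → (∀ x, HasDerivAt ω (ω' x) x) →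
      (∀ x, ω' x ≤ 0) → (∀ x, 0 ≤ ω x) → (∀ x, ω x ≤ 1) →
      (∀ x, (∫ ξ in (0 : ℝ)..Real.pi, 1 / k ξ) ≤ x → ω x = 0) →
      ∀ ζ q v r ρ : ℝ → ℝ → ℝ, WaveSystem k p T ζ q v r ρ →
      (∀ ξ, ∀ t ∈ Icc 0 T, ρ ξ t ^ 2 ≤ K * (q ξ t ^ 2 + ∫ s in (0 : ℝ)..t, q ξ s ^ 2)) →
      (∫ ξ in (0 : ℝ)..Real.pi, ω (∫ y in (0 : ℝ)..ξ, 1 / k y) * ζ ξ 0 ^ 2) ≤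
        C * ∫ t in (0 : ℝ)..T, q 0 t ^ 2 := by
  have hπ := Real.pi_pos
  have hk0 : ∀ ξ, k ξ ≠ 0 := fun ξ => (hkpos ξ).ne'
  have hp0 : ∀ t, p t ≠ 0 := fun t => (hppos t).ne'
  have hbd : ∀ {f : ℝ → ℝ → ℝ}, (Continuous fun x : ℝ × ℝ => f x.1 x.2) →
      ∃ C, 0 ≤ C ∧ ∀ ξ ∈ Icc 0 Real.pi, ∀ t ∈ Icc 0 T, |f ξ t| ≤ C := by
    intro f hf
    obtain ⟨C, hC⟩ := (isCompact_Icc.prod isCompact_Icc).exists_bound_of_continuousOn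
      (s := Icc (0 : ℝ) Real.pi ×ˢ Icc (0 : ℝ) T) hf.continuousOn
    exact ⟨max C 0, le_max_right _ _, fun ξ hξ t ht =>
      (hC (ξ, t) ⟨hξ, ht⟩).trans (le_max_left _ _)⟩
  obtain ⟨D₁, hD₁, hb₁⟩ := hbd (f := fun ξ t => k ξ * p₁ t / (2 * p t ^ 2))
    (by fun_prop (disch := intro x; have := hp0 x.2; positivity))
  obtain ⟨D₂, hD₂, hb₂⟩ := hbd (f := fun ξ t => p₁ t / (2 * k ξ))
    (by fun_prop (disch := intro x; have := hk0 x.1; positivity))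
  obtain ⟨D₃, hD₃, hb₃⟩ := hbd (f := fun ξ t => 2 * k ξ * k₁ ξ) (by fun_prop)
  obtain ⟨D₄, hD₄, hb₄⟩ := hbd (f := fun ξ t => k₁ ξ * p t) (by fun_prop)
  obtain ⟨D₅, hD₅, hb₅⟩ := hbd (f := fun ξ t => p t / k ξ)
    (by fun_prop (disch := intro x; exact hk0 x.1))
  obtain ⟨A, hA, hbA⟩ := hbd (f := fun ξ t => p t ^ 2) (by fun_prop)
  set D := D₁ + D₂ + D₃ + D₄ + D₅ with hD
  have hD0 : 0 ≤ D := by positivity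
  -- The factor exp(-Cξ) creates the positive term (Cm/2)(ζ² + q²). Its part 3D + 1 absorbs the
  -- lower order coefficients, and (D + 1)K(1 + T) the memory term ρ.
  set C := 2 * (3 * D + 1 + (D + 1) * (K * (1 + T))) / m with hC
  have hC0 : 0 ≤ C := by positivity
  have hCm : C * m / 2 = 3 * D + 1 + (D + 1) * (K * (1 + T)) := by
    rw [hC]; field_simp
  -- A lower bound for exp(-Cξ) k(ξ)/(2p(0)), the coefficient of ζ(ξ,0)² on the edge t = 0.
  set κ := Real.exp (-C * Real.pi) * √m / (2 * p 0) with hκ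
  have hp00 := hppos 0
  have hsm : 0 < √m := Real.sqrt_pos.2 hm
  have hκ0 : 0 < κ := by positivity
  refine ⟨A / κ, by positivity, ?_⟩
  intro ω ω' hω hω' hωd hωn hω0 hω1 hωL ζ q v r ρ hs hρ
  have hζc := hs.cont_ζ
  have hqc := hs.cont_q
  have hvc := hs.cont_v
  have hrc := hs.cont_r
  have hρc := hs.cont_ρ
  have hslice : ∀ {f : ℝ → ℝ → ℝ}, (Continuous fun x : ℝ × ℝ => f x.1 x.2) → ∀ ξ,
      Continuous (f ξ) := fun hf ξ => hf.comp (f := fun t : ℝ => (ξ, t)) (by fun_prop)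
  have hslice' : ∀ {f : ℝ → ℝ → ℝ}, (Continuous fun x : ℝ × ℝ => f x.1 x.2) → ∀ t,
      Continuous (fun ξ => f ξ t) := fun hf t => hf.comp (f := fun ξ : ℝ => (ξ, t)) (by fun_prop)
  have hkinv : Continuous fun ξ => 1 / k ξ := by fun_prop (disch := exact hk0)
  set X : ℝ → ℝ := fun ξ => ∫ y in (0 : ℝ)..ξ, 1 / k y with hX
  set τ : ℝ → ℝ := fun t => ∫ s in (0 : ℝ)..t, p s with hτ
  have hXc : Continuous X := continuous_primitive_of_continuous hkinv
  have hτc : Continuous τ := continuous_primitive_of_continuous hp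
  have hX0 : ∀ ξ ∈ Icc 0 Real.pi, 0 ≤ X ξ := fun ξ hξ =>
    intervalIntegral.integral_nonneg hξ.1 fun y _ => (one_div_pos.2 (hkpos y)).le
  have hτ0 : ∀ t ∈ Icc 0 T, 0 ≤ τ t := fun t ht =>
    intervalIntegral.integral_nonneg ht.1 fun y _ => (hppos y).le
  have hXd : ∀ ξ, HasDerivAt X (1 / k ξ) ξ := hasDerivAt_primitive hkinv
  have hτd : ∀ t, HasDerivAt τ (p t) t := hasDerivAt_primitive hp
  have hXz : X 0 = 0 := by simp [hX]
  have hτz : τ 0 = 0 := by simp [hτ]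
  -- X + τ is constant along the characteristics dξ/dt = -kp. Since X(π) = τ(T) is the threshold
  -- beyond which ω vanishes, W is zero on the edges ξ = π and t = T.
  set W : ℝ → ℝ → ℝ := fun ξ t => ω (X ξ + τ t) with hW
  set W' : ℝ → ℝ → ℝ := fun ξ t => ω' (X ξ + τ t) with hW'
  have hWc : Continuous fun x : ℝ × ℝ => W x.1 x.2 := by fun_prop
  have hW'c : Continuous fun x : ℝ × ℝ => W' x.1 x.2 := by fun_prop
  have hWξ : ∀ t ξ, HasDerivAt (fun ξ => W ξ t) (W' ξ t * (1 / k ξ)) ξ := fun t ξ =>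
    (hωd (X ξ + τ t)).comp ξ ((hXd ξ).add_const _)
  have hWt : ∀ ξ t, HasDerivAt (W ξ) (W' ξ t * p t) t := fun ξ t =>
    (hωd (X ξ + τ t)).comp t ((hτd t).const_add _)
  have hkc1 : Continuous fun x : ℝ × ℝ => k x.1 := by fun_prop
  have hpc1 : Continuous fun x : ℝ × ℝ => p x.2 := by fun_prop
  have hk1 : ∀ x : ℝ × ℝ, k x.1 ≠ 0 := fun x => hk0 x.1
  have hp1 : ∀ x : ℝ × ℝ, p x.2 ≠ 0 := fun x => hp0 x.2
  -- Because W is constant along characteristics, its derivatives combine into a perfect square (kζ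
  -- - pq)², with a favourable sign since ω' ≤ 0. No bound on ω' is needed, so the final constant is
  -- independent of ω.
  set R : ℝ → ℝ → ℝ := fun ξ t =>
    C * W ξ t * (k ξ ^ 2 * ζ ξ t ^ 2 + p t ^ 2 * q ξ t ^ 2 + k ξ * p t * ζ ξ t * q ξ t) -
      W' ξ t / (2 * k ξ) * (k ξ * ζ ξ t - p t * q ξ t) ^ 2 +
      W ξ t * (-(k ξ * p₁ t / (2 * p t ^ 2)) * ζ ξ t ^ 2 + p₁ t / (2 * k ξ) * q ξ t ^ 2 -
        2 * k ξ * k₁ ξ * ζ ξ t ^ 2 + 2 * ζ ξ t * ρ ξ t - k₁ ξ * p t * ζ ξ t * q ξ t +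
        p t / k ξ * ρ ξ t * q ξ t) with hR
  have hRc : Continuous fun x : ℝ × ℝ => R x.1 x.2 := by
    simp only [hR]
    fun_prop (disch := intro x; have := hk1 x; have := hp1 x; positivity)
  -- The flux 2ζq of k²ζ² + p²q² vanishes at t = 0, where q = 0. The cross term kpζq is included
  -- because its flux kζ²/(2p) + pq²/(2k) leaves kζ²/(2p) there, which is the quantity to be
  -- observed.
  set H : ℝ → ℝ → ℝ := fun ξ t =>
    W ξ t * (2 * (ζ ξ t * q ξ t) + k ξ / 2 * (ζ ξ t ^ 2 / p t) + p t * q ξ t ^ 2 / (2 * k ξ))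
    with hH
  set H' : ℝ → ℝ → ℝ := fun ξ t =>
    W' ξ t * p t * (2 * (ζ ξ t * q ξ t) + k ξ / 2 * (ζ ξ t ^ 2 / p t) +
      p t * q ξ t ^ 2 / (2 * k ξ)) +
    W ξ t * (2 * (v ξ t * q ξ t + ζ ξ t * r ξ t) +
      k ξ / 2 * ((2 * ζ ξ t * v ξ t * p t - ζ ξ t ^ 2 * p₁ t) / p t ^ 2) +
      (p₁ t * q ξ t ^ 2 + p t * (2 * q ξ t * r ξ t)) / (2 * k ξ)) with hH'
  have hH'c : Continuous fun x : ℝ × ℝ => H' x.1 x.2 := by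
    simp only [hH']
    fun_prop (disch := intro x; have := hk1 x; have := hp1 x; positivity)
  have hHc : ∀ ξ, Continuous (H ξ) := fun ξ => by
    have h1 := hslice hWc ξ
    have h2 := hslice hζc ξ
    have h3 := hslice hqc ξ
    have h4 := hk0 ξ
    simp only [hH]
    fun_prop (disch := first | exact hp0 | (intro x; positivity))
  have hHd : ∀ ξ, ∀ t ∈ Ioo 0 T, HasDerivAt (H ξ) (H' ξ t) t := by
    intro ξ t ht
    have h1 := hs.ζ_time ξ t ht
    have h2 := hs.q_time ξ t ht
    have h3 := hpd t ht
    have h4 := (hWt ξ t).mul ((((h1.mul h2).const_mul 2).add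
      (((h1.pow 2).div h3 (hp0 t)).const_mul (k ξ / 2))).add
      ((h3.mul (h2.pow 2)).div_const (2 * k ξ)))
    refine h4.congr_deriv ?_
    simp only [hH', Pi.pow_apply, Pi.mul_apply, Pi.add_apply, Pi.div_apply]
    push_cast
    ring
  have hmain := integral_sub_eq_integral_integral_deriv (T := T)
    (G := fun ξ t => Real.exp (-C * ξ) * (W ξ t *
      (k ξ ^ 2 * ζ ξ t ^ 2 + p t ^ 2 * q ξ t ^ 2 + k ξ * p t * (ζ ξ t * q ξ t))))
    (G' := fun ξ t => Real.exp (-C * ξ) * (H' ξ t - R ξ t)) hπ.le (by fun_prop) (by fun_prop) (by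
      intro t ξ hξ
      have h1 := hs.ζ_space t ξ hξ
      have h2 := hs.q_space t ξ hξ
      have h3 := hkd ξ hξ
      have h4 : HasDerivAt (fun ξ => Real.exp (-C * ξ)) (Real.exp (-C * ξ) * (-C * 1)) ξ :=
        ((hasDerivAt_id ξ).const_mul (-C)).exp
      have h5 := h4.mul ((hWξ t ξ).mul ((((h3.pow 2).mul (h1.pow 2)).add
        ((h2.pow 2).const_mul (p t ^ 2))).add ((h3.mul_const (p t)).mul (h1.mul h2))))
      refine h5.congr_deriv ?_
      have hk := hk0 ξ
      have hp := hp0 t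
      simp only [hH', hR, Pi.pow_apply, Pi.mul_apply, Pi.add_apply]
      push_cast
      field_simp
      ring)
  have hinner : ∀ ξ ∈ Icc 0 Real.pi,
      (∫ t in (0 : ℝ)..T, Real.exp (-C * ξ) * (H' ξ t - R ξ t)) ≤
        -(κ * (ω (X ξ) * ζ ξ 0 ^ 2)) := by
    intro ξ hξ
    have hζξ := hslice hζc ξ
    have hqξ := hslice hqc ξ
    have hρξ := hslice hρc ξ
    have hRξ := hslice hRc ξ
    have hH'ξ := hslice hH'c ξ
    have hWξc := hslice hWc ξ
    rw [intervalIntegral.integral_const_mul,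
      intervalIntegral.integral_sub (hH'ξ.intervalIntegrable _ _) (hRξ.intervalIntegrable _ _)]
    have hWT : W ξ T = 0 := hωL _ (by
      have : τ T = ∫ ξ in (0 : ℝ)..Real.pi, 1 / k ξ := hTπ
      linarith [hX0 ξ hξ])
    have h1 : (∫ t in (0 : ℝ)..T, H' ξ t) = -(ω (X ξ) * (k ξ / 2 * (ζ ξ 0 ^ 2 / p 0))) := by
      rw [intervalIntegral.integral_eq_sub_of_hasDerivAt_of_le hT (hHc ξ).continuousOn (hHd ξ)
        (hH'ξ.intervalIntegrable _ _)]
      simp only [hH, hWT, hs.q_init]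
      simp only [hW, hτz]
      ring_nf
    have hWnn : ∀ t ∈ Icc 0 T, 0 ≤ W ξ t := fun t _ => hω0 _
    have hWanti : AntitoneOn (W ξ) (Icc 0 T) := by
      refine antitoneOn_of_deriv_nonpos (convex_Icc 0 T) hWξc.continuousOn
        (fun t _ => (hWt ξ t).differentiableAt.differentiableWithinAt) fun t _ => ?_
      rw [(hWt ξ t).deriv]
      exact mul_nonpos_of_nonpos_of_nonneg (hωn _) (hppos t).le
    have h2 := integral_weight_mul_sq_le hT hWξc hqξ hρξ hWnn hWanti hK (hρ ξ)
    have h3 : (∫ t in (0 : ℝ)..T, ((C * m / 2 - (3 * D + 1)) * (W ξ t * q ξ t ^ 2) -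
        (D + 1) * (W ξ t * ρ ξ t ^ 2))) ≤ ∫ t in (0 : ℝ)..T, R ξ t := by
      refine intervalIntegral.integral_mono_on hT (Continuous.intervalIntegrable (by fun_prop) _ _)
        (hRξ.intervalIntegrable _ _) fun t ht => ?_
      have h4 := weighted_energy_pointwise (k := k ξ) (p := p t) (k₁ := k₁ ξ) (p₁ := p₁ t)
        (w := W ξ t) (w' := W' ξ t) (z := ζ ξ t) (q := q ξ t) (ρ := ρ ξ t) (C := C) (D := D)
        (hkpos ξ) (hω0 _) (hωn _) hC0 (hmk ξ) (hmp t)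
        ((hb₁ ξ hξ t ht).trans (by linarith)) ((hb₂ ξ hξ t ht).trans (by linarith))
        ((hb₃ ξ hξ t ht).trans (by linarith)) ((hb₄ ξ hξ t ht).trans (by linarith))
        ((hb₅ ξ hξ t ht).trans (by linarith))
      have h5 : 0 ≤ (C * m / 2 - (3 * D + 1)) * (W ξ t * ζ ξ t ^ 2) := by
        rw [hCm]
        have := hWnn t ht
        have : 3 * D + 1 + (D + 1) * (K * (1 + T)) - (3 * D + 1) = (D + 1) * (K * (1 + T)) := by
          ring
        rw [this]
        positivity
      refine le_trans ?_ h4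
      linarith
    rw [intervalIntegral.integral_sub (Continuous.intervalIntegrable (by fun_prop) _ _)
      (Continuous.intervalIntegrable (by fun_prop) _ _), intervalIntegral.integral_const_mul,
      intervalIntegral.integral_const_mul] at h3
    have h6 : 0 ≤ ∫ t in (0 : ℝ)..T, R ξ t := by
      refine le_trans ?_ h3
      have h7 : C * m / 2 - (3 * D + 1) = (D + 1) * (K * (1 + T)) := by rw [hCm]; ring
      rw [h7]
      have := mul_le_mul_of_nonneg_left h2 (by positivity : 0 ≤ D + 1)
      linarith
    have h8 : κ * (ω (X ξ) * ζ ξ 0 ^ 2) ≤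
        Real.exp (-C * ξ) * (ω (X ξ) * (k ξ / 2 * (ζ ξ 0 ^ 2 / p 0))) := by
      have h9 : Real.exp (-C * Real.pi) ≤ Real.exp (-C * ξ) :=
        Real.exp_le_exp.2 (by nlinarith [hξ.2])
      have h10 : √m ≤ k ξ := Real.sqrt_le_iff.2 ⟨(hkpos ξ).le, hmk ξ⟩
      have h11 := hω0 (X ξ)
      calc κ * (ω (X ξ) * ζ ξ 0 ^ 2)
          = Real.exp (-C * Real.pi) * (ω (X ξ) * (√m / 2 * (ζ ξ 0 ^ 2 / p 0))) := by
            rw [hκ]; field_simp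
        _ ≤ _ := by gcongr
    rw [h1]
    have h12 := mul_nonneg (Real.exp_pos (-C * ξ)).le h6
    linarith
  have hζ0 := hslice' hζc 0
  have hup : (∫ ξ in (0 : ℝ)..Real.pi, ∫ t in (0 : ℝ)..T, Real.exp (-C * ξ) * (H' ξ t - R ξ t)) ≤
      ∫ ξ in (0 : ℝ)..Real.pi, -(κ * (ω (X ξ) * ζ ξ 0 ^ 2)) := by
    refine intervalIntegral.integral_mono_on hπ.le (Continuous.intervalIntegrable ?_ _ _)
      (Continuous.intervalIntegrable (by fun_prop) _ _) hinner
    exact intervalIntegral.continuous_parametric_intervalIntegral_of_continuous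
      (f := fun ξ t => Real.exp (-C * ξ) * (H' ξ t - R ξ t)) (by fun_prop) continuous_const
  rw [← hmain, intervalIntegral.integral_neg, intervalIntegral.integral_const_mul] at hup
  have hleft : -(A * ∫ t in (0 : ℝ)..T, q 0 t ^ 2) ≤ (∫ t in (0 : ℝ)..T,
      (Real.exp (-C * Real.pi) * (W Real.pi t * (k Real.pi ^ 2 * ζ Real.pi t ^ 2 +
        p t ^ 2 * q Real.pi t ^ 2 + k Real.pi * p t * (ζ Real.pi t * q Real.pi t))) -
      Real.exp (-C * 0) * (W 0 t * (k 0 ^ 2 * ζ 0 t ^ 2 + p t ^ 2 * q 0 t ^ 2 +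
        k 0 * p t * (ζ 0 t * q 0 t))))) := by
    have hq0 := hslice hqc 0
    have hqπ := hslice hqc Real.pi
    have hζπ := hslice hζc Real.pi
    have hWπ := hslice hWc Real.pi
    have hW0 := hslice hWc 0
    simp only [hs.ζ_left]
    rw [← intervalIntegral.integral_const_mul, ← intervalIntegral.integral_neg]
    refine intervalIntegral.integral_mono_on hT (Continuous.intervalIntegrable (by fun_prop) _ _)
      (Continuous.intervalIntegrable (by fun_prop) _ _) fun t ht => ?_
    have h1 : W Real.pi t = 0 := hωL _ (by
      have : X Real.pi = ∫ ξ in (0 : ℝ)..Real.pi, 1 / k ξ := rfl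
      linarith [hτ0 t ht])
    have h2 : W 0 t ≤ 1 := hω1 _
    have h3 : 0 ≤ W 0 t := hω0 _
    have h4 : p t ^ 2 ≤ A := (le_abs_self _).trans (hbA 0 (left_mem_Icc.2 hπ.le) t ht)
    have h5 : W 0 t * (p t ^ 2 * q 0 t ^ 2) ≤ 1 * (A * q 0 t ^ 2) := by gcongr
    rw [h1]
    simp only [mul_zero, Real.exp_zero]
    linarith
  rw [div_mul_eq_mul_div, le_div_iff₀ hκ0]
  linarith

/-- Observability in the critical time: the initial value of `ζ` is controlled by the trace of `q`
at `ξ = 0`. -/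
theorem exists_observability {k k₁ p p₁ : ℝ → ℝ} (hk : Continuous k)
    (hk₁ : Continuous k₁) (hkd : ∀ ξ ∈ Ioo 0 Real.pi, HasDerivAt k (k₁ ξ) ξ) (hkpos : ∀ ξ, 0 < k ξ)
    {T K m : ℝ} (hT : 0 ≤ T) (hp : Continuous p) (hp₁ : Continuous p₁)
    (hpd : ∀ t ∈ Ioo 0 T, HasDerivAt p (p₁ t) t) (hppos : ∀ t, 0 < p t) (hK : 0 ≤ K)
    (hm : 0 < m) (hmk : ∀ ξ, m ≤ k ξ ^ 2) (hmp : ∀ t, m ≤ p t ^ 2)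
    (hTπ : (∫ t in (0 : ℝ)..T, p t) = ∫ ξ in (0 : ℝ)..Real.pi, 1 / k ξ) :
    ∃ C, 0 ≤ C ∧ ∀ ζ q v r ρ : ℝ → ℝ → ℝ, WaveSystem k p T ζ q v r ρ →
      (∀ ξ, ∀ t ∈ Icc 0 T, ρ ξ t ^ 2 ≤ K * (q ξ t ^ 2 + ∫ s in (0 : ℝ)..t, q ξ s ^ 2)) →
      (∫ ξ in (0 : ℝ)..Real.pi, ζ ξ 0 ^ 2) ≤ C * ∫ t in (0 : ℝ)..T, q 0 t ^ 2 := by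
  obtain ⟨C, hC, hmain⟩ := exists_weighted_observability hk hk₁ hkd hkpos hT hp hp₁ hpd hppos hK hm
    hmk hmp hTπ
  refine ⟨C, hC, fun ζ q v r ρ hs hρ => ?_⟩
  have hkinv : Continuous fun ξ => 1 / k ξ := by
    fun_prop (disch := exact fun x => (hkpos x).ne')
  set L := ∫ ξ in (0 : ℝ)..Real.pi, 1 / k ξ with hL
  set X : ℝ → ℝ := fun ξ => ∫ y in (0 : ℝ)..ξ, 1 / k y with hX
  have hXc : Continuous X := continuous_primitive_of_continuous hkinv
  have hXL : ∀ ξ < Real.pi, X ξ < L := by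
    intro ξ hξ
    have h1 : X ξ + (∫ y in ξ..Real.pi, 1 / k y) = L :=
      intervalIntegral.integral_add_adjacent_intervals (hkinv.intervalIntegrable _ _)
        (hkinv.intervalIntegrable _ _)
    have h2 : 0 < ∫ y in ξ..Real.pi, 1 / k y :=
      intervalIntegral.intervalIntegral_pos_of_pos (hkinv.intervalIntegrable _ _)
        (fun y => one_div_pos.2 (hkpos y)) hξ
    linarith
  have hζ0 : Continuous fun ξ => ζ ξ 0 := hs.cont_ζ.comp (f := fun ξ : ℝ => (ξ, 0)) (by fun_prop)
  -- Smooth nonincreasing approximations of the indicator of x < L. As the constant is the same for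
  -- all of them, the limit loses neither time nor constant.
  let ω : ℕ → ℝ → ℝ := fun j x => Real.smoothTransition (j * (L - x))
  have hωsm : ∀ j, ContDiff ℝ 1 (ω j) := fun j =>
    Real.smoothTransition.contDiff.comp (by fun_prop)
  have hωanti : ∀ j, Antitone (ω j) := fun j x y hxy =>
    Real.smoothTransition.monotone (by gcongr)
  have hle : ∀ j : ℕ, (∫ ξ in (0 : ℝ)..Real.pi, ω j (X ξ) * ζ ξ 0 ^ 2) ≤
      C * ∫ t in (0 : ℝ)..T, q 0 t ^ 2 := by
    intro j
    refine hmain (ω j) (deriv (ω j)) (hωsm j).continuous ((hωsm j).continuous_deriv le_rfl)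
      (fun x => ((hωsm j).differentiable one_ne_zero x).hasDerivAt) (fun x => (hωanti j).deriv_nonpos)
      (fun x => Real.smoothTransition.nonneg _) (fun x => Real.smoothTransition.le_one _)
      (fun x hx => Real.smoothTransition.zero_of_nonpos ?_) ζ q v r ρ hs hρ
    exact mul_nonpos_of_nonneg_of_nonpos j.cast_nonneg (by linarith)
  have hωc : ∀ j, Continuous (ω j) := fun j => (hωsm j).continuous
  have hlim : Tendsto (fun j : ℕ => ∫ ξ in (0 : ℝ)..Real.pi, ω j (X ξ) * ζ ξ 0 ^ 2) atTop
      (𝓝 (∫ ξ in (0 : ℝ)..Real.pi, ζ ξ 0 ^ 2)) := by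
    refine intervalIntegral.tendsto_integral_filter_of_dominated_convergence
      (fun ξ => ζ ξ 0 ^ 2) (Eventually.of_forall fun j => ?_) (Eventually.of_forall fun j => ?_)
      (Continuous.intervalIntegrable (by fun_prop) _ _) ?_
    · have := hωc j
      exact Continuous.aestronglyMeasurable (by fun_prop)
    · refine ae_of_all _ fun ξ _ => ?_
      rw [Real.norm_eq_abs, abs_mul, abs_of_nonneg (sq_nonneg (ζ ξ 0)),
        abs_of_nonneg (Real.smoothTransition.nonneg _)]
      exact mul_le_of_le_one_left (sq_nonneg _) (Real.smoothTransition.le_one _)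
    · have hne : ∀ᵐ ξ : ℝ, ξ ≠ Real.pi := by simp [ae_iff]
      filter_upwards [hne] with ξ hξ hmem
      rw [uIoc_of_le Real.pi_pos.le] at hmem
      have hpos : 0 < L - X ξ := by linarith [hXL ξ (lt_of_le_of_ne hmem.2 hξ)]
      refine tendsto_const_nhds.congr' ?_
      obtain ⟨n, hn⟩ := exists_nat_ge (1 / (L - X ξ))
      filter_upwards [eventually_ge_atTop n] with j hj
      have h1 : 1 ≤ (j : ℝ) * (L - X ξ) := by
        rw [← div_le_iff₀ hpos]
        exact hn.trans (by exact_mod_cast hj)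
      simp only [ω, Real.smoothTransition.one_of_one_le h1, one_mul]
  exact le_of_tendsto hlim (Eventually.of_forall hle)

/-! ### Sturm–Liouville modes: energy comparison, orthogonality, bounds. -/

section

/-- The elasticity, extended to the whole line. -/
structure SpaceData (c c₁ : ℝ → ℝ) (c₀ : ℝ) : Prop where
  cont : Continuous c
  cont₁ : Continuous c₁
  deriv : ∀ ξ ∈ Ioo 0 Real.pi, HasDerivAt c (c₁ ξ) ξ
  pos : 0 < c₀
  lower : ∀ ξ, c₀ ≤ c ξ

/-- `a` and `b` are continuous, and `c a' = b`, `b' = μ a` on `(0, π)`, `a(0) = a(π) = 0`. -/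
structure ModePair (c : ℝ → ℝ) (μ : ℝ) (a b : ℝ → ℝ) : Prop where
  cont_a : Continuous a
  cont_b : Continuous b
  deriv_a : ∀ ξ ∈ Ioo 0 Real.pi, HasDerivAt a (b ξ / c ξ) ξ
  deriv_b : ∀ ξ ∈ Ioo 0 Real.pi, HasDerivAt b (μ * a ξ) ξ
  left : a 0 = 0
  right : a Real.pi = 0

variable {c c₁ : ℝ → ℝ} {c₀ : ℝ}

theorem SpaceData.c_pos (h : SpaceData c c₁ c₀) (ξ : ℝ) : 0 < c ξ := h.pos.trans_le (h.lower ξ)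

theorem SpaceData.continuous_div (h : SpaceData c c₁ c₀) {b : ℝ → ℝ} (hb : Continuous b) :
    Continuous fun ξ => b ξ / c ξ :=
  hb.div h.cont fun ξ => (h.c_pos ξ).ne'

/-- The energy density of a mode is comparable at any two points. -/
theorem SpaceData.exists_energy_comparison (h : SpaceData c c₁ c₀) :
    ∃ C, 0 < C ∧ ∀ l a b, ModePair c (-l ^ 2) a b → ∀ ξ ∈ Icc 0 Real.pi, ∀ η ∈ Icc 0 Real.pi,
      b ξ ^ 2 + c ξ * l ^ 2 * a ξ ^ 2 ≤ C * (b η ^ 2 + c η * l ^ 2 * a η ^ 2) := by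
  obtain ⟨D, hD, hb⟩ := exists_abs_le_of_continuousOn (h.cont₁.continuousOn (s := Icc 0 Real.pi))
  have hπ := Real.pi_pos
  have hc₀ := h.pos
  set K := D / c₀ with hK
  have hK0 : 0 ≤ K := by positivity
  refine ⟨Real.exp (K * Real.pi) * Real.exp (K * Real.pi), by positivity, ?_⟩
  intro l a b hab ξ hξ η hη
  set e : ℝ → ℝ := fun ξ => b ξ ^ 2 + c ξ * l ^ 2 * a ξ ^ 2 with he
  have hac := hab.cont_a
  have hbc := hab.cont_b
  have hcc := h.cont
  have hec : Continuous e := by fun_prop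
  -- The terms ∓2 l² a b cancel. What remains is at most (D/c₀) e, with a rate that does not depend
  -- on l.
  have hed : ∀ ξ ∈ Ioo 0 Real.pi, HasDerivAt e (c₁ ξ * l ^ 2 * a ξ ^ 2) ξ := by
    intro ξ hξ
    have h1 := ((hab.deriv_b ξ hξ).pow 2).add
      (((h.deriv ξ hξ).mul_const (l ^ 2)).mul ((hab.deriv_a ξ hξ).pow 2))
    refine h1.congr_deriv ?_
    have := (h.c_pos ξ).ne'
    simp only [Pi.pow_apply]
    field_simp
    ring
  have hbound : ∀ ξ ∈ Ioo 0 Real.pi, |c₁ ξ * l ^ 2 * a ξ ^ 2| ≤ K * e ξ := by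
    intro ξ hξ
    have h1 := hb ξ ⟨hξ.1.le, hξ.2.le⟩
    rw [abs_mul, abs_mul, abs_of_nonneg (sq_nonneg l), abs_of_nonneg (sq_nonneg (a ξ))]
    calc |c₁ ξ| * l ^ 2 * a ξ ^ 2 ≤ D * l ^ 2 * a ξ ^ 2 := by gcongr
      _ = K * (c₀ * l ^ 2 * a ξ ^ 2) := by rw [hK]; field_simp
      _ ≤ K * e ξ := by
          gcongr
          have := mul_le_mul_of_nonneg_right (h.lower ξ) (by positivity : 0 ≤ l ^ 2 * a ξ ^ 2)
          simp only [he]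
          nlinarith [sq_nonneg (b ξ)]
  have he0 : ∀ ξ, 0 ≤ e ξ := fun ξ => by have := (h.c_pos ξ).le; positivity
  have h1 := le_mul_exp_of_deriv_le hec.continuousOn hed
    (fun ξ hξ => (le_abs_self _).trans (hbound ξ hξ)) ξ hξ
  have h2 := le_mul_exp_of_deriv_le (f := fun ξ => -e ξ) (K := -K) hec.neg.continuousOn
    (fun ξ hξ => (hed ξ hξ).neg) (fun ξ hξ => by
      have := (neg_le_abs _).trans (hbound ξ hξ); linarith) η hη
  have h3 : e 0 ≤ Real.exp (K * Real.pi) * e η := by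
    have h4 : e 0 * Real.exp (-K * (η - 0)) ≤ e η := by linarith
    calc e 0 = Real.exp (K * η) * (e 0 * Real.exp (-K * (η - 0))) := by
          rw [mul_left_comm, ← Real.exp_add]; simp
      _ ≤ Real.exp (K * Real.pi) * e η := by
          gcongr
          · exact mul_nonneg (he0 0) (Real.exp_pos _).le
          · exact hη.2
  calc e ξ ≤ e 0 * Real.exp (K * (ξ - 0)) := h1
    _ ≤ e 0 * Real.exp (K * Real.pi) := by
        have := he0 0
        gcongr
        linarith [hξ.2]
    _ ≤ Real.exp (K * Real.pi) * e η * Real.exp (K * Real.pi) := by gcongr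
    _ = _ := by ring

/-- Green's identity: integrate the derivative of the product of b and a', whose boundary values
vanish by the Dirichlet conditions. It carries orthogonality from modes to fluxes. -/
theorem ModePair.integral_flux_mul (h : SpaceData c c₁ c₀) {μ μ' : ℝ} {a b a' b' : ℝ → ℝ}
    (hab : ModePair c μ a b) (hab' : ModePair c μ' a' b') :
    (∫ ξ in (0 : ℝ)..Real.pi, b ξ * b' ξ / c ξ) =
      -μ * ∫ ξ in (0 : ℝ)..Real.pi, a ξ * a' ξ := by
  have hac := hab.cont_a
  have hbc := hab.cont_b
  have hac' := hab'.cont_a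
  have hbc' := hab'.cont_b
  have hdiv : Continuous fun ξ => b ξ * b' ξ / c ξ := h.continuous_div (hbc.mul hbc')
  have h1 := intervalIntegral.integral_eq_sub_of_hasDerivAt_of_le Real.pi_pos.le
    (f := fun ξ => b ξ * a' ξ) (f' := fun ξ => μ * (a ξ * a' ξ) + b ξ * b' ξ / c ξ) (by fun_prop)
    (fun ξ hξ => ((hab.deriv_b ξ hξ).mul (hab'.deriv_a ξ hξ)).congr_deriv (by ring))
    (Continuous.intervalIntegrable (by fun_prop) _ _)
  rw [intervalIntegral.integral_add (Continuous.intervalIntegrable (by fun_prop) _ _)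
    (hdiv.intervalIntegrable _ _), intervalIntegral.integral_const_mul, hab'.left, hab'.right] at h1
  linarith

theorem ModePair.integral_mul_eq_zero (h : SpaceData c c₁ c₀) {μ μ' : ℝ} {a b a' b' : ℝ → ℝ}
    (hab : ModePair c μ a b) (hab' : ModePair c μ' a' b') (hne : μ ≠ μ') :
    (∫ ξ in (0 : ℝ)..Real.pi, a ξ * a' ξ) = 0 := by
  have h1 := hab.integral_flux_mul h hab'
  have h2 := hab'.integral_flux_mul h hab
  have h3 : (∫ ξ in (0 : ℝ)..Real.pi, b' ξ * b ξ / c ξ) = ∫ ξ in (0 : ℝ)..Real.pi,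
      b ξ * b' ξ / c ξ := intervalIntegral.integral_congr fun ξ _ => by ring
  have h4 : (∫ ξ in (0 : ℝ)..Real.pi, a' ξ * a ξ) = ∫ ξ in (0 : ℝ)..Real.pi, a ξ * a' ξ :=
    intervalIntegral.integral_congr fun ξ _ => by ring
  rw [h3, h4] at h2
  have : (μ - μ') * (∫ ξ in (0 : ℝ)..Real.pi, a ξ * a' ξ) = 0 := by linarith
  exact (mul_eq_zero.1 this).resolve_left (sub_ne_zero.2 hne)

/-- Eigenvalues are simple. -/
theorem ModePair.proportional (h : SpaceData c c₁ c₀) {l : ℝ} (hl : l ≠ 0) {a b a' b' : ℝ → ℝ}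
    (hab : ModePair c (-l ^ 2) a b) (hab' : ModePair c (-l ^ 2) a' b') :
    ∀ ξ ∈ Icc 0 Real.pi, b' 0 * a ξ = b 0 * a' ξ := by
  obtain ⟨C, hC, hcomp⟩ := h.exists_energy_comparison
  -- This combination has zero value and zero flux at ξ = 0, so its energy is zero there and hence
  -- everywhere.
  have hcomb : ModePair c (-l ^ 2) (fun ξ => b' 0 * a ξ - b 0 * a' ξ)
      (fun ξ => b' 0 * b ξ - b 0 * b' ξ) := by
    have hac := hab.cont_a
    have hbc := hab.cont_b
    have hac' := hab'.cont_a
    have hbc' := hab'.cont_b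
    refine ⟨by fun_prop, by fun_prop, fun ξ hξ => ?_, fun ξ hξ => ?_, ?_, ?_⟩
    · exact (((hab.deriv_a ξ hξ).const_mul _).sub ((hab'.deriv_a ξ hξ).const_mul _)).congr_deriv
        (by ring)
    · exact (((hab.deriv_b ξ hξ).const_mul _).sub ((hab'.deriv_b ξ hξ).const_mul _)).congr_deriv
        (by ring)
    · simp [hab.left, hab'.left]
    · simp [hab.right, hab'.right]
  intro ξ hξ
  have h1 := hcomp l _ _ hcomb ξ hξ 0 (left_mem_Icc.2 Real.pi_pos.le)
  simp only [hab.left, hab'.left] at h1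
  ring_nf at h1
  have h2 : c ξ * l ^ 2 * (b' 0 * a ξ - b 0 * a' ξ) ^ 2 ≤ 0 := by
    nlinarith [sq_nonneg (b' 0 * b ξ - b 0 * b' ξ)]
  have h3 : 0 < c ξ * l ^ 2 := mul_pos (h.c_pos ξ) (by positivity)
  have h4 : (b' 0 * a ξ - b 0 * a' ξ) ^ 2 = 0 :=
    le_antisymm (by by_contra hcon; nlinarith [not_le.1 hcon]) (sq_nonneg _)
  exact sub_eq_zero.1 (pow_eq_zero_iff two_ne_zero |>.1 h4)

/-- Uniform bounds for normalized modes. -/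
theorem SpaceData.exists_mode_bounds (h : SpaceData c c₁ c₀) :
    ∃ C, 0 < C ∧ ∀ l a b, 0 < l → ModePair c (-l ^ 2) a b →
      (∫ ξ in (0 : ℝ)..Real.pi, a ξ ^ 2) = 1 →
      l ^ 2 ≤ C * b 0 ^ 2 ∧ ∀ ξ ∈ Icc 0 Real.pi, |b ξ| ≤ C * l ∧ |a ξ| ≤ C * l * ξ := by
  obtain ⟨C, hC, hcomp⟩ := h.exists_energy_comparison
  have hπ := Real.pi_pos
  have hc₀ := h.pos
  have hinv : Continuous fun ξ => 1 / c ξ := h.continuous_div continuous_const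
  set J := ∫ ξ in (0 : ℝ)..Real.pi, 1 / c ξ with hJ
  have hJ0 : 0 < J := intervalIntegral.intervalIntegral_pos_of_pos (hinv.intervalIntegrable _ _)
    (fun y => one_div_pos.2 (h.c_pos y)) hπ
  set B := √(2 * C / J) with hB
  have hB0 : 0 ≤ B := Real.sqrt_nonneg _
  refine ⟨C * J + B + B / c₀, by positivity, fun l a b hl hab hnorm => ?_⟩
  have hac := hab.cont_a
  have hbc := hab.cont_b
  have hcc := h.cont
  have hcne : ∀ ξ, c ξ ≠ 0 := fun ξ => (h.c_pos ξ).ne'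
  have hbb : Continuous fun ξ => b ξ * b ξ / c ξ := h.continuous_div (hbc.mul hbc)
  have hec : Continuous fun ξ => (b ξ ^ 2 + c ξ * l ^ 2 * a ξ ^ 2) / c ξ :=
    h.continuous_div (by fun_prop)
  -- Equipartition: each half contributes l². Comparing the energy at a point with this average
  -- bounds b above everywhere, and below at 0, where a vanishes and the energy is b(0)².
  have htotal : (∫ ξ in (0 : ℝ)..Real.pi, (b ξ ^ 2 + c ξ * l ^ 2 * a ξ ^ 2) / c ξ) = 2 * l ^ 2 := by
    have h1 : ∀ ξ, (b ξ ^ 2 + c ξ * l ^ 2 * a ξ ^ 2) / c ξ = b ξ * b ξ / c ξ + l ^ 2 * a ξ ^ 2 := by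
      intro ξ
      have := hcne ξ
      field_simp
    simp only [h1]
    rw [intervalIntegral.integral_add (hbb.intervalIntegrable _ _)
      (Continuous.intervalIntegrable (by fun_prop) _ _), hab.integral_flux_mul h hab,
      intervalIntegral.integral_const_mul, hnorm]
    have : (∫ ξ in (0 : ℝ)..Real.pi, a ξ * a ξ) = 1 := by
      rw [← hnorm]; exact intervalIntegral.integral_congr fun ξ _ => by ring
    rw [this]; ring
  have hmem0 : (0 : ℝ) ∈ Icc 0 Real.pi := left_mem_Icc.2 hπ.le
  have hup : ∀ ξ ∈ Icc 0 Real.pi, (b ξ ^ 2 + c ξ * l ^ 2 * a ξ ^ 2) * J ≤ C * (2 * l ^ 2) := by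
    intro ξ hξ
    rw [← htotal, hJ, ← intervalIntegral.integral_const_mul, ← intervalIntegral.integral_const_mul]
    refine intervalIntegral.integral_mono_on hπ.le (Continuous.intervalIntegrable (by fun_prop) _ _)
      (Continuous.intervalIntegrable (by fun_prop) _ _) fun η hη => ?_
    rw [mul_one_div, mul_div_assoc']
    exact div_le_div_of_nonneg_right (hcomp l a b hab ξ hξ η hη) (h.c_pos η).le
  have hlow : 2 * l ^ 2 ≤ C * b 0 ^ 2 * J := by
    rw [← htotal, hJ, ← intervalIntegral.integral_const_mul]
    refine intervalIntegral.integral_mono_on hπ.le (Continuous.intervalIntegrable (by fun_prop) _ _)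
      (Continuous.intervalIntegrable (by fun_prop) _ _) fun η hη => ?_
    rw [mul_one_div]
    have := hcomp l a b hab η hη 0 hmem0
    rw [hab.left] at this
    simp only [ne_eq, OfNat.ofNat_ne_zero, not_false_eq_true, zero_pow, mul_zero, add_zero] at this
    exact div_le_div_of_nonneg_right this (h.c_pos η).le
  have hbB : ∀ ξ ∈ Icc 0 Real.pi, |b ξ| ≤ B * l := by
    intro ξ hξ
    have h1 := hup ξ hξ
    have h2 : 0 ≤ c ξ * l ^ 2 * a ξ ^ 2 * J := by have := (h.c_pos ξ).le; positivity
    refine abs_le_of_sq_le_sq ?_ (by positivity)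
    rw [mul_pow, hB, Real.sq_sqrt (by positivity), div_mul_eq_mul_div, le_div_iff₀ hJ0]
    nlinarith
  refine ⟨?_, fun ξ hξ => ⟨?_, ?_⟩⟩
  · have : 0 ≤ (B + B / c₀) * b 0 ^ 2 := by positivity
    nlinarith [sq_nonneg l]
  · refine (hbB ξ hξ).trans ?_
    have : 0 ≤ (C * J + B / c₀) * l := by positivity
    linarith
  · have hdiv := h.continuous_div hbc
    have h1 := intervalIntegral.integral_eq_sub_of_hasDerivAt_of_le hξ.1 hac.continuousOn
      (fun y hy => hab.deriv_a y ⟨hy.1, hy.2.trans_le hξ.2⟩) (hdiv.intervalIntegrable 0 ξ)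
    rw [hab.left, sub_zero] at h1
    have h2 : ‖∫ y in (0 : ℝ)..ξ, b y / c y‖ ≤ B * l / c₀ * |ξ - 0| := by
      refine intervalIntegral.norm_integral_le_of_norm_le_const fun y hy => ?_
      rw [uIoc_of_le hξ.1] at hy
      rw [Real.norm_eq_abs, abs_div, abs_of_pos (h.c_pos y)]
      exact div_le_div₀ (by positivity) (hbB y ⟨hy.1.le, hy.2.trans hξ.2⟩) hc₀ (h.lower y)
    rw [h1, Real.norm_eq_abs, sub_zero, abs_of_nonneg hξ.1] at h2
    refine h2.trans ?_
    have h3 : 0 ≤ (C * J + B) * l * ξ := by have := hξ.1; positivity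
    have h4 : B * l / c₀ * ξ = B / c₀ * l * ξ := by ring
    rw [h4]
    linarith

end

/-! ### Passing between functions on [0, π] and on the line. -/

section

/-- The restriction of `f` to `[0, π]`, extended by constants. -/
def spaceExt (f : ℝ → ℝ) : ℝ → ℝ := IccExtend Real.pi_pos.le ((Icc 0 Real.pi).domRestrict f)

theorem spaceExt_of_mem (f : ℝ → ℝ) {ξ : ℝ} (hξ : ξ ∈ Icc 0 Real.pi) : spaceExt f ξ = f ξ := by
  rw [spaceExt, IccExtend_of_mem _ _ hξ]; rfl

theorem spaceExt_mem (f : ℝ → ℝ) (ξ : ℝ) : ∃ η ∈ Icc 0 Real.pi, spaceExt f ξ = f η :=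
  ⟨projIcc 0 Real.pi Real.pi_pos.le ξ, (projIcc 0 Real.pi Real.pi_pos.le ξ).2, rfl⟩

theorem continuous_spaceExt {f : ℝ → ℝ} (hf : ContinuousOn f (Icc 0 Real.pi)) :
    Continuous (spaceExt f) :=
  (continuousOn_iff_continuous_domRestrict.1 hf).Icc_extend'

theorem hasDerivAt_spaceExt {f : ℝ → ℝ} {f' ξ : ℝ} (hξ : ξ ∈ Ioo 0 Real.pi)
    (hf : HasDerivWithinAt f f' (Icc 0 Real.pi) ξ) : HasDerivAt (spaceExt f) f' ξ := by
  have hn : Icc 0 Real.pi ∈ 𝓝 ξ := Icc_mem_nhds hξ.1 hξ.2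
  refine (hf.hasDerivAt hn).congr_of_eventuallyEq ?_
  filter_upwards [hn] with η hη using spaceExt_of_mem f hη

theorem uniqueDiffOn_space : UniqueDiffOn ℝ (Icc 0 Real.pi) := uniqueDiffOn_Icc Real.pi_pos

theorem spaceData_of_contDiffOn {c : ℝ → ℝ} {c₀ : ℝ} (hc₀ : 0 < c₀)
    (hc : ContDiffOn ℝ 1 c (Icc 0 Real.pi)) (hcpos : ∀ ξ ∈ Icc 0 Real.pi, c₀ < c ξ) :
    SpaceData (spaceExt c) (spaceExt (derivWithin c (Icc 0 Real.pi))) c₀ where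
  cont := continuous_spaceExt hc.continuousOn
  cont₁ := continuous_spaceExt (hc.continuousOn_derivWithin uniqueDiffOn_space le_rfl)
  deriv ξ hξ := by
    rw [spaceExt_of_mem _ ⟨hξ.1.le, hξ.2.le⟩]
    exact hasDerivAt_spaceExt hξ
      ((hc.differentiableOn one_ne_zero ξ ⟨hξ.1.le, hξ.2.le⟩).hasDerivWithinAt)
  pos := hc₀
  lower ξ := by
    obtain ⟨η, hη, h⟩ := spaceExt_mem c ξ
    rw [h]
    exact (hcpos η hη).le

variable {c : ℝ → ℝ} {c₀ : ℝ}

theorem SolvesEigenProblem.modePair {μ : ℝ} {ψ : ℝ → ℝ} (hcpos : ∀ ξ ∈ Icc 0 Real.pi, 0 < c ξ)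
    (h : SolvesEigenProblem c μ ψ) :
    ModePair (spaceExt c) μ (spaceExt ψ) (spaceExt fun ξ => c ξ * spaceDeriv ψ ξ) where
  cont_a := continuous_spaceExt h.contDiffOn.continuousOn
  cont_b := continuous_spaceExt fun ξ hξ => (h.eqn ξ hξ).continuousWithinAt
  deriv_a ξ hξ := by
    have hm : ξ ∈ Icc 0 Real.pi := ⟨hξ.1.le, hξ.2.le⟩
    rw [spaceExt_of_mem _ hm, spaceExt_of_mem _ hm, mul_div_cancel_left₀ _ (hcpos ξ hm).ne']
    exact hasDerivAt_spaceExt hξ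
      (h.contDiffOn.differentiableOn two_ne_zero ξ hm).hasDerivWithinAt
  deriv_b ξ hξ := by
    have hm : ξ ∈ Icc 0 Real.pi := ⟨hξ.1.le, hξ.2.le⟩
    rw [spaceExt_of_mem _ hm]
    exact hasDerivAt_spaceExt hξ (h.eqn ξ hm)
  left := by rw [spaceExt_of_mem _ (left_mem_Icc.2 Real.pi_pos.le), h.left]
  right := by rw [spaceExt_of_mem _ (right_mem_Icc.2 Real.pi_pos.le), h.right]

/-- A pair of functions solving the first order system on `[0, π]` gives a classical solution of
the eigenvalue problem. -/
theorem solvesEigenProblem_of_hasDerivWithinAt {μ : ℝ} {a b : ℝ → ℝ}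
    (hc : ContDiffOn ℝ 1 c (Icc 0 Real.pi)) (hcpos : ∀ ξ ∈ Icc 0 Real.pi, 0 < c ξ)
    (ha : ∀ ξ ∈ Icc 0 Real.pi, HasDerivWithinAt a (b ξ / c ξ) (Icc 0 Real.pi) ξ)
    (hb : ∀ ξ ∈ Icc 0 Real.pi, HasDerivWithinAt b (μ * a ξ) (Icc 0 Real.pi) ξ)
    (h0 : a 0 = 0) (hπ : a Real.pi = 0) : SolvesEigenProblem c μ a := by
  have hda : ∀ ξ ∈ Icc 0 Real.pi, derivWithin a (Icc 0 Real.pi) ξ = b ξ / c ξ := fun ξ hξ =>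
    (ha ξ hξ).derivWithin (uniqueDiffOn_space ξ hξ)
  have hac : ContinuousOn a (Icc 0 Real.pi) := fun ξ hξ => (ha ξ hξ).continuousWithinAt
  have hb1 : ContDiffOn ℝ 1 b (Icc 0 Real.pi) := by
    rw [show (1 : WithTop ℕ∞) = 0 + 1 by rfl, contDiffOn_succ_iff_derivWithin uniqueDiffOn_space]
    refine ⟨fun ξ hξ => (hb ξ hξ).differentiableWithinAt, by simp, ?_⟩
    rw [contDiffOn_zero]
    exact (hac.const_mul μ).congr fun ξ hξ =>
      (hb ξ hξ).derivWithin (uniqueDiffOn_space ξ hξ)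
  refine ⟨?_, h0, hπ, fun ξ hξ => ?_⟩
  · rw [show (2 : WithTop ℕ∞) = 1 + 1 by norm_num, contDiffOn_succ_iff_derivWithin uniqueDiffOn_space]
    refine ⟨fun ξ hξ => (ha ξ hξ).differentiableWithinAt, by simp, ?_⟩
    exact (hb1.div hc fun ξ hξ => (hcpos ξ hξ).ne').congr hda
  · refine (hb ξ hξ).congr (fun η hη => ?_) ?_
    · rw [spaceDeriv, hda η hη, mul_div_cancel₀ _ (hcpos η hη).ne']
    · rw [spaceDeriv, hda ξ hξ, mul_div_cancel₀ _ (hcpos ξ hξ).ne']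

theorem integral_spaceMeasure (f : ℝ → ℝ) :
    ∫ ξ, f ξ ∂spaceMeasure = ∫ ξ in (0 : ℝ)..Real.pi, f ξ := by
  rw [intervalIntegral.integral_of_le Real.pi_pos.le, integral_Ioc_eq_integral_Ioo]

theorem innerL2_eq_spaceExt (u v : ℝ → ℝ) :
    innerL2 u v = ∫ ξ in (0 : ℝ)..Real.pi, spaceExt u ξ * spaceExt v ξ := by
  rw [innerL2, integral_spaceMeasure]
  refine intervalIntegral.integral_congr fun ξ hξ => ?_
  rw [uIcc_of_le Real.pi_pos.le] at hξ
  simp only [spaceExt_of_mem _ hξ]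

theorem memLp_space_of_continuousOn {f : ℝ → ℝ} (hf : ContinuousOn f (Icc 0 Real.pi)) :
    MemLp f 2 spaceMeasure := by
  have h1 : MemLp (spaceExt f) 2 spaceMeasure :=
    (memLp_two_of_continuous (continuous_spaceExt hf) 0 Real.pi).mono_measure
      (Measure.restrict_mono Ioo_subset_Ioc_self le_rfl)
  refine h1.ae_eq ?_
  filter_upwards [ae_restrict_mem measurableSet_Ioo] with ξ hξ
    using spaceExt_of_mem f ⟨hξ.1.le, hξ.2.le⟩

end

/-! ### Compact operators into L²(0, π) given by continuous features. -/

section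

/-- The Hilbert space `L²(0, π)`. -/
abbrev SpaceL2 : Type := Lp ℝ 2 spaceMeasure

section FeatureOperator

theorem exists_norm_le_on_space {H : Type*} [NormedAddCommGroup H] {γ : ℝ → H} (hγ : Continuous γ) :
    ∃ C, 0 ≤ C ∧ ∀ s ∈ Icc 0 Real.pi, ‖γ s‖ ≤ C := by
  obtain ⟨C, hC⟩ := isCompact_Icc.exists_bound_of_continuousOn (hγ.continuousOn (s := Icc 0 Real.pi))
  exact ⟨max C 0, le_max_right _ _, fun s hs => (hC s hs).trans (le_max_left _ _)⟩

variable {H : Type*} [NormedAddCommGroup H] [InnerProductSpace ℝ H]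

theorem memLp_inner_feature {γ : ℝ → H} (hγ : Continuous γ) (f : H) :
    MemLp (fun s => inner ℝ (γ s) f) 2 spaceMeasure :=
  memLp_space_of_continuousOn (hγ.inner continuous_const).continuousOn

theorem norm_toLp_le {u : ℝ → ℝ} (hu : MemLp u 2 spaceMeasure) {C : ℝ} (hC : 0 ≤ C)
    (h : ∀ s ∈ Ioo 0 Real.pi, |u s| ≤ C) :
    ‖hu.toLp u‖ ≤ (measureUnivNNReal spaceMeasure : ℝ) ^ (2 : ENNReal).toReal⁻¹ * C := by
  refine Lp.norm_le_of_ae_bound hC ?_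
  filter_upwards [hu.coeFn_toLp, ae_restrict_mem measurableSet_Ioo] with s hs hs'
  rw [hs]
  exact h s hs'

/-- The operator `f ↦ (s ↦ ⟪γ s, f⟫)` into `L²(0, π)`. -/
def featureOp (γ : ℝ → H) (hγ : Continuous γ) : H →L[ℝ] SpaceL2 :=
  LinearMap.mkContinuous
    { toFun := fun f => (memLp_inner_feature hγ f).toLp _
      map_add' := fun f g => by
        rw [← MemLp.toLp_add]
        exact MemLp.toLp_congr _ _ (ae_of_all _ fun s => inner_add_right _ _ _)
      map_smul' := fun r f => by
        rw [RingHom.id_apply, ← MemLp.toLp_const_smul]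
        exact MemLp.toLp_congr _ _ (ae_of_all _ fun s => inner_smul_right _ _ _) }
    ((measureUnivNNReal spaceMeasure : ℝ) ^ (2 : ENNReal).toReal⁻¹ *
      (exists_norm_le_on_space hγ).choose) (fun f => by
        have h := (exists_norm_le_on_space hγ).choose_spec
        rw [mul_assoc]
        refine norm_toLp_le (memLp_inner_feature hγ f) (mul_nonneg h.1 (norm_nonneg f)) fun s hs => ?_
        refine (abs_real_inner_le_norm _ _).trans ?_
        gcongr
        exact h.2 s ⟨hs.1.le, hs.2.le⟩)

theorem coeFn_featureOp (γ : ℝ → H) (hγ : Continuous γ) (f : H) :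
    featureOp γ hγ f =ᵐ[spaceMeasure] fun s => inner ℝ (γ s) f :=
  (memLp_inner_feature hγ f).coeFn_toLp

theorem isCompactOperator_smulRight {G : Type*} [NormedAddCommGroup G] [NormedSpace ℝ G]
    (φ : H →L[ℝ] ℝ) (g : G) : IsCompactOperator (φ.smulRight g) := by
  have h1 : IsCompactOperator φ := isCompactOperator_of_locallyCompactSpace_dom φ
  exact h1.clm_comp (ContinuousLinearMap.toSpanSingleton ℝ g)

theorem isCompactOperator_sum {G ι : Type*} [NormedAddCommGroup G] [NormedSpace ℝ G]
    (s : Finset ι) (T : ι → H →L[ℝ] G) (h : ∀ i ∈ s, IsCompactOperator (T i)) :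
    IsCompactOperator (∑ i ∈ s, T i : H →L[ℝ] G) := by
  classical
  induction s using Finset.induction_on with
  | empty => simpa using isCompactOperator_zero
  | insert i s hi ih =>
    rw [Finset.sum_insert hi]
    exact (h i (Finset.mem_insert_self _ _)).add
      (ih fun j hj => h j (Finset.mem_insert_of_mem hj))

/-- Uniform continuity of γ on [0, π]: sampling γ at the grid points ⌊sm⌋/m gives finite rank
operators that converge in operator norm. -/
theorem isCompactOperator_featureOp (γ : ℝ → H) (hγ : Continuous γ) :
    IsCompactOperator (featureOp γ hγ) := by
  have hπ := Real.pi_pos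
  let I : ℕ → ℕ → Set ℝ := fun m i => {s | ⌊s * m⌋₊ = i}
  have hI : ∀ m i, MeasurableSet (I m i) := fun m i =>
    (Nat.measurable_floor.comp (measurable_id.mul_const (m : ℝ))) (measurableSet_singleton i)
  let e : ℕ → ℕ → SpaceL2 := fun m i => indicatorConstLp 2 (hI m i) (measure_ne_top _ _) (1 : ℝ)
  -- Since π ≤ 4, ⌊sm⌋ ≤ 4m for s in (0, π), and 4m + 1 cells cover the interval.
  let T : ℕ → H →L[ℝ] SpaceL2 := fun m =>
    ∑ i ∈ Finset.range (4 * m + 1), (innerSL ℝ (γ (i / m))).smulRight (e m i)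
  have hTc : ∀ m, IsCompactOperator (T m) := fun m =>
    isCompactOperator_sum _ _ fun i _ => isCompactOperator_smulRight _ _
  have hTfun : ∀ m f, T m f =ᵐ[spaceMeasure] fun s => inner ℝ (γ (⌊s * m⌋₊ / m)) f := by
    intro m f
    have h1 : T m f = ∑ i ∈ Finset.range (4 * m + 1), (inner ℝ (γ (i / m)) f : ℝ) • e m i := by
      simp [T]
    have h2 : ∀ i, e m i =ᵐ[spaceMeasure] (I m i).indicator fun _ => (1 : ℝ) := fun i =>
      indicatorConstLp_coeFn
    rw [h1]
    have h3 := Lp.coeFn_finsetSum (μ := spaceMeasure) (p := 2) (E := ℝ)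
      (Finset.range (4 * m + 1)) (fun i => (inner ℝ (γ (i / m)) f : ℝ) • e m i)
    have h4 : ∀ i : ℕ, ((inner ℝ (γ (i / m)) f : ℝ) • e m i : SpaceL2) =ᵐ[spaceMeasure]
        fun s => inner ℝ (γ (i / m)) f * (e m i s) := fun i => by
      filter_upwards [Lp.coeFn_smul (inner ℝ (γ (i / m)) f : ℝ) (e m i)] with s hs
      rw [hs]; rfl
    filter_upwards [h3, ae_all_iff.2 h2, ae_all_iff.2 h4, ae_restrict_mem measurableSet_Ioo]
      with s hs1 hs2 hs4 hs3
    rw [hs1]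
    simp only [Finset.sum_apply, hs4, hs2]
    rw [Finset.sum_eq_single ⌊s * m⌋₊]
    · simp [I, indicator]
    · intro i _ hi
      have hs : s ∉ I m i := fun h => hi h.symm
      rw [indicator_of_notMem hs, mul_zero]
    · intro h
      exfalso
      apply h
      rw [Finset.mem_range, Nat.lt_succ_iff]
      refine Nat.floor_le_of_le ?_
      push_cast
      have : s ≤ 4 := hs3.2.le.trans Real.pi_le_four
      gcongr
  refine isCompactOperator_of_tendsto (F := T) (l := atTop) ?_ (Eventually.of_forall hTc)
  rw [Metric.tendsto_atTop]
  intro ε hε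
  set Kμ : ℝ := (measureUnivNNReal spaceMeasure : ℝ) ^ (2 : ENNReal).toReal⁻¹ with hKμ
  have hKμ0 : 0 ≤ Kμ := by positivity
  have hunif : UniformContinuousOn γ (Icc 0 Real.pi) :=
    isCompact_Icc.uniformContinuousOn_of_continuous hγ.continuousOn
  obtain ⟨δ, hδ, hγδ⟩ := Metric.uniformContinuousOn_iff.1 hunif (ε / (2 * (Kμ + 1))) (by positivity)
  obtain ⟨n, hn⟩ := exists_nat_gt (1 / δ)
  refine ⟨n + 1, fun m hm => ?_⟩
  have hm0 : (0 : ℝ) < m := by exact_mod_cast (Nat.succ_pos n).trans_le hm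
  have hmδ : 1 / (m : ℝ) < δ := by
    rw [one_div_lt hm0 hδ]
    refine hn.trans ?_
    exact_mod_cast hm
  rw [dist_eq_norm]
  refine lt_of_le_of_lt (ContinuousLinearMap.opNorm_le_bound _ (by positivity : 0 ≤ ε / 2)
    fun f => ?_) (half_lt_self hε)
  have hbound : ‖T m f - featureOp γ hγ f‖ ≤ Kμ * (ε / (2 * (Kμ + 1)) * ‖f‖) := by
    refine Lp.norm_le_of_ae_bound (by positivity) ?_
    filter_upwards [Lp.coeFn_sub (T m f) (featureOp γ hγ f), hTfun m f, coeFn_featureOp γ hγ f,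
      ae_restrict_mem measurableSet_Ioo] with s h1 h2 h3 h4
    rw [h1, Pi.sub_apply, h2, h3, ← inner_sub_left, Real.norm_eq_abs]
    refine (abs_real_inner_le_norm _ _).trans ?_
    gcongr
    rw [← dist_eq_norm]
    have h5 : (⌊s * m⌋₊ : ℝ) ≤ s * m := Nat.floor_le (mul_nonneg h4.1.le hm0.le)
    have h6 : s * m < ⌊s * m⌋₊ + 1 := Nat.lt_floor_add_one _
    have h7 : (⌊s * m⌋₊ : ℝ) / m ≤ s := by rwa [div_le_iff₀ hm0]
    refine (hγδ _ ⟨by positivity, h7.trans h4.2.le⟩ s ⟨h4.1.le, h4.2.le⟩ ?_).le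
    rw [Real.dist_eq, abs_sub_comm, abs_of_nonneg (sub_nonneg.2 h7)]
    refine lt_trans ?_ hmδ
    rw [sub_lt_iff_lt_add, ← add_div, lt_div_iff₀ hm0]
    linarith
  refine hbound.trans ?_
  rw [← mul_assoc]
  gcongr
  rw [mul_div_assoc', div_le_div_iff₀ (by positivity) two_pos]
  nlinarith

end FeatureOperator

end

/-! ### The Green operator as a square D*D. -/

section

/-- The indicator function of `(0, s)` as an element of `L²(0, π)`. -/
def stepFeature (s : ℝ) : SpaceL2 :=
  indicatorConstLp 2 (measurableSet_Iio (a := s)) (measure_ne_top _ _) (1 : ℝ)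

theorem continuous_stepFeature : Continuous stepFeature := by
  refine continuous_indicatorConstLp_set (by simp) fun x => ?_
  have hle : ∀ y, spaceMeasure (symmDiff (Iio y) (Iio x)) ≤ ENNReal.ofReal |y - x| := by
    intro y
    refine (Measure.restrict_apply_le _ _).trans ?_
    have hsub : symmDiff (Iio y) (Iio x) ⊆ uIcc x y := by
      intro z hz
      rw [mem_symmDiff] at hz
      rw [mem_uIcc]
      rcases hz with ⟨h1, h2⟩ | ⟨h1, h2⟩
      · exact Or.inl ⟨not_lt.1 h2, (mem_Iio.1 h1).le⟩
      · exact Or.inr ⟨not_lt.1 h2, (mem_Iio.1 h1).le⟩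
    exact (measure_mono hsub).trans_eq Real.volume_interval
  refine tendsto_of_tendsto_of_tendsto_of_le_of_le tendsto_const_nhds ?_ (fun _ => bot_le) hle
  have : Continuous fun y : ℝ => ENNReal.ofReal |y - x| :=
    ENNReal.continuous_ofReal.comp (by fun_prop)
  simpa using this.tendsto x

theorem intervalIntegrable_SpaceL2 (f : SpaceL2) {s t : ℝ} (hs : s ∈ Icc 0 Real.pi)
    (ht : t ∈ Icc 0 Real.pi) : IntervalIntegrable f volume s t := by
  have h1 : IntegrableOn f (Ioo 0 Real.pi) := (Lp.memLp f).integrable one_le_two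
  have h2 : IntegrableOn f (Icc 0 Real.pi) := (integrableOn_Icc_iff_integrableOn_Ioo).2 h1
  exact (h2.mono_set (uIcc_subset_Icc hs ht)).intervalIntegrable

theorem inner_stepFeature (f : SpaceL2) {s : ℝ} (hs : s ∈ Icc 0 Real.pi) :
    inner ℝ (stepFeature s) f = ∫ r in (0 : ℝ)..s, f r := by
  rw [stepFeature, L2.inner_indicatorConstLp_one, Measure.restrict_restrict measurableSet_Iio,
    intervalIntegral.integral_of_le hs.1, integral_Ioc_eq_integral_Ioo]
  congr 2
  ext x
  simp only [mem_inter_iff, mem_Iio, mem_Ioo]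
  exact ⟨fun h => ⟨h.2.1, h.1⟩, fun h => ⟨h.2, h.1, h.2.trans_le hs.2⟩⟩

variable {c c₁ : ℝ → ℝ} {c₀ : ℝ}

/-- The mean of the step functions with respect to the density `1 / c`. -/
def meanFeature (c : ℝ → ℝ) : SpaceL2 :=
  (∫ r in (0 : ℝ)..Real.pi, 1 / c r)⁻¹ • ∫ r in (0 : ℝ)..Real.pi, (1 / c r) • stepFeature r

theorem SpaceData.inner_meanFeature (h : SpaceData c c₁ c₀) (f : SpaceL2) :
    inner ℝ (meanFeature c) f = (∫ r in (0 : ℝ)..Real.pi, 1 / c r)⁻¹ *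
      ∫ r in (0 : ℝ)..Real.pi, inner ℝ (stepFeature r) f / c r := by
  have hc : Continuous fun r => (1 / c r) • stepFeature r :=
    (h.continuous_div continuous_const).smul continuous_stepFeature
  rw [meanFeature, real_inner_smul_left, real_inner_comm]
  congr 1
  have := (innerSL ℝ f).intervalIntegral_comp_comm (hc.intervalIntegrable (μ := volume) 0 Real.pi)
  rw [innerSL_apply_apply] at this
  rw [← this]
  refine intervalIntegral.integral_congr fun r _ => ?_
  simp only [innerSL_apply_apply, real_inner_smul_right, real_inner_comm]
  ring

/-- The features of the operator `f ↦ (∫₀ˢ f - κ(f)) / √c`, where `κ(f)` makes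
`(∫₀ˢ f - κ(f)) / c` a function of mean zero. -/
def fluxFeature (c : ℝ → ℝ) (s : ℝ) : SpaceL2 := (1 / √(c s)) • (stepFeature s - meanFeature c)

theorem SpaceData.continuous_fluxFeature (h : SpaceData c c₁ c₀) :
    Continuous (fluxFeature c) := by
  have h1 : Continuous fun s => 1 / √(c s) :=
    continuous_const.div (Real.continuous_sqrt.comp h.cont) fun s =>
      (Real.sqrt_pos.2 (h.c_pos s)).ne'
  exact h1.smul (continuous_stepFeature.sub continuous_const)

/-- The flux `∫₀ˢ f - κ(f)`. -/
def fluxOf (c : ℝ → ℝ) (f : SpaceL2) (s : ℝ) : ℝ :=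
  inner ℝ (stepFeature s) f - inner ℝ (meanFeature c) f

theorem continuous_fluxOf (c : ℝ → ℝ) (f : SpaceL2) : Continuous (fluxOf c f) :=
  (continuous_stepFeature.inner continuous_const).sub continuous_const

theorem SpaceData.integral_fluxOf (h : SpaceData c c₁ c₀) (f : SpaceL2) :
    (∫ s in (0 : ℝ)..Real.pi, fluxOf c f s / c s) = 0 := by
  have hinv : Continuous fun r => 1 / c r := h.continuous_div continuous_const
  have hst : Continuous fun r => (inner ℝ (stepFeature r) f : ℝ) / c r :=
    h.continuous_div (continuous_stepFeature.inner continuous_const)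
  have hJ0 : 0 < ∫ r in (0 : ℝ)..Real.pi, 1 / c r :=
    intervalIntegral.intervalIntegral_pos_of_pos (hinv.intervalIntegrable _ _)
      (fun y => one_div_pos.2 (h.c_pos y)) Real.pi_pos
  have h1 : ∀ s, fluxOf c f s / c s =
      (inner ℝ (stepFeature s) f : ℝ) / c s - inner ℝ (meanFeature c) f * (1 / c s) := fun s => by
    rw [fluxOf]; ring
  simp only [h1]
  rw [intervalIntegral.integral_sub (hst.intervalIntegrable _ _)
    ((hinv.const_mul _).intervalIntegrable _ _), intervalIntegral.integral_const_mul,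
    h.inner_meanFeature f]
  field_simp
  ring

/-- The function `fluxOf c f` divided by c has mean zero, so the constant subtracted in the flux of
g drops out. -/
theorem SpaceData.inner_featureOp (h : SpaceData c c₁ c₀) (f g : SpaceL2) :
    inner ℝ (featureOp _ h.continuous_fluxFeature f) (featureOp _ h.continuous_fluxFeature g) =
      ∫ s in (0 : ℝ)..Real.pi, fluxOf c f s / c s * inner ℝ (stepFeature s) g := by
  have h1 : inner ℝ (featureOp _ h.continuous_fluxFeature f)
      (featureOp _ h.continuous_fluxFeature g) =
      ∫ s in (0 : ℝ)..Real.pi, fluxOf c f s / c s * fluxOf c g s := by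
    rw [L2.inner_def, ← integral_spaceMeasure]
    refine integral_congr_ae ?_
    filter_upwards [coeFn_featureOp _ h.continuous_fluxFeature f,
      coeFn_featureOp _ h.continuous_fluxFeature g] with s hf hg
    rw [hf, hg]
    have h2 := Real.mul_self_sqrt (h.c_pos s).le
    have h3 := (Real.sqrt_pos.2 (h.c_pos s)).ne'
    have h4 := (h.c_pos s).ne'
    simp only [fluxFeature, real_inner_smul_left, inner_sub_left, fluxOf, RCLike.inner_apply,
      conj_trivial]
    field_simp
    rw [pow_two, h2]
    field_simp
  rw [h1]
  have hw : Continuous fun s => fluxOf c f s / c s := h.continuous_div (continuous_fluxOf c f)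
  have hst : Continuous fun s => (inner ℝ (stepFeature s) g : ℝ) :=
    continuous_stepFeature.inner continuous_const
  have h5 : ∀ s, fluxOf c f s / c s * fluxOf c g s =
      fluxOf c f s / c s * inner ℝ (stepFeature s) g -
        fluxOf c f s / c s * inner ℝ (meanFeature c) g := fun s => by
    rw [fluxOf, fluxOf]; ring
  simp only [h5]
  have hws : Continuous fun s => fluxOf c f s / c s * inner ℝ (stepFeature s) g := hw.mul hst
  rw [intervalIntegral.integral_sub (hws.intervalIntegrable _ _)
    ((hw.mul_const _).intervalIntegrable _ _), intervalIntegral.integral_mul_const,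
    h.integral_fluxOf, zero_mul, sub_zero]

/-- Fubini exhibits D*D f as u(r) = ∫_r^π (flux of f)/c. Formally (c u')' = -f and u(π) = 0, while
u(0) = 0 is the mean zero property: this is the Dirichlet Green operator. -/
theorem SpaceData.inner_featureOp_eq (h : SpaceData c c₁ c₀) (f g : SpaceL2) :
    inner ℝ (featureOp _ h.continuous_fluxFeature f) (featureOp _ h.continuous_fluxFeature g) =
      ∫ r in (0 : ℝ)..Real.pi, (∫ s in r..Real.pi, fluxOf c f s / c s) * g r := by
  have hw : Continuous fun s => fluxOf c f s / c s := h.continuous_div (continuous_fluxOf c f)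
  have hπ := Real.pi_pos.le
  rw [h.inner_featureOp f g]
  have h1 : (∫ s in (0 : ℝ)..Real.pi, fluxOf c f s / c s * inner ℝ (stepFeature s) g) =
      ∫ s in (0 : ℝ)..Real.pi, ∫ r in (0 : ℝ)..s, fluxOf c f s / c s * g r := by
    refine intervalIntegral.integral_congr fun s hs => ?_
    rw [uIcc_of_le hπ] at hs
    simp only [inner_stepFeature g hs, intervalIntegral.integral_const_mul]
  have hg : IntegrableOn g (Icc 0 Real.pi) :=
    (integrableOn_Icc_iff_integrableOn_Ioo).2 ((Lp.memLp g).integrable one_le_two)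
  rw [h1, integral_triangle_swap (F := fun s r => fluxOf c f s / c s * g r) hπ]
  · refine intervalIntegral.integral_congr fun r _ => ?_
    simp only [intervalIntegral.integral_mul_const]
  · have h2 : IntegrableOn (fun p : ℝ × ℝ => g p.2) (Icc 0 Real.pi ×ˢ Icc 0 Real.pi) := by
      have : Integrable (fun p : ℝ × ℝ => g p.2)
          ((volume.restrict (Icc 0 Real.pi)).prod (volume.restrict (Icc 0 Real.pi))) :=
        Integrable.comp_snd hg _
      rwa [Measure.prod_restrict] at this
    refine IntegrableOn.continuousOn_mul (g := fun p : ℝ × ℝ => fluxOf c f p.1 / c p.1) ?_ h2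
      (isCompact_Icc.prod isCompact_Icc)
    exact (hw.comp continuous_fst).continuousOn

/-- The flux vanishes almost everywhere, hence on [0, π] by continuity. So the primitive of f is
constant, and Lebesgue differentiation gives f = 0. -/
theorem SpaceData.eq_zero_of_featureOp_eq_zero (h : SpaceData c c₁ c₀) {f : SpaceL2}
    (hf : featureOp _ h.continuous_fluxFeature f = 0) : f = 0 := by
  have hπ := Real.pi_pos
  have h1 : (fun s => fluxOf c f s) =ᵐ[volume.restrict (Ioo 0 Real.pi)] fun _ => 0 := by
    filter_upwards [coeFn_featureOp _ h.continuous_fluxFeature f,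
      Lp.coeFn_zero ℝ 2 spaceMeasure] with s hs h0
    rw [hf, h0] at hs
    have h3 := (Real.sqrt_pos.2 (h.c_pos s)).ne'
    simp only [fluxFeature, real_inner_smul_left, inner_sub_left, Pi.zero_apply] at hs
    rcases mul_eq_zero.1 hs.symm with h4 | h4
    · exact absurd h4 (one_div_ne_zero h3)
    · exact h4
  have h2 : EqOn (fluxOf c f) (fun _ => 0) (Icc 0 Real.pi) := by
    refine Measure.eqOn_Icc_of_ae_eq volume hπ.ne ?_ (continuous_fluxOf c f).continuousOn
      continuousOn_const
    rwa [Measure.restrict_congr_set Ioo_ae_eq_Icc.symm]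
  have hF : ∀ s ∈ Icc 0 Real.pi, (∫ r in (0 : ℝ)..s, f r) = 0 := by
    intro s hs
    have h3 := h2 hs
    have h4 := h2 (left_mem_Icc.2 hπ.le)
    simp only [fluxOf] at h3 h4
    rw [inner_stepFeature f hs] at h3
    rw [inner_stepFeature f (left_mem_Icc.2 hπ.le), intervalIntegral.integral_same] at h4
    linarith
  have hint := intervalIntegrable_SpaceL2 f (left_mem_Icc.2 hπ.le) (right_mem_Icc.2 hπ.le)
  have hd := hint.ae_hasDerivAt_integral
  refine Lp.eq_zero_iff_ae_eq_zero.2 ?_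
  rw [Filter.EventuallyEq, ae_restrict_iff' measurableSet_Ioo]
  filter_upwards [hd] with x hx hmem
  have h5 := hx (by rw [uIcc_of_le hπ.le]; exact ⟨hmem.1.le, hmem.2.le⟩) 0 left_mem_uIcc
  have h6 : HasDerivAt (fun x => ∫ t in (0 : ℝ)..x, f t) 0 x := by
    refine (hasDerivAt_const x (0 : ℝ)).congr_of_eventuallyEq ?_
    filter_upwards [Icc_mem_nhds hmem.1 hmem.2] with y hy using hF y hy
  exact h5.unique h6

end

/-! ### Completeness of the eigenfunctions. -/

section

variable {c : ℝ → ℝ} {c₀ : ℝ}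

theorem inner_SpaceL2_toLp {u v : ℝ → ℝ} (hu : MemLp u 2 spaceMeasure)
    (hv : MemLp v 2 spaceMeasure) : inner ℝ (hu.toLp u) (hv.toLp v) = innerL2 u v := by
  rw [L2.inner_def, innerL2]
  refine integral_congr_ae ?_
  filter_upwards [hu.coeFn_toLp, hv.coeFn_toLp] with s h1 h2
  rw [h1, h2]
  simp only [RCLike.inner_apply, conj_trivial, mul_comm]

/-- Eigenvectors of the Green operator for a nonzero eigenvalue come from classical
eigenfunctions. -/
theorem exists_solvesEigenProblem {c₁ : ℝ → ℝ} (hc : ContDiffOn ℝ 1 c (Icc 0 Real.pi))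
    (hcpos : ∀ ξ ∈ Icc 0 Real.pi, 0 < c ξ) (h : SpaceData (spaceExt c) c₁ c₀)
    {f : SpaceL2} {μ : ℝ} (hμ : μ ≠ 0)
    (hf : ∀ g : SpaceL2, inner ℝ (featureOp _ h.continuous_fluxFeature f)
      (featureOp _ h.continuous_fluxFeature g) = μ * inner ℝ f g) :
    ∃ a : ℝ → ℝ, f =ᵐ[spaceMeasure] a ∧ SolvesEigenProblem c (-μ⁻¹) a := by
  have hπ := Real.pi_pos
  set w : ℝ → ℝ := fun s => fluxOf (spaceExt c) f s / spaceExt c s with hw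
  have hwc : Continuous w := h.continuous_div (continuous_fluxOf _ f)
  -- Bootstrapping: f is its own Green potential divided by μ, hence has this continuous
  -- representative. Putting u for f in the flux makes the equation classical.
  set u : ℝ → ℝ := fun r => μ⁻¹ * ∫ s in r..Real.pi, w s with hu
  have hud : ∀ r, HasDerivAt u (-(μ⁻¹ * w r)) r := fun r =>
    ((intervalIntegral.integral_hasDerivAt_left (hwc.intervalIntegrable r Real.pi)
      (hwc.stronglyMeasurableAtFilter _ _) hwc.continuousAt).const_mul μ⁻¹).congr_deriv (by ring)
  have huc : Continuous u := continuous_iff_continuousAt.2 fun r => (hud r).continuousAt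
  have huL : MemLp u 2 spaceMeasure := memLp_space_of_continuousOn huc.continuousOn
  have hfu : f = huL.toLp u := by
    refine ext_inner_right ℝ fun g => ?_
    have h1 := hf g
    rw [h.inner_featureOp_eq f g] at h1
    have h2 : inner ℝ (huL.toLp u) g = ∫ r in (0 : ℝ)..Real.pi, u r * g r := by
      rw [L2.inner_def, ← integral_spaceMeasure]
      refine integral_congr_ae ?_
      filter_upwards [huL.coeFn_toLp] with s hs
      rw [hs]
      simp only [RCLike.inner_apply, conj_trivial, mul_comm]
    have h3 : (∫ r in (0 : ℝ)..Real.pi, u r * g r) =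
        μ⁻¹ * ∫ r in (0 : ℝ)..Real.pi, (∫ s in r..Real.pi, w s) * g r := by
      rw [← intervalIntegral.integral_const_mul]
      refine intervalIntegral.integral_congr fun r _ => ?_
      simp only [hu]
      ring
    rw [h2, h3, h1, ← mul_assoc, inv_mul_cancel₀ hμ, one_mul]
  have hfae : f =ᵐ[spaceMeasure] u := by
    conv_lhs => rw [hfu]
    exact huL.coeFn_toLp
  refine ⟨u, hfae, ?_⟩
  set b : ℝ → ℝ := fun s => -(μ⁻¹ * fluxOf (spaceExt c) f s) with hb
  have hint : ∀ s ∈ Icc 0 Real.pi, (∫ r in (0 : ℝ)..s, f r) = ∫ r in (0 : ℝ)..s, u r := by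
    intro s hs
    refine intervalIntegral.integral_congr_ae ?_
    have h1 := (ae_restrict_iff' measurableSet_Ioo).1 hfae
    have hne : ∀ᵐ x : ℝ, x ≠ Real.pi := by simp [ae_iff]
    filter_upwards [h1, hne] with r hr hr2 hmem
    rw [uIoc_of_le hs.1] at hmem
    exact hr ⟨hmem.1, lt_of_le_of_ne (hmem.2.trans hs.2) hr2⟩
  have hbeq : ∀ s ∈ Icc 0 Real.pi, b s = -(μ⁻¹ * ((∫ r in (0 : ℝ)..s, u r) -
      inner ℝ (meanFeature (spaceExt c)) f)) := by
    intro s hs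
    simp only [hb, fluxOf]
    rw [inner_stepFeature f hs, hint s hs]
  refine solvesEigenProblem_of_hasDerivWithinAt (b := b) hc hcpos ?_ ?_ ?_ ?_
  · intro ξ hξ
    refine ((hud ξ).congr_deriv ?_).hasDerivWithinAt
    simp only [hw, hb, spaceExt_of_mem c hξ]
    ring
  · intro ξ hξ
    have h1 := ((((hasDerivAt_primitive huc ξ).sub_const
      (inner ℝ (meanFeature (spaceExt c)) f)).const_mul μ⁻¹).neg).hasDerivWithinAt
      (s := Icc 0 Real.pi)
    exact (h1.congr_deriv (by ring)).congr hbeq (hbeq ξ hξ)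
  · simp only [hu]
    rw [h.integral_fluxOf, mul_zero]
  · simp [hu]

theorem IsDirichletEigensystem.integral_sq {lam : ℕ → ℝ} {φ : ℕ → ℝ → ℝ}
    (hφ : IsDirichletEigensystem c lam φ) (n : ℕ) :
    (∫ ξ in (0 : ℝ)..Real.pi, spaceExt (φ n) ξ ^ 2) = 1 := by
  rw [← hφ.normalized n, innerL2_eq_spaceExt]
  exact intervalIntegral.integral_congr fun ξ _ => by ring

theorem SolvesEigenProblem.memLp {μ : ℝ} {ψ : ℝ → ℝ} (h : SolvesEigenProblem c μ ψ) :
    MemLp ψ 2 spaceMeasure := memLp_space_of_continuousOn h.contDiffOn.continuousOn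

/-- The eigenfunctions form an orthonormal basis. -/
theorem IsDirichletEigensystem.isL2OrthonormalBasis {lam : ℕ → ℝ} {φ : ℕ → ℝ → ℝ} (hc₀ : 0 < c₀)
    (hc : ContDiffOn ℝ 1 c (Icc 0 Real.pi)) (hcpos : ∀ ξ ∈ Icc 0 Real.pi, c₀ < c ξ)
    (hφ : IsDirichletEigensystem c lam φ) : IsL2OrthonormalBasis φ := by
  have hsd := spaceData_of_contDiffOn hc₀ hc hcpos
  have hcpos' : ∀ ξ ∈ Icc 0 Real.pi, 0 < c ξ := fun ξ hξ => hc₀.trans (hcpos ξ hξ)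
  have hmem : ∀ n, MemLp (φ n) 2 spaceMeasure := fun n => (hφ.eigen n).memLp
  refine ⟨hmem, fun m n => ?_, fun g hg horth => ?_⟩
  · split_ifs with hmn
    · rw [hmn]; exact hφ.normalized n
    · rw [innerL2_eq_spaceExt]
      refine ((hφ.eigen m).modePair hcpos').integral_mul_eq_zero hsd
        ((hφ.eigen n).modePair hcpos') fun heq => hmn (hφ.strictMono.injective ?_)
      have h1 : lam m ^ 2 = lam n ^ 2 := by linarith
      exact (pow_left_inj₀ (hφ.pos m).le (hφ.pos n).le two_ne_zero).1 h1
  · set D := featureOp _ hsd.continuous_fluxFeature with hD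
    -- G is compact and symmetric, so its eigenspaces have trivial common orthogonal complement. It
    -- remains to see that g is orthogonal to each of them.
    set G : SpaceL2 →L[ℝ] SpaceL2 := (ContinuousLinearMap.adjoint D).comp D with hG
    have hGinner : ∀ f f' : SpaceL2, inner ℝ (G f) f' = inner ℝ (D f) (D f') := fun f f' => by
      rw [hG, ContinuousLinearMap.comp_apply, ContinuousLinearMap.adjoint_inner_left]
    have hGc : IsCompactOperator G :=
      (isCompactOperator_featureOp _ hsd.continuous_fluxFeature).clm_comp
        (ContinuousLinearMap.adjoint D)
    have hGs : (G : SpaceL2 →ₗ[ℝ] SpaceL2).IsSymmetric := fun f f' => by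
      change inner ℝ (G f) f' = inner ℝ f (G f')
      rw [hGinner, real_inner_comm (G f') f, hGinner, real_inner_comm]
    have hspec := ContinuousLinearMap.orthogonalComplement_iSup_eigenspaces_eq_bot hGc hGs
    have hkey : hg.toLp g ∈ (⨆ μ, Module.End.eigenspace (G : Module.End ℝ SpaceL2) μ)ᗮ := by
      rw [Submodule.mem_orthogonal]
      intro v hv
      refine Submodule.iSup_induction _ (motive := fun v => inner ℝ v (hg.toLp g) = (0 : ℝ)) hv
        (fun μ v hv => ?_) (inner_zero_left _) fun v v' h1 h2 => by
          rw [inner_add_left, h1, h2, add_zero]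
      have hGv : G v = μ • v := Module.End.mem_eigenspace_iff.1 hv
      -- For μ = 0 the eigenspace is trivial because D is injective. Otherwise v is a classical
      -- eigenfunction: it is zero, or by exhaustiveness and simplicity a multiple of some φ_n.
      by_cases hμ : μ = 0
      · have h1 : inner ℝ (D v) (D v) = (0 : ℝ) := by
          rw [← hGinner, hGv, hμ, zero_smul, inner_zero_left]
        rw [hsd.eq_zero_of_featureOp_eq_zero (inner_self_eq_zero.1 h1), inner_zero_left]
      · obtain ⟨a, hva, ha⟩ := exists_solvesEigenProblem hc hcpos' hsd hμ (f := v) fun f' => by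
          rw [← hD, ← hGinner, hGv, real_inner_smul_left]
        by_cases hnz : ∃ ξ ∈ Icc 0 Real.pi, a ξ ≠ 0
        · obtain ⟨n, hn⟩ := hφ.exhaustive _ _ ha hnz
          rw [hn] at ha
          have hprop := (ha.modePair hcpos').proportional hsd (hφ.pos n).ne'
            ((hφ.eigen n).modePair hcpos')
          set B := spaceExt (fun ξ => c ξ * spaceDeriv (φ n) ξ) 0
          set B' := spaceExt (fun ξ => c ξ * spaceDeriv a ξ) 0
          have hB : B ≠ 0 := by
            obtain ⟨C, _, hC⟩ := hsd.exists_mode_bounds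
            have h1 := (hC (lam n) _ _ (hφ.pos n) ((hφ.eigen n).modePair hcpos')
              (hφ.integral_sq n)).1
            intro h0
            have h2 : lam n ^ 2 ≤ C * B ^ 2 := h1
            rw [h0] at h2
            have := hφ.pos n
            nlinarith [sq_nonneg (lam n), pow_pos this 2]
          have hvφ : v = (B' / B) • (hmem n).toLp (φ n) := by
            refine Lp.ext ?_
            filter_upwards [hva, Lp.coeFn_smul (B' / B) ((hmem n).toLp (φ n)),
              (hmem n).coeFn_toLp, ae_restrict_mem measurableSet_Ioo] with ξ h1 h2 h3 h4
            have h5 : ξ ∈ Icc 0 Real.pi := ⟨h4.1.le, h4.2.le⟩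
            rw [h1, h2, Pi.smul_apply, h3, smul_eq_mul]
            have h6 := hprop ξ h5
            rw [spaceExt_of_mem _ h5, spaceExt_of_mem _ h5] at h6
            field_simp
            linarith
          rw [hvφ, real_inner_smul_left, inner_SpaceL2_toLp, horth n, mul_zero]
        · push Not at hnz
          have hv0 : v = 0 := by
            refine Lp.eq_zero_iff_ae_eq_zero.2 ?_
            filter_upwards [hva, ae_restrict_mem measurableSet_Ioo] with ξ h1 h2
            rw [h1, hnz ξ ⟨h2.1.le, h2.2.le⟩]
            rfl
          rw [hv0, inner_zero_left]
    rw [hspec, Submodule.mem_bot] at hkey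
    have h1 := hg.coeFn_toLp
    rw [hkey] at h1
    filter_upwards [h1, Lp.coeFn_zero ℝ 2 spaceMeasure] with ξ h2 h3
    rw [← h2, h3]

end

/-! ### Upper and lower Riesz bounds for the traces of the modes. -/

section

/-- A sequence of orthonormal modes with frequencies `lam n`. -/
structure Modes (c : ℝ → ℝ) (lam : ℕ → ℝ) (a b : ℕ → ℝ → ℝ) : Prop where
  pair : ∀ n, ModePair c (-(lam n) ^ 2) (a n) (b n)
  ortho : ∀ m n, (∫ ξ in (0 : ℝ)..Real.pi, a m ξ * a n ξ) = if m = n then 1 else 0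

/-- Finite Parseval with a weight, for use with modes (s = 1) and with fluxes (s = 1/c). -/
theorem integral_sq_sum_mul {F : Finset ℕ} {g : ℕ → ℝ → ℝ} {s : ℝ → ℝ} {d : ℕ → ℝ}
    (hg : ∀ n, Continuous (g n)) (hs : Continuous s)
    (h : ∀ m n, (∫ ξ in (0 : ℝ)..Real.pi, g m ξ * g n ξ * s ξ) = if m = n then d m else 0)
    (x : ℕ → ℝ) :
    (∫ ξ in (0 : ℝ)..Real.pi, (∑ n ∈ F, x n * g n ξ) ^ 2 * s ξ) = ∑ n ∈ F, x n ^ 2 * d n := by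
  have h1 : ∀ ξ, (∑ n ∈ F, x n * g n ξ) ^ 2 * s ξ =
      ∑ m ∈ F, ∑ n ∈ F, x m * x n * (g m ξ * g n ξ * s ξ) := by
    intro ξ
    rw [pow_two, Finset.sum_mul_sum, Finset.sum_mul]
    refine Finset.sum_congr rfl fun m _ => ?_
    rw [Finset.sum_mul]
    exact Finset.sum_congr rfl fun n _ => by ring
  have hc : ∀ m n, Continuous fun ξ => x m * x n * (g m ξ * g n ξ * s ξ) := fun m n => by
    have := hg m
    have := hg n
    fun_prop
  simp only [h1]
  rw [intervalIntegral.integral_finsetSum fun m _ =>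
    (continuous_finsetSum F fun n _ => hc m n).intervalIntegrable _ _]
  refine Finset.sum_congr rfl fun m hm => ?_
  rw [intervalIntegral.integral_finsetSum fun n _ => (hc m n).intervalIntegrable _ _]
  simp only [intervalIntegral.integral_const_mul, h, mul_ite, mul_zero]
  rw [Finset.sum_ite_eq, if_pos hm]
  ring

variable {P P₁ M M₁ : ℝ → ℝ} {p₀ : ℝ} {c c₁ : ℝ → ℝ} {c₀ : ℝ} {lam : ℕ → ℝ} {a b : ℕ → ℝ → ℝ}

theorem Modes.integral_sq_sum (hm : Modes c lam a b) (F : Finset ℕ) (x : ℕ → ℝ) :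
    (∫ ξ in (0 : ℝ)..Real.pi, (∑ n ∈ F, x n * a n ξ) ^ 2) = ∑ n ∈ F, x n ^ 2 := by
  have := integral_sq_sum_mul (F := F) (g := a) (s := fun _ => 1) (d := fun _ => 1)
    (fun n => (hm.pair n).cont_a) continuous_const (fun m n => by simp [hm.ortho]) x
  simpa using this

theorem Modes.integral_sq_flux_sum (hm : Modes c lam a b) (h : SpaceData c c₁ c₀) (F : Finset ℕ)
    (x : ℕ → ℝ) :
    (∫ ξ in (0 : ℝ)..Real.pi, (∑ n ∈ F, x n * b n ξ) ^ 2 * (1 / c ξ)) =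
      ∑ n ∈ F, x n ^ 2 * lam n ^ 2 := by
  refine integral_sq_sum_mul (F := F) (g := b) (s := fun ξ => 1 / c ξ) (d := fun n => lam n ^ 2)
    (fun n => (hm.pair n).cont_b) (h.continuous_div continuous_const) (fun m n => ?_) x
  have := (hm.pair m).integral_flux_mul h (hm.pair n)
  simp only [mul_one_div]
  rw [this, hm.ortho]
  split_ifs <;> simp

/-- Finite combinations of modes solve the wave system. -/
theorem waveSystem_sum (ht : TimeData P P₁ M M₁ p₀) (h : SpaceData c c₁ c₀)
    (hm : Modes c lam a b) {T τ : ℝ} (hτ : τ ≤ T) {z : ℕ → ℝ → ℝ}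
    (hz : ∀ n, ModalSol P M (lam n) T (z n)) (F : Finset ℕ) (w : ℕ → ℝ) :
    WaveSystem (fun ξ => √(c ξ)) (fun t => √(P (T - t))) τ
      (fun ξ t => ∑ n ∈ F, w n * a n ξ * z n t)
      (fun ξ t => ∑ n ∈ F, w n * b n ξ * conv (memoryPrimitive M) (z n) t)
      (fun ξ t => ∑ n ∈ F, w n * a n ξ *
        (-(lam n) ^ 2 * P (T - t) * conv (memoryPrimitive M) (z n) t))
      (fun ξ t => ∑ n ∈ F, w n * b n ξ * (z n t + conv M (z n) t))
      (fun ξ t => ∑ n ∈ F, w n * b n ξ * conv M (z n) t) := by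
  have hac := fun n => (hm.pair n).cont_a
  have hbc := fun n => (hm.pair n).cont_b
  have hzc := fun n => (hz n).cont
  have hZc := fun n => continuous_conv (continuous_memoryPrimitive ht.contM) (hzc n)
  have hMc := fun n => continuous_conv ht.contM (hzc n)
  have hPc := ht.contP
  refine ⟨?_, ?_, ?_, ?_, ?_, ?_, ?_, ?_, ?_, ?_, ?_⟩
  · fun_prop
  · fun_prop
  · fun_prop
  · fun_prop
  · fun_prop
  · intro t ξ hξ
    have h1 := HasDerivAt.fun_sum (u := F) fun n _ =>
      (((hm.pair n).deriv_a ξ hξ).const_mul (w n)).mul_const (z n t)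
    refine h1.congr_deriv ?_
    rw [← Finset.sum_sub_distrib, Finset.sum_div, Real.sq_sqrt (h.c_pos ξ).le]
    exact Finset.sum_congr rfl fun n _ => by ring
  · intro t ξ hξ
    have h1 := HasDerivAt.fun_sum (u := F) fun n _ =>
      (((hm.pair n).deriv_b ξ hξ).const_mul (w n)).mul_const (conv (memoryPrimitive M) (z n) t)
    refine h1.congr_deriv ?_
    have := (ht.P_pos (T - t)).ne'
    rw [Finset.sum_div, Real.sq_sqrt (ht.P_pos _).le]
    exact Finset.sum_congr rfl fun n _ => by field_simp
  · intro ξ t htt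
    exact HasDerivAt.fun_sum (u := F) fun n _ =>
      ((hz n).deriv t ⟨htt.1, htt.2.trans_le hτ⟩).const_mul (w n * a n ξ)
  · intro ξ t htt
    exact HasDerivAt.fun_sum (u := F) fun n _ =>
      (hasDerivAt_conv_memoryPrimitive ht.contM (hzc n) htt.1).const_mul (w n * b n ξ)
  · intro t
    simp [(hm.pair _).left]
  · intro ξ
    simp [conv_zero]

theorem SpaceData.sqrt_deriv (h : SpaceData c c₁ c₀) :
    (Continuous fun ξ => √(c ξ)) ∧ (Continuous fun ξ => c₁ ξ / (2 * √(c ξ))) ∧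
      ∀ ξ ∈ Ioo 0 Real.pi, HasDerivAt (fun ξ => √(c ξ)) (c₁ ξ / (2 * √(c ξ))) ξ := by
  have hcc := h.cont
  have h1 : Continuous fun ξ => √(c ξ) := by fun_prop
  refine ⟨h1, h.cont₁.div (h1.const_mul 2) fun ξ => ?_, fun ξ hξ =>
    (h.deriv ξ hξ).sqrt (h.c_pos ξ).ne'⟩
  have := Real.sqrt_pos.2 (h.c_pos ξ)
  positivity

/-- By linearity the Volterra bound acts on the whole sum Σ x_n z_n, so K does not depend on the
modes. With x_n = w_n b_n(ξ) it supplies the estimate for ρ at each ξ. -/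
theorem TimeData.exists_memory_bound (ht : TimeData P P₁ M M₁ p₀) (S : ℝ) :
    ∃ K, 0 ≤ K ∧ ∀ (z : ℕ → ℝ → ℝ), (∀ n, Continuous (z n)) → ∀ (F : Finset ℕ) (x : ℕ → ℝ),
      ∀ t ∈ Icc 0 S,
      (∑ n ∈ F, x n * ∫ s in (0 : ℝ)..t, z n s) ^ 2 ≤
        K * ((∑ n ∈ F, x n * conv (memoryPrimitive M) (z n) t) ^ 2 +
          ∫ s in (0 : ℝ)..t, (∑ n ∈ F, x n * conv (memoryPrimitive M) (z n) s) ^ 2) ∧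
      (∑ n ∈ F, x n * conv M (z n) t) ^ 2 ≤
        K * ((∑ n ∈ F, x n * conv (memoryPrimitive M) (z n) t) ^ 2 +
          ∫ s in (0 : ℝ)..t, (∑ n ∈ F, x n * conv (memoryPrimitive M) (z n) s) ^ 2) := by
  obtain ⟨K, hK, hb⟩ := exists_volterra_bounds ht.contM ht.contM₁ ht.M_eq S
  refine ⟨K, hK, fun z hz F x t htt => ?_⟩
  have h1 := hb (fun s => ∑ n ∈ F, x n * z n s) (by fun_prop) t htt
  have h2 : ∀ s, conv (memoryPrimitive M) (fun s => ∑ n ∈ F, x n * z n s) s =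
      ∑ n ∈ F, x n * conv (memoryPrimitive M) (z n) s := fun s =>
    conv_sum F _ x z (continuous_memoryPrimitive ht.contM) (fun n _ => hz n) s
  have h3 : conv M (fun s => ∑ n ∈ F, x n * z n s) t = ∑ n ∈ F, x n * conv M (z n) t :=
    conv_sum F _ x z ht.contM (fun n _ => hz n) t
  have h4 : (∫ s in (0 : ℝ)..t, ∑ n ∈ F, x n * z n s) =
      ∑ n ∈ F, x n * ∫ s in (0 : ℝ)..t, z n s := by
    simp only [← conv_one]
    exact conv_sum F _ x z continuous_const (fun n _ => hz n) t
  simp only [h2, h3, h4] at h1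
  exact h1

/-- Bessel type inequality for the traces of the modes, uniformly in the final time. -/
theorem exists_bessel_bound (ht : TimeData P P₁ M M₁ p₀) (h : SpaceData c c₁ c₀)
    (hm : Modes c lam a b) (S : ℝ) :
    ∃ C, 0 ≤ C ∧ ∀ T ∈ Icc 0 S, ∀ z : ℕ → ℝ → ℝ, (∀ n, ModalSol P M (lam n) T (z n)) →
      (∀ n, z n 0 = 1) → ∀ (F : Finset ℕ) (w : ℕ → ℝ),
      (∫ t in (0 : ℝ)..T, (∑ n ∈ F, w n * b n 0 * ∫ s in (0 : ℝ)..t, z n s) ^ 2) ≤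
        C * ∑ n ∈ F, w n ^ 2 := by
  rcases lt_or_ge S 0 with hS | hS
  · exact ⟨0, le_rfl, fun T hT => absurd (hT.1.trans hT.2) (not_le.2 hS)⟩
  obtain ⟨K, hK, hmem⟩ := ht.exists_memory_bound S
  obtain ⟨A, hA, hPb⟩ := exists_abs_le_of_continuousOn (ht.contP.continuousOn (s := Icc 0 S))
  obtain ⟨B, hB, hcb⟩ := exists_abs_le_of_continuousOn (h.cont.continuousOn (s := Icc 0 Real.pi))
  obtain ⟨E, hE, hen⟩ := ht.exists_energy_bound S
  obtain ⟨hk, hk₁, hkd⟩ := h.sqrt_deriv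
  obtain ⟨C, hC, htr⟩ := exists_trace_bound hk hk₁ hkd (fun ξ => Real.sqrt_pos.2 (h.c_pos ξ))
    (S := S) (A := A) hK ht.pos
  have hp := ht.pos
  -- E bounds the ζ part of the energy and B(E/p₀) the q part, from c ≤ B and λ_n² (N*z_n)² ≤ E/p₀.
  -- C is the trace constant, and K(1 + S) passes from N*z_n to the primitive of z_n.
  refine ⟨K * (1 + S) * (C * (E + B * (E / p₀))), by positivity, ?_⟩
  intro T hT z hz hz0 F w
  have hPc := ht.contP
  have hzc := fun n => (hz n).cont
  have hZc := fun n => continuous_conv (continuous_memoryPrimitive ht.contM) (hzc n)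
  have hIc := fun n => continuous_primitive_of_continuous (hzc n)
  have hbc := fun n => (hm.pair n).cont_b
  have hac := fun n => (hm.pair n).cont_a
  have h1 := htr T hT (fun t => √(P (T - t))) (by fun_prop)
    (fun t => by rw [Real.sq_sqrt (ht.P_pos _).le]; exact ht.lower _)
    (fun t htt => by
      rw [Real.sq_sqrt (ht.P_pos _).le]
      exact (le_abs_self _).trans (hPb _ ⟨by linarith [htt.2], by linarith [htt.1, hT.2]⟩))
    _ _ _ _ _ (waveSystem_sum ht h hm le_rfl hz F w)
    (fun ξ t htt => (hmem z hzc F (fun n => w n * b n ξ) t ⟨htt.1, htt.2.trans hT.2⟩).2)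
    ((E + B * (E / p₀)) * ∑ n ∈ F, w n ^ 2) (fun t htt => by
      have e1 : (∫ ξ in (0 : ℝ)..Real.pi, (∑ n ∈ F, w n * a n ξ * z n t) ^ 2) ≤
          E * ∑ n ∈ F, w n ^ 2 := by
        have : ∀ ξ, ∑ n ∈ F, w n * a n ξ * z n t = ∑ n ∈ F, (w n * z n t) * a n ξ := fun ξ =>
          Finset.sum_congr rfl fun n _ => by ring
        simp only [this]
        rw [hm.integral_sq_sum F, Finset.mul_sum]
        refine Finset.sum_le_sum fun n _ => ?_
        have e2 := hen (lam n) T hT (z n) (hz n) t htt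
        rw [hz0] at e2
        have e3 : 0 ≤ lam n ^ 2 * P (T - t) * conv (memoryPrimitive M) (z n) t ^ 2 := by
          have := (ht.P_pos (T - t)).le; positivity
        rw [mul_pow]
        nlinarith [sq_nonneg (w n)]
      have e4 : (∫ ξ in (0 : ℝ)..Real.pi,
          (∑ n ∈ F, w n * b n ξ * conv (memoryPrimitive M) (z n) t) ^ 2) ≤
          B * (E / p₀) * ∑ n ∈ F, w n ^ 2 := by
        have : ∀ ξ, ∑ n ∈ F, w n * b n ξ * conv (memoryPrimitive M) (z n) t =
            ∑ n ∈ F, (w n * conv (memoryPrimitive M) (z n) t) * b n ξ := fun ξ =>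
          Finset.sum_congr rfl fun n _ => by ring
        simp only [this]
        have hsc : Continuous fun ξ => (∑ n ∈ F, (w n * conv (memoryPrimitive M) (z n) t) * b n ξ) ^ 2
          := by fun_prop
        have hinv : Continuous fun ξ => 1 / c ξ := h.continuous_div continuous_const
        calc _ ≤ ∫ ξ in (0 : ℝ)..Real.pi,
              B * ((∑ n ∈ F, (w n * conv (memoryPrimitive M) (z n) t) * b n ξ) ^ 2 * (1 / c ξ)) := by
              refine intervalIntegral.integral_mono_on Real.pi_pos.le (hsc.intervalIntegrable _ _)
                ((hsc.mul hinv).const_mul B |>.intervalIntegrable _ _) fun ξ hξ => ?_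
              have e5 : 1 ≤ B * (1 / c ξ) := by
                rw [mul_one_div, le_div_iff₀ (h.c_pos ξ), one_mul]
                exact (le_abs_self _).trans (hcb ξ hξ)
              have := sq_nonneg (∑ n ∈ F, (w n * conv (memoryPrimitive M) (z n) t) * b n ξ)
              nlinarith
          _ ≤ _ := by
              rw [intervalIntegral.integral_const_mul, hm.integral_sq_flux_sum h F, mul_assoc]
              refine mul_le_mul_of_nonneg_left ?_ hB
              rw [Finset.mul_sum]
              refine Finset.sum_le_sum fun n _ => ?_
              have e2 := hen (lam n) T hT (z n) (hz n) t htt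
              rw [hz0] at e2
              have e3 := mul_le_mul_of_nonneg_right (ht.lower (T - t))
                (by positivity : 0 ≤ lam n ^ 2 * conv (memoryPrimitive M) (z n) t ^ 2)
              have e6 : lam n ^ 2 * conv (memoryPrimitive M) (z n) t ^ 2 ≤ E / p₀ := by
                rw [le_div_iff₀ hp]
                nlinarith [sq_nonneg (z n t)]
              rw [mul_pow]
              nlinarith [sq_nonneg (w n)]
      rw [intervalIntegral.integral_add (Continuous.intervalIntegrable (by fun_prop) _ _)
        (Continuous.intervalIntegrable (by fun_prop) _ _), add_mul]
      exact add_le_add e1 e4)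
  have h2 := integral_weight_mul_sq_le hT.1 (continuous_const (y := (1 : ℝ)))
    (q := fun t => ∑ n ∈ F, w n * b n 0 * conv (memoryPrimitive M) (z n) t)
    (ρ := fun t => ∑ n ∈ F, w n * b n 0 * ∫ s in (0 : ℝ)..t, z n s)
    (by fun_prop) (by fun_prop)
    (fun _ _ => zero_le_one) (fun _ _ _ _ _ => le_rfl) hK
    (fun t htt => (hmem z hzc F (fun n => w n * b n 0) t ⟨htt.1, htt.2.trans hT.2⟩).1)
  simp only [one_mul] at h2
  calc _ ≤ K * (1 + T) * ∫ t in (0 : ℝ)..T,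
        (∑ n ∈ F, w n * b n 0 * conv (memoryPrimitive M) (z n) t) ^ 2 := h2
    _ ≤ K * (1 + S) * ∫ t in (0 : ℝ)..T,
        (∑ n ∈ F, w n * b n 0 * conv (memoryPrimitive M) (z n) t) ^ 2 := by
        have := hT.2
        gcongr
        exact intervalIntegral.integral_nonneg hT.1 fun t _ => by positivity
    _ ≤ K * (1 + S) * (C * ((E + B * (E / p₀)) * ∑ n ∈ F, w n ^ 2)) := by gcongr
    _ = _ := by ring

/-- Lower bound for the traces of the modes in the critical time. -/
theorem exists_riesz_lower_bound (ht : TimeData P P₁ M M₁ p₀) (h : SpaceData c c₁ c₀)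
    (hm : Modes c lam a b) {T T₀ : ℝ} (hT₀ : 0 ≤ T₀) (hTT : T₀ ≤ T)
    (hTπ : (∫ s in (0 : ℝ)..T₀, √(P (T - s))) = ∫ ξ in (0 : ℝ)..Real.pi, 1 / √(c ξ)) :
    ∃ C, 0 ≤ C ∧ ∀ z : ℕ → ℝ → ℝ, (∀ n, ModalSol P M (lam n) T (z n)) →
      (∀ n, z n 0 = 1) → ∀ (F : Finset ℕ) (w : ℕ → ℝ),
      (∑ n ∈ F, w n ^ 2) ≤ C * ∫ t in (0 : ℝ)..T₀,
        (∑ n ∈ F, w n * b n 0 * conv (memoryPrimitive M) (z n) t) ^ 2 := by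
  obtain ⟨K, hK, hmem⟩ := ht.exists_memory_bound T₀
  obtain ⟨hk, hk₁, hkd⟩ := h.sqrt_deriv
  have hPc := ht.contP
  have hP₁c := ht.contP₁
  have hp := ht.pos
  have hc₀ := h.pos
  have hsq : ∀ t, 0 < √(P (T - t)) := fun t => Real.sqrt_pos.2 (ht.P_pos _)
  obtain ⟨C, hC, hobs⟩ := exists_observability hk hk₁ hkd (fun ξ => Real.sqrt_pos.2 (h.c_pos ξ))
    (p := fun t => √(P (T - t))) (p₁ := fun t => -P₁ (T - t) / (2 * √(P (T - t))))
    (m := min c₀ p₀) hT₀ (by fun_prop)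
    (Continuous.div (by fun_prop) (by fun_prop) fun t => by have := hsq t; positivity)
    (fun t htt => (ht.hasDerivAt_reverse (htt.2.trans_le hTT)).sqrt (ht.P_pos _).ne')
    hsq hK (lt_min hc₀ hp)
    (fun ξ => by rw [Real.sq_sqrt (h.c_pos ξ).le]; exact (min_le_left _ _).trans (h.lower ξ))
    (fun t => by rw [Real.sq_sqrt (ht.P_pos _).le]; exact (min_le_right _ _).trans (ht.lower _))
    hTπ
  refine ⟨C, hC, fun z hz hz0 F w => ?_⟩
  have h1 := hobs _ _ _ _ _ (waveSystem_sum ht h hm hTT hz F w)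
    (fun ξ t htt => (hmem z (fun n => (hz n).cont) F (fun n => w n * b n ξ) t htt).2)
  -- As z_n(0) = 1, the observed initial value is Σ w_n a_n, with squared norm Σ w_n².
  simp only [hz0, mul_one] at h1
  rwa [hm.integral_sq_sum F] at h1

end

/-! ### Extending the time coefficients to the line. -/

/-- A function on the half line, extended by a constant to the left. -/
def timeExt (f : ℝ → ℝ) (t : ℝ) : ℝ := f (max t 0)

theorem timeExt_of_nonneg (f : ℝ → ℝ) {t : ℝ} (ht : 0 ≤ t) : timeExt f t = f t := by
  rw [timeExt, max_eq_left ht]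

theorem continuous_timeExt {f : ℝ → ℝ} (hf : ContinuousOn f (Ici 0)) : Continuous (timeExt f) :=
  hf.comp_continuous (by fun_prop) fun x => mem_Ici.2 (le_max_right x 0)

theorem integrableOn_Icc_of_memLp_two {f : ℝ → ℝ} {T : ℝ} (hf : MemLp f 2 (timeMeasure T)) :
    IntegrableOn f (Icc 0 T) := by
  rw [integrableOn_Icc_iff_integrableOn_Ioo]
  exact hf.integrable one_le_two

theorem continuousOn_of_eq_add_integral {f g : ℝ → ℝ}
    (hg : ∀ K, IntegrableOn g (Icc 0 K))
    (h : ∀ t, 0 ≤ t → f t = f 0 + ∫ s in (0 : ℝ)..t, g s) : ContinuousOn f (Ici 0) := by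
  intro t ht
  have h1 : ContinuousOn (fun t => f 0 + ∫ s in (0 : ℝ)..t, g s) (Icc 0 (t + 1)) :=
    continuousOn_const.add ((intervalIntegral.continuousOn_primitive_interval'
      (b₁ := 0) (b₂ := t + 1) (a := 0) (f := g) (μ := volume)
      ((intervalIntegrable_iff_integrableOn_Icc_of_le (by have : 0 ≤ t := ht; linarith)).2 (hg _))
      left_mem_uIcc).mono Icc_subset_uIcc)
  have h2 : ContinuousOn f (Icc 0 (t + 1)) := h1.congr fun s hs => h s hs.1
  refine (h2 t ⟨ht, by linarith⟩).mono_of_mem_nhdsWithin ?_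
  exact mem_nhdsWithin.2 ⟨Iio (t + 1), isOpen_Iio, by simp, fun s hs => ⟨hs.2, hs.1.le⟩⟩

theorem exists_timeData {P M : ℝ → ℝ} {p₀ : ℝ} (hp₀ : 0 < p₀) (hP : ContDiffOn ℝ 1 P (Ici 0))
    (hPpos : ∀ t : ℝ, 0 ≤ t → p₀ < P t) (hM : IsW22Loc M) :
    ∃ P₁ M₁, TimeData (timeExt P) P₁ (timeExt M) M₁ p₀ := by
  obtain ⟨M₁, M₂, h2, h1, h0⟩ := hM
  have hM₁ : ContinuousOn M₁ (Ici 0) :=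
    continuousOn_of_eq_add_integral (fun K => integrableOn_Icc_of_memLp_two (h2 K)) h1
  have hMc : ContinuousOn M (Ici 0) := continuousOn_of_eq_add_integral
    (fun K => (hM₁.mono Icc_subset_Ici_self).integrableOn_compact isCompact_Icc) h0
  refine ⟨timeExt (derivWithin P (Ici 0)), timeExt M₁, ⟨continuous_timeExt hP.continuousOn,
    continuous_timeExt (hP.continuousOn_derivWithin (uniqueDiffOn_Ici 0) le_rfl), fun t ht => ?_,
    hp₀, fun t => (hPpos _ (le_max_right _ _)).le, continuous_timeExt hMc, continuous_timeExt hM₁,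
    fun t ht => ?_⟩⟩
  · rw [timeExt_of_nonneg _ ht.le]
    have h3 := ((hP.differentiableOn one_ne_zero t ht.le).hasDerivWithinAt).hasDerivAt
      (Ici_mem_nhds ht)
    refine h3.congr_of_eventuallyEq ?_
    filter_upwards [Ici_mem_nhds ht] with s hs using timeExt_of_nonneg P hs
  · rw [timeExt_of_nonneg _ ht, timeExt_of_nonneg _ le_rfl, h0 t ht]
    congr 1
    refine intervalIntegral.integral_congr fun s hs => ?_
    rw [uIcc_of_le ht] at hs
    exact (timeExt_of_nonneg _ hs.1).symm

theorem memoryPrimitive_timeExt (M : ℝ → ℝ) {t : ℝ} (ht : 0 ≤ t) :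
    memoryPrimitive M t = memoryPrimitive (timeExt M) t := by
  rw [memoryPrimitive, memoryPrimitive]
  congr 1
  refine intervalIntegral.integral_congr fun s hs => ?_
  rw [uIcc_of_le ht] at hs
  exact (timeExt_of_nonneg _ hs.1).symm

theorem modalKernel_timeExt (P M : ℝ → ℝ) : modalKernel P (memoryPrimitive M) =
    modalKernel (timeExt P) (memoryPrimitive (timeExt M)) :=
  funext₂ fun l T => modalKernel_congr (fun _ ht => (timeExt_of_nonneg P ht).symm)
    (fun _ ht => memoryPrimitive_timeExt M ht) l T

theorem sourceCoeff_timeExt (P M : ℝ → ℝ) : sourceCoeff P (memoryPrimitive M) =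
    sourceCoeff (timeExt P) (memoryPrimitive (timeExt M)) := by
  funext lam σ t n
  simp only [sourceCoeff, modalKernel_timeExt P M]

theorem sourceState_timeExt (P M : ℝ → ℝ) : sourceState P (memoryPrimitive M) =
    sourceState (timeExt P) (memoryPrimitive (timeExt M)) := by
  funext lam φ b σ t ξ
  simp only [sourceState, sourceCoeff_timeExt P M]

theorem output_timeExt (P M : ℝ → ℝ) : output P (memoryPrimitive M) =
    output (timeExt P) (memoryPrimitive (timeExt M)) := by
  funext lam φ b σ t
  simp only [output, sourceState_timeExt P M]

theorem controlCoeff_timeExt (P M : ℝ → ℝ) (lam : ℕ → ℝ) (φ : ℕ → ℝ → ℝ) {T : ℝ} (hT : 0 ≤ T) :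
    controlCoeff P (memoryPrimitive M) lam φ T =
      controlCoeff (timeExt P) (memoryPrimitive (timeExt M)) lam φ T := by
  funext f n
  refine intervalIntegral.integral_congr fun s hs => ?_
  rw [uIcc_of_le hT] at hs
  simp only [modalKernel_timeExt P M]
  congr 2
  refine intervalIntegral.integral_congr fun r hr => ?_
  rw [uIcc_of_le hs.1] at hr
  rw [memoryPrimitive_timeExt M (sub_nonneg.2 hr.2)]

theorem IsDirichletEigensystem.modes {c : ℝ → ℝ} {lam : ℕ → ℝ} {φ : ℕ → ℝ → ℝ} {c₀ : ℝ}
    (hc₀ : 0 < c₀) (hc : ContDiffOn ℝ 1 c (Icc 0 Real.pi))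
    (hcpos : ∀ ξ ∈ Icc 0 Real.pi, c₀ < c ξ) (hφ : IsDirichletEigensystem c lam φ) :
    Modes (spaceExt c) lam (fun n => spaceExt (φ n))
      (fun n => spaceExt fun ξ => c ξ * spaceDeriv (φ n) ξ) where
  pair n := (hφ.eigen n).modePair fun ξ hξ => hc₀.trans (hcpos ξ hξ)
  ortho m n := by
    rw [← innerL2_eq_spaceExt]
    exact (hφ.isL2OrthonormalBasis hc₀ hc hcpos).orthonormal m n

/-- The sign of the critical time is forced: for negative T the oriented integral is nonpositive,
while the travel time on the right is positive. -/
theorem nonneg_of_integral_sqrt_eq {g c : ℝ → ℝ} {T : ℝ} (hcpos : ∀ ξ ∈ Icc 0 Real.pi, 0 < c ξ)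
    (hc : ContinuousOn c (Icc 0 Real.pi))
    (h : (∫ s in (0 : ℝ)..T, √(g s)) = ∫ ξ in (0 : ℝ)..Real.pi, 1 / √(c ξ)) : 0 ≤ T := by
  by_contra! hT
  have h1 : 0 < ∫ ξ in (0 : ℝ)..Real.pi, 1 / √(c ξ) := by
    refine intervalIntegral.intervalIntegral_pos_of_pos_on ?_ (fun ξ hξ => ?_) Real.pi_pos
    · refine ContinuousOn.intervalIntegrable_of_Icc Real.pi_pos.le ?_
      exact continuousOn_const.div hc.sqrt fun ξ hξ => (Real.sqrt_pos.2 (hcpos ξ hξ)).ne'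
    · have := Real.sqrt_pos.2 (hcpos ξ ⟨hξ.1.le, hξ.2.le⟩)
      positivity
  have h2 : 0 ≤ ∫ s in T..(0 : ℝ), √(g s) :=
    intervalIntegral.integral_nonneg hT.le fun s _ => Real.sqrt_nonneg _
  rw [intervalIntegral.integral_symm] at h2
  linarith

/-! ### Series of functions with square summable coefficients. -/

theorem summable_abs_mul_of_sq {x y : ℕ → ℝ} (hx : Summable fun n => x n ^ 2)
    (hy : Summable fun n => y n ^ 2) : Summable fun n => |x n| * |y n| := by
  refine Summable.of_nonneg_of_le (fun n => by positivity) (fun n => ?_) (hx.add hy)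
  have := sq_nonneg (|x n| - |y n|)
  nlinarith [sq_abs (x n), sq_abs (y n), sq_nonneg (x n), sq_nonneg (y n)]

theorem summable_sq_of_sum_le {y : ℕ → ℝ} {K : ℝ} (hy : ∀ F : Finset ℕ, ∑ n ∈ F, y n ^ 2 ≤ K) :
    Summable fun n => y n ^ 2 :=
  summable_of_sum_le (fun _ => sq_nonneg _) hy

/-- A series `∑ βₙ fₙ(t)` of continuous functions is continuous if `β` is square summable and
`fₙ(t)` is uniformly square summable. -/
theorem continuousOn_tsum_mul {β : ℕ → ℝ} {f : ℕ → ℝ → ℝ} {A : Set ℝ} {K : ℝ}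
    (hβ : Summable fun n => β n ^ 2) (hf : ∀ n, ContinuousOn (f n) A)
    (hK : ∀ t ∈ A, ∀ F : Finset ℕ, ∑ n ∈ F, f n t ^ 2 ≤ K) :
    ContinuousOn (fun t => ∑' n, β n * f n t) A := by
  refine continuousOn_of_uniform_approx_of_continuousOn fun u hu => ?_
  obtain ⟨ε, hε, hεu⟩ := Metric.mem_uniformity_dist.1 hu
  -- By Cauchy–Schwarz the squared tail is at most δ(|K| + 1) = (ε/2)², uniformly in t.
  set δ := (ε / 2) ^ 2 / (|K| + 1) with hδ
  have hδ0 : 0 < δ := by positivity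
  obtain ⟨F, hF⟩ := summable_iff_vanishing_norm.1 hβ δ hδ0
  refine ⟨fun t => ∑ n ∈ F, β n * f n t,
    continuousOn_finsetSum _ fun n _ => (hf n).const_mul (β n), fun t ht => hεu ?_⟩
  have hsum : Summable fun n => β n * f n t :=
    (summable_abs_mul_of_sq hβ (summable_sq_of_sum_le (hK t ht))).of_norm_bounded
      fun n => by rw [Real.norm_eq_abs, abs_mul]
  have hlim : Tendsto (fun G : Finset ℕ => |∑ n ∈ G, β n * f n t - ∑ n ∈ F, β n * f n t|) atTop
      (𝓝 |(∑' n, β n * f n t) - ∑ n ∈ F, β n * f n t|) :=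
    (hsum.hasSum.sub_const _).abs
  rw [Real.dist_eq]
  refine lt_of_le_of_lt (le_of_tendsto hlim ?_) (half_lt_self hε)
  filter_upwards [eventually_ge_atTop F] with G hG
  rw [← Finset.sum_sdiff hG, add_sub_cancel_right]
  refine abs_le_of_sq_le_sq ?_ (by positivity)
  refine (Finset.sum_mul_sq_le_sq_mul_sq (G \ F) β fun n => f n t).trans ?_
  have h1 := hF (G \ F) Finset.sdiff_disjoint
  have h2 := hK t ht (G \ F)
  rw [Real.norm_eq_abs] at h1
  have h3 : (∑ n ∈ G \ F, β n ^ 2) ≤ δ := (le_abs_self _).trans h1.le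
  calc _ ≤ δ * (|K| + 1) := by
        refine mul_le_mul h3 (h2.trans ?_) (Finset.sum_nonneg fun _ _ => sq_nonneg _) hδ0.le
        linarith [le_abs_self K]
    _ = _ := by rw [hδ]; field_simp

/-- Term by term differentiation at the left end point. -/
theorem hasDerivWithinAt_tsum_mul {a : ℕ → ℝ → ℝ} {a' x u : ℕ → ℝ} (hu : Summable u)
    (ha0 : ∀ n, a n 0 = 0) (ha : ∀ n, HasDerivWithinAt (a n) (a' n) (Icc 0 Real.pi) 0)
    (hb : ∀ n, ∀ ξ ∈ Icc 0 Real.pi, |a n ξ * x n| ≤ ξ * u n) :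
    HasDerivWithinAt (fun ξ => ∑' n, a n ξ * x n) (∑' n, a' n * x n) (Icc 0 Real.pi) 0 := by
  rw [hasDerivWithinAt_iff_tendsto_slope]
  have h1 : Tendsto (fun ξ : ℝ => ∑' n, ξ⁻¹ * (a n ξ * x n)) (𝓝[Icc 0 Real.pi \ {0}] 0)
      (𝓝 (∑' n, a' n * x n)) := by
    -- Each term of the difference quotient is dominated by u n, because the bound on a n carries
    -- the factor ξ.
    refine tendsto_tsum_of_dominated_convergence hu (fun n => ?_) ?_
    · have h2 := hasDerivWithinAt_iff_tendsto_slope.1 (ha n)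
      refine (h2.mul_const (x n)).congr fun ξ => ?_
      rw [slope_def_field, ha0, sub_zero, sub_zero]
      ring
    · filter_upwards [self_mem_nhdsWithin] with ξ hξ n
      have h3 : 0 < ξ := lt_of_le_of_ne hξ.1.1 (Ne.symm hξ.2)
      rw [norm_mul, Real.norm_eq_abs, Real.norm_eq_abs, abs_of_pos (inv_pos.2 h3),
        inv_mul_le_iff₀ h3]
      exact hb n ξ hξ.1
  refine h1.congr fun ξ => ?_
  rw [slope_def_field, tsum_mul_left]
  simp only [ha0, zero_mul, tsum_zero, sub_zero]
  ring

/-! ### Source coefficients. -/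

section

variable {P P₁ M M₁ : ℝ → ℝ} {p₀ : ℝ} {c c₁ : ℝ → ℝ} {c₀ : ℝ} {lam : ℕ → ℝ} {a b : ℕ → ℝ → ℝ}

/-- The integration is moved from σ to z, by z*(1*σ) = (1*z)*σ. This is why the Bessel inequality
concerns the primitive of z_n. -/
theorem sourceCoeff_eq_conv {N σ z : ℝ → ℝ} {t : ℝ} {n : ℕ} (ht : 0 ≤ t) (hz : Continuous z)
    (hzN : ∀ s ∈ Icc 0 t, modalKernel P N (lam n) t s = z s) (hσ : IntegrableOn σ (Icc 0 t)) :
    sourceCoeff P N lam σ t n = conv (fun s => ∫ r in (0 : ℝ)..s, z r) σ t := by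
  have h1 : sourceCoeff P N lam σ t n =
      conv (modalKernel P N (lam n) t) (conv (fun _ => 1) σ) t := by
    simp only [sourceCoeff, conv, one_mul]
  rw [h1, conv_congr ht hzN fun _ _ => rfl, conv_assoc hz continuous_const ht hσ]
  congr 1
  funext s
  rw [conv_comm, conv_one]

/-- The source coefficients, scaled by the traces of the modes, are square summable. -/
theorem exists_source_bound (ht : TimeData P P₁ M M₁ p₀) (h : SpaceData c c₁ c₀)
    (hm : Modes c lam a b) {S : ℝ} {σ : ℝ → ℝ} (hS : 0 ≤ S) (hσ : MemLp σ 2 (timeMeasure S)) :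
    ∃ K, 0 ≤ K ∧ ∀ t ∈ Icc 0 S, ∀ F : Finset ℕ,
      ∑ n ∈ F, (b n 0 * sourceCoeff P (memoryPrimitive M) lam σ t n) ^ 2 ≤ K := by
  obtain ⟨C, hC, hbes⟩ := exists_bessel_bound ht h hm S
  have hQ : 0 ≤ ∫ s in (0 : ℝ)..S, σ s ^ 2 :=
    intervalIntegral.integral_nonneg hS fun s _ => sq_nonneg _
  refine ⟨C * ∫ s in (0 : ℝ)..S, σ s ^ 2, by positivity, fun t htt F => ?_⟩
  choose Z hZc hZ using fun n => ht.exists_modalKernel_family (lam n) S hS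
  have hz := fun n => ((hZ n) t htt).2.1
  have hzc := fun n => (hz n).cont
  have hσt : IntegrableOn σ (Icc 0 t) :=
    (integrableOn_Icc_of_memLp_two hσ).mono_set (Icc_subset_Icc_right htt.2)
  have hIc := fun n => continuous_primitive_of_continuous (hzc n)
  -- Duality: the Bessel inequality is tested on the coefficients themselves. Cauchy–Schwarz then
  -- gives (Σ w_n²)² ≤ C ‖σ‖² Σ w_n², and one factor is cancelled.
  set w : ℕ → ℝ := fun n => b n 0 * sourceCoeff P (memoryPrimitive M) lam σ t n with hw
  set J : ℝ → ℝ := fun s => ∑ n ∈ F, w n * b n 0 * ∫ r in (0 : ℝ)..s, Z n t r with hJ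
  have hJc : Continuous J := by fun_prop
  have h1 : ∑ n ∈ F, w n ^ 2 = conv J σ t := by
    have h2 : ∀ n, w n ^ 2 = ∫ s in (0 : ℝ)..t,
        w n * b n 0 * ((∫ r in (0 : ℝ)..(t - s), Z n t r) * σ s) := by
      intro n
      rw [intervalIntegral.integral_const_mul]
      have h3 := sourceCoeff_eq_conv (P := P) (lam := lam) (n := n) htt.1 (hzc n)
        ((hZ n) t htt).2.2 hσt
      simp only [conv] at h3
      rw [← h3]
      simp only [hw]
      ring
    simp only [h2]
    rw [← intervalIntegral.integral_finsetSum fun n _ =>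
      (intervalIntegrable_conv_integrand (hIc n) htt.1 hσt).const_mul _]
    refine intervalIntegral.integral_congr fun s _ => ?_
    simp only [hJ]
    rw [Finset.sum_mul]
    exact Finset.sum_congr rfl fun n _ => by ring
  have h4 : conv J σ t ^ 2 ≤ (∫ s in (0 : ℝ)..t, J s ^ 2) * ∫ s in (0 : ℝ)..S, σ s ^ 2 := by
    have h5 : (∫ s in (0 : ℝ)..t, J (t - s) ^ 2) = ∫ s in (0 : ℝ)..t, J s ^ 2 := by
      rw [intervalIntegral.integral_comp_sub_left (fun s => J s ^ 2) t]; simp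
    have hσm : MemLp σ 2 (volume.restrict (Ioc 0 S)) := by
      rw [← restrict_Ioo_eq_restrict_Ioc]; exact hσ
    have h6 : (∫ s in (0 : ℝ)..t, σ s ^ 2) ≤ ∫ s in (0 : ℝ)..S, σ s ^ 2 := by
      refine intervalIntegral.integral_mono_interval le_rfl htt.1 htt.2
        (ae_of_all _ fun s => sq_nonneg _) ?_
      rw [intervalIntegrable_iff_integrableOn_Ioc_of_le hS]
      exact hσm.integrable_sq
    calc conv J σ t ^ 2 ≤ (∫ s in (0 : ℝ)..t, J (t - s) ^ 2) * ∫ s in (0 : ℝ)..t, σ s ^ 2 := by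
          simp only [conv, intervalIntegral.integral_of_le htt.1]
          exact sq_integral_mul_le (memLp_two_of_continuous (by fun_prop) 0 t)
            (hσm.mono_measure (Measure.restrict_mono (Ioc_subset_Ioc_right htt.2) le_rfl))
      _ ≤ _ := by
          rw [h5]
          exact mul_le_mul_of_nonneg_left h6
            (intervalIntegral.integral_nonneg htt.1 fun s _ => sq_nonneg _)
  have h7 : (∫ s in (0 : ℝ)..t, J s ^ 2) ≤ C * ∑ n ∈ F, w n ^ 2 :=
    hbes t htt (fun n => Z n t) hz (fun n => ((hZ n) t htt).1) F w
  rw [← h1] at h4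
  have h8 := h4.trans (mul_le_mul_of_nonneg_right h7 hQ)
  have h9 : 0 ≤ ∑ n ∈ F, w n ^ 2 := Finset.sum_nonneg fun _ _ => sq_nonneg _
  rcases h9.eq_or_lt with h10 | h10
  · rw [← h10]; positivity
  · refine le_of_mul_le_mul_right ?_ h10
    calc _ = (∑ n ∈ F, w n ^ 2) ^ 2 := by ring
      _ ≤ _ := h8
      _ = _ := by ring

/-- The time t is also the final time of the kernel, so joint continuity of the kernels in both
variables is needed. -/
theorem continuousOn_sourceCoeff (ht : TimeData P P₁ M M₁ p₀) (lam : ℕ → ℝ) {S : ℝ} {σ : ℝ → ℝ}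
    (hS : 0 ≤ S) (hσ : MemLp σ 2 (timeMeasure S)) (n : ℕ) :
    ContinuousOn (fun t => sourceCoeff P (memoryPrimitive M) lam σ t n) (Icc 0 S) := by
  obtain ⟨Z, hZc, hZ⟩ := ht.exists_modalKernel_family (lam n) S hS
  set g : ℝ → ℝ := fun t => ∫ r in (0 : ℝ)..t, (Icc 0 S).indicator σ r with hg
  have hint : Integrable ((Icc 0 S).indicator σ) :=
    (integrable_indicator_iff measurableSet_Icc).2 (integrableOn_Icc_of_memLp_two hσ)
  have hgc : Continuous g :=
    intervalIntegral.continuous_primitive (fun _ _ => hint.intervalIntegrable) 0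
  have h1 : Continuous fun t => ∫ s in (0 : ℝ)..t, Z t (t - s) * g s := by
    refine intervalIntegral.continuous_parametric_intervalIntegral_of_continuous
      (f := fun t s => Z t (t - s) * g s) ?_ continuous_id
    exact (hZc.comp (f := fun p : ℝ × ℝ => (p.1, p.1 - p.2)) (by fun_prop)).mul
      (hgc.comp continuous_snd)
  refine h1.continuousOn.congr fun t htt => ?_
  refine intervalIntegral.integral_congr fun s hs => ?_
  rw [uIcc_of_le htt.1] at hs
  rw [(hZ t htt).2.2 _ ⟨by linarith [hs.2], by linarith [hs.1]⟩]
  congr 1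
  refine intervalIntegral.integral_congr fun r hr => ?_
  rw [uIcc_of_le hs.1] at hr
  exact (indicator_of_mem (show r ∈ Icc 0 S from ⟨hr.1, hr.2.trans (hs.2.trans htt.2)⟩) σ).symm

end

/-! ### The moment problem and orthonormal expansions. -/

/-- Solvability of the moment problem for a sequence with a lower Riesz bound. -/
theorem exists_moment_solution {H : Type*} [NormedAddCommGroup H] [InnerProductSpace ℝ H]
    [CompleteSpace H] {ψ : ℕ → H} {α : ℕ → ℝ} {C B : ℝ} (hC : 0 ≤ C)
    (hψ : ∀ (F : Finset ℕ) (w : ℕ → ℝ), ∑ n ∈ F, w n ^ 2 ≤ C * ‖∑ n ∈ F, w n • ψ n‖ ^ 2)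
    (hα : ∀ F : Finset ℕ, ∑ n ∈ F, α n ^ 2 ≤ B) :
    ∃ f : H, ∀ n, inner ℝ f (ψ n) = α n := by
  have hB : 0 ≤ B := by simpa using hα ∅
  set L : (ℕ →₀ ℝ) →ₗ[ℝ] H := Finsupp.linearCombination ℝ ψ with hL
  set A : (ℕ →₀ ℝ) →ₗ[ℝ] ℝ := Finsupp.linearCombination ℝ α with hA
  have hLw : ∀ w : ℕ →₀ ℝ, L w = ∑ n ∈ w.support, w n • ψ n := fun w =>
    Finsupp.linearCombination_apply ℝ w
  have hAw : ∀ w : ℕ →₀ ℝ, A w = ∑ n ∈ w.support, w n * α n := fun w =>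
    Finsupp.linearCombination_apply ℝ w
  have hb : ∀ w, ∑ n ∈ w.support, w n ^ 2 ≤ C * ‖L w‖ ^ 2 := fun w => by
    rw [hLw]; exact hψ w.support w
  have hker : LinearMap.ker L = ⊥ := by
    refine (Submodule.eq_bot_iff _).2 fun w hw => ?_
    have h1 := hb w
    rw [LinearMap.mem_ker.1 hw, norm_zero] at h1
    by_contra hne
    obtain ⟨n, hn⟩ := Finsupp.ne_iff.1 hne
    rw [Finsupp.coe_zero, Pi.zero_apply] at hn
    have h2 : w n ^ 2 ≤ ∑ n ∈ w.support, w n ^ 2 :=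
      Finset.single_le_sum (f := fun n => w n ^ 2) (fun n _ => sq_nonneg _)
        (Finsupp.mem_support_iff.2 hn)
    have h3 : 0 < w n ^ 2 := by positivity
    norm_num at h1
    linarith
  set e := LinearEquiv.ofInjective L (LinearMap.ker_eq_bot.1 hker) with he
  -- The lower bound makes Σ w_n ψ_n ↦ Σ w_n α_n a well defined bounded functional on the span.
  -- Hahn–Banach extends it, and Riesz representation yields f.
  have hbound : ∀ x : LinearMap.range L, ‖(A ∘ₗ e.symm.toLinearMap) x‖ ≤ √(C * B) * ‖x‖ := by
    intro x
    obtain ⟨w, rfl⟩ := e.surjective x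
    have h1 : ‖e w‖ = ‖L w‖ := rfl
    simp only [LinearMap.comp_apply, LinearEquiv.coe_coe, LinearEquiv.symm_apply_apply]
    rw [h1, Real.norm_eq_abs]
    refine abs_le_of_sq_le_sq ?_ (by positivity)
    rw [mul_pow, Real.sq_sqrt (by positivity), hAw]
    calc _ ≤ (∑ n ∈ w.support, w n ^ 2) * ∑ n ∈ w.support, α n ^ 2 :=
          Finset.sum_mul_sq_le_sq_mul_sq _ _ _
      _ ≤ (C * ‖L w‖ ^ 2) * B :=
          mul_le_mul (hb w) (hα _) (Finset.sum_nonneg fun _ _ => sq_nonneg _) (by positivity)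
      _ = _ := by ring
  obtain ⟨g, hg, -⟩ := exists_extension_norm_eq (LinearMap.range L)
    ((A ∘ₗ e.symm.toLinearMap).mkContinuous _ hbound)
  refine ⟨(InnerProductSpace.toDual ℝ H).symm g, fun n => ?_⟩
  rw [InnerProductSpace.toDual_symm_apply]
  have h1 : L (Finsupp.single n 1) = ψ n := by simp [hL]
  have h2 := hg (e (Finsupp.single n 1))
  have h3 : ((e (Finsupp.single n 1) : LinearMap.range L) : H) = ψ n := h1
  rw [h3] at h2
  rw [h2, LinearMap.mkContinuous_apply, LinearMap.comp_apply, LinearEquiv.coe_coe,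
    LinearEquiv.symm_apply_apply]
  simp [hA]

theorem IsL2OrthonormalBasis.exists_hilbertBasis {e : ℕ → ℝ → ℝ} (he : IsL2OrthonormalBasis e) :
    ∃ B : HilbertBasis ℕ ℝ SpaceL2, ∀ n, B n = (he.memLp n).toLp (e n) := by
  have hv : Orthonormal ℝ fun n => (he.memLp n).toLp (e n) := by
    rw [orthonormal_iff_ite]
    intro m n
    rw [inner_SpaceL2_toLp, he.orthonormal]
  have hsp : (Submodule.span ℝ (range fun n => (he.memLp n).toLp (e n)))ᗮ = ⊥ := by
    refine (Submodule.eq_bot_iff _).2 fun g hg => ?_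
    refine Lp.eq_zero_iff_ae_eq_zero.2 (he.total g (Lp.memLp g) fun n => ?_)
    rw [← inner_SpaceL2_toLp (he.memLp n) (Lp.memLp g), Lp.toLp_coeFn]
    exact hg _ (Submodule.subset_span ⟨n, rfl⟩)
  exact ⟨HilbertBasis.mkOfOrthogonalEqBot hv hsp, fun n => by
    rw [HilbertBasis.coe_mkOfOrthogonalEqBot]⟩

theorem innerL2_comm (u v : ℝ → ℝ) : innerL2 u v = innerL2 v u := by
  simp only [innerL2, mul_comm]

theorem convergesInL2_iff_hasSum {α : ℕ → ℝ} {e : ℕ → ℝ → ℝ} {W : ℝ → ℝ}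
    (he : ∀ n, MemLp (e n) 2 spaceMeasure) (hW : MemLp W 2 spaceMeasure) :
    ConvergesInL2 α e W ↔ HasSum (fun n => α n • (he n).toLp (e n)) (hW.toLp W) := by
  rw [HasSum, Lp.tendsto_Lp_iff_tendsto_eLpNorm, ConvergesInL2]
  refine tendsto_congr fun s => ?_
  rw [← eLpNorm_neg]
  refine eLpNorm_congr_ae ?_
  have h1 : ∀ᵐ ξ ∂spaceMeasure, ∀ n, (α n • (he n).toLp (e n) : SpaceL2) ξ = α n * e n ξ := by
    refine ae_all_iff.2 fun n => ?_
    filter_upwards [Lp.coeFn_smul (α n) ((he n).toLp (e n)), (he n).coeFn_toLp] with ξ h2 h3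
    rw [h2, Pi.smul_apply, h3, smul_eq_mul]
  filter_upwards [h1, Lp.coeFn_finsetSum s fun n => α n • (he n).toLp (e n)] with ξ h2 h3
  simp only [Pi.neg_apply, Pi.sub_apply, h3, Finset.sum_apply, h2]
  ring

theorem IsL2OrthonormalBasis.sum_sq_le {e : ℕ → ℝ → ℝ} (he : IsL2OrthonormalBasis e)
    {W : ℝ → ℝ} (hW : MemLp W 2 spaceMeasure) :
    ∃ B, ∀ F : Finset ℕ, ∑ n ∈ F, innerL2 W (e n) ^ 2 ≤ B := by
  obtain ⟨B, hB⟩ := he.exists_hilbertBasis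
  refine ⟨‖hW.toLp W‖ ^ 2, fun F => ?_⟩
  have h1 := B.orthonormal.sum_inner_products_le (s := F) (hW.toLp W)
  simpa only [hB, inner_SpaceL2_toLp, Real.norm_eq_abs, sq_abs, innerL2_comm] using h1

theorem IsL2OrthonormalBasis.convergesInL2 {e : ℕ → ℝ → ℝ} (he : IsL2OrthonormalBasis e)
    {W : ℝ → ℝ} (hW : MemLp W 2 spaceMeasure) :
    ConvergesInL2 (fun n => innerL2 (e n) W) e W := by
  obtain ⟨B, hB⟩ := he.exists_hilbertBasis
  rw [convergesInL2_iff_hasSum he.memLp hW]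
  have h1 := B.hasSum_repr (hW.toLp W)
  simpa only [B.repr_apply_apply, hB, inner_SpaceL2_toLp] using h1

theorem ConvergesInL2.hasSum_innerL2 {α : ℕ → ℝ} {e : ℕ → ℝ → ℝ} {W b : ℝ → ℝ}
    (he : ∀ n, MemLp (e n) 2 spaceMeasure) (hW : MemLp W 2 spaceMeasure)
    (hb : MemLp b 2 spaceMeasure) (h : ConvergesInL2 α e W) :
    HasSum (fun n => α n * innerL2 b (e n)) (innerL2 b W) := by
  have h1 := ((convergesInL2_iff_hasSum he hW).1 h).mapL (innerSL ℝ (hb.toLp b))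
  simpa only [innerSL_apply_apply, real_inner_smul_right, inner_SpaceL2_toLp] using h1

/-! ### Regularity of the output; inputs attached to controls. -/

section

variable {P P₁ M M₁ : ℝ → ℝ} {p₀ : ℝ} {c : ℝ → ℝ} {c₀ : ℝ} {lam : ℕ → ℝ} {φ : ℕ → ℝ → ℝ}

/-- Regularity of the deformation caused by a distributed source, and of its boundary output. -/
theorem IsDirichletEigensystem.source_regularity (ht : TimeData P P₁ M M₁ p₀) (hc₀ : 0 < c₀)
    (hc : ContDiffOn ℝ 1 c (Icc 0 Real.pi)) (hcpos : ∀ ξ ∈ Icc 0 Real.pi, c₀ < c ξ)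
    (hφ : IsDirichletEigensystem c lam φ) {S : ℝ} (hS : 0 ≤ S) {σ : ℝ → ℝ}
    (hσ : MemLp σ 2 (timeMeasure S)) {b : ℝ → ℝ} (hb : MemLp b 2 spaceMeasure) :
    (∀ t ∈ Icc 0 S,
      (∀ ξ ∈ Icc 0 Real.pi, Summable fun n =>
        φ n ξ * innerL2 b (φ n) * sourceCoeff P (memoryPrimitive M) lam σ t n) ∧
      DifferentiableWithinAt ℝ (sourceState P (memoryPrimitive M) lam φ b σ t) (Icc 0 Real.pi) 0 ∧
      HasSum (fun n => innerL2 b (φ n) * spaceDeriv (φ n) 0 *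
        sourceCoeff P (memoryPrimitive M) lam σ t n)
        (output P (memoryPrimitive M) lam φ b σ t)) ∧
    ContinuousOn (output P (memoryPrimitive M) lam φ b σ) (Icc 0 S) := by
  have hsd := spaceData_of_contDiffOn hc₀ hc hcpos
  have hm := hφ.modes hc₀ hc hcpos
  have h0 : (0 : ℝ) ∈ Icc 0 Real.pi := left_mem_Icc.2 Real.pi_pos.le
  have hc0 : 0 < c 0 := hc₀.trans (hcpos 0 h0)
  obtain ⟨K, hK, hKb⟩ := exists_source_bound ht hsd hm hS hσ
  obtain ⟨C, hC, hCb⟩ := hsd.exists_mode_bounds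
  obtain ⟨B, hB⟩ := (hφ.isL2OrthonormalBasis hc₀ hc hcpos).sum_sq_le hb
  simp only [spaceExt_of_mem _ h0] at hKb
  -- Square summability is known for φ_n'(0) s_n, while the domination of φ_n(ξ) costs a factor λ_n.
  -- This inequality trades one for the other.
  have hlam : ∀ n, lam n ^ 2 ≤ C * (c 0 * spaceDeriv (φ n) 0) ^ 2 := fun n => by
    have := (hCb (lam n) _ _ (hφ.pos n) (hm.pair n) (hφ.integral_sq n)).1
    rwa [spaceExt_of_mem _ h0] at this
  have hφb : ∀ n, ∀ ξ ∈ Icc 0 Real.pi, |φ n ξ| ≤ C * lam n * ξ := fun n ξ hξ => by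
    have := ((hCb (lam n) _ _ (hφ.pos n) (hm.pair n) (hφ.integral_sq n)).2 ξ hξ).2
    rwa [spaceExt_of_mem _ hξ] at this
  set s : ℝ → ℕ → ℝ := fun t n => sourceCoeff P (memoryPrimitive M) lam σ t n with hs
  set β : ℕ → ℝ := fun n => innerL2 b (φ n) with hβ
  have hβs : Summable fun n => β n ^ 2 := summable_sq_of_sum_le hB
  have htrace : ∀ t ∈ Icc 0 S, ∀ F : Finset ℕ,
      ∑ n ∈ F, (spaceDeriv (φ n) 0 * s t n) ^ 2 ≤ K / c 0 ^ 2 := by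
    intro t htt F
    rw [le_div_iff₀ (by positivity), Finset.sum_mul]
    refine le_of_eq_of_le (Finset.sum_congr rfl fun n _ => ?_) (hKb t htt F)
    ring
  have hmain : ∀ t ∈ Icc 0 S,
      (∀ ξ ∈ Icc 0 Real.pi, Summable fun n => φ n ξ * (β n * s t n)) ∧
      HasDerivWithinAt (sourceState P (memoryPrimitive M) lam φ b σ t)
        (∑' n, spaceDeriv (φ n) 0 * (β n * s t n)) (Icc 0 Real.pi) 0 := by
    intro t htt
    have hy : Summable fun n => (lam n * s t n) ^ 2 := by
      refine summable_sq_of_sum_le (K := C * K) fun F => ?_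
      refine le_trans ?_ (mul_le_mul_of_nonneg_left (hKb t htt F) hC.le)
      rw [Finset.mul_sum]
      refine Finset.sum_le_sum fun n _ => ?_
      have := mul_le_mul_of_nonneg_right (hlam n) (sq_nonneg (s t n))
      calc _ = lam n ^ 2 * s t n ^ 2 := by ring
        _ ≤ _ := this
        _ = _ := by ring
    have hu : Summable fun n => C * (|β n| * |lam n * s t n|) :=
      (summable_abs_mul_of_sq hβs hy).mul_left C
    have hbd : ∀ n, ∀ ξ ∈ Icc 0 Real.pi,
        |φ n ξ * (β n * s t n)| ≤ ξ * (C * (|β n| * |lam n * s t n|)) := by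
      intro n ξ hξ
      have h1 := mul_le_mul_of_nonneg_right (hφb n ξ hξ) (abs_nonneg (β n * s t n))
      rw [abs_mul]
      refine h1.trans_eq ?_
      rw [abs_mul, abs_mul, abs_of_pos (hφ.pos n)]
      ring
    refine ⟨fun ξ hξ => (hu.mul_left ξ).of_norm_bounded fun n => hbd n ξ hξ, ?_⟩
    have h2 := hasDerivWithinAt_tsum_mul hu (fun n => (hφ.eigen n).left) (fun n =>
      ((hφ.eigen n).contDiffOn.differentiableOn two_ne_zero 0 h0).hasDerivWithinAt) hbd
    simp only [← mul_assoc] at h2 ⊢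
    exact h2
  have hout : ∀ t ∈ Icc 0 S, output P (memoryPrimitive M) lam φ b σ t =
      ∑' n, β n * (spaceDeriv (φ n) 0 * s t n) := by
    intro t htt
    rw [output, spaceDeriv, (hmain t htt).2.derivWithin (uniqueDiffOn_space 0 h0)]
    exact tsum_congr fun n => by ring
  refine ⟨fun t htt => ⟨fun ξ hξ => ?_, (hmain t htt).2.differentiableWithinAt, ?_⟩, ?_⟩
  · simpa only [mul_assoc] using (hmain t htt).1 ξ hξ
  · rw [hout t htt]
    have h3 : Summable fun n => β n * (spaceDeriv (φ n) 0 * s t n) :=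
      (summable_abs_mul_of_sq hβs (summable_sq_of_sum_le (htrace t htt))).of_norm_bounded
        fun n => by rw [Real.norm_eq_abs, abs_mul]
    simpa only [mul_assoc] using h3.hasSum
  · refine (continuousOn_tsum_mul hβs (fun n => ?_) htrace).congr hout
    exact (continuousOn_sourceCoeff ht lam hS hσ n).const_mul _

/-- On [0, T] the memory term M*f equals M(0) g + M₁*g, where g is the primitive of f, and is
therefore continuous. -/
theorem TimeData.memLp_inputSignal (h : TimeData P P₁ M M₁ p₀) {f : ℝ → ℝ} {T : ℝ}
    (hf : MemLp f 2 (timeMeasure T)) : MemLp (inputSignal M f) 2 (timeMeasure T) := by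
  have hfi := integrableOn_Icc_of_memLp_two hf
  have hint : Integrable ((Icc 0 T).indicator f) := (integrable_indicator_iff measurableSet_Icc).2 hfi
  set g : ℝ → ℝ := fun t => ∫ s in (0 : ℝ)..t, (Icc 0 T).indicator f s with hg
  have hgc : Continuous g :=
    intervalIntegral.continuous_primitive (fun _ _ => hint.intervalIntegrable) 0
  have hgeq : ∀ t ∈ Icc 0 T, (∫ s in (0 : ℝ)..t, f s) = g t := by
    intro t ht
    refine intervalIntegral.integral_congr fun s hs => ?_
    rw [uIcc_of_le ht.1] at hs
    exact (indicator_of_mem (show s ∈ Icc 0 T from ⟨hs.1, hs.2.trans ht.2⟩) f).symm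
  have hkey : ∀ t ∈ Icc 0 T, conv M f t = M 0 * g t + conv M₁ g t := by
    intro t ht
    have hft : IntegrableOn f (Icc 0 t) := hfi.mono_set (Icc_subset_Icc_right ht.2)
    have h1 : conv M f t = conv (fun s => M 0 + conv M₁ (fun _ => 1) s) f t := by
      refine conv_congr ht.1 (fun s hs => ?_) fun _ _ => rfl
      rw [conv_comm, conv_one, h.M_eq s hs.1]
    rw [h1, conv_add_left (intervalIntegrable_conv_integrand continuous_const ht.1 hft)
      (intervalIntegrable_conv_integrand (continuous_conv h.contM₁ continuous_const) ht.1 hft),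
      conv_const_left, ← conv_assoc h.contM₁ continuous_const ht.1 hft, hgeq t ht]
    congr 1
    refine conv_congr ht.1 (fun _ _ => rfl) fun s hs => ?_
    rw [conv_one, hgeq s ⟨hs.1, hs.2.trans ht.2⟩]
  have h2 : MemLp (fun t => M 0 * g t + conv M₁ g t) 2 (timeMeasure T) :=
    (memLp_two_of_continuous (((hgc.const_mul _).add (continuous_conv h.contM₁ hgc))) 0 T).mono_measure
      (Measure.restrict_mono Ioo_subset_Ioc_self le_rfl)
  refine (hf.add h2).ae_eq ?_
  filter_upwards [ae_restrict_mem measurableSet_Ioo] with t ht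
  rw [Pi.add_apply, ← hkey t ⟨ht.1.le, ht.2.le⟩]
  rfl

theorem TimeData.integral_inputSignal (h : TimeData P P₁ M M₁ p₀) {f : ℝ → ℝ} {T : ℝ}
    (hf : MemLp f 2 (timeMeasure T)) {t : ℝ} (ht : t ∈ Icc 0 T) :
    (∫ s in (0 : ℝ)..t, inputSignal M f s) = ∫ s in (0 : ℝ)..t, memoryPrimitive M (t - s) * f s := by
  have hint : ∀ {g : ℝ → ℝ}, IntegrableOn g (Icc 0 T) → IntervalIntegrable g volume 0 t :=
    fun hg => (intervalIntegrable_iff_integrableOn_Icc_of_le ht.1).2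
      (hg.mono_set (Icc_subset_Icc_right ht.2))
  have hf1 := hint (integrableOn_Icc_of_memLp_two hf)
  have hs1 := (hint (integrableOn_Icc_of_memLp_two (h.memLp_inputSignal hf))).sub hf1
  have h1 : (fun s => inputSignal M f s - f s) = conv M f := by
    funext s
    exact add_sub_cancel_left _ _
  have h2 : IntervalIntegrable (conv M f) volume 0 t := h1 ▸ hs1
  have h3 := conv_memoryPrimitive h.contM ht.1
    ((integrableOn_Icc_of_memLp_two hf).mono_set (Icc_subset_Icc_right ht.2))
  rw [← intervalIntegral.integral_add hf1 h2] at h3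
  exact h3.symm

theorem inputSignal_timeExt (M f : ℝ → ℝ) {t : ℝ} (ht : 0 ≤ t) :
    inputSignal M f t = inputSignal (timeExt M) f t := by
  rw [inputSignal, inputSignal]
  congr 1
  refine intervalIntegral.integral_congr fun s hs => ?_
  rw [uIcc_of_le ht] at hs
  rw [timeExt_of_nonneg M (sub_nonneg.2 hs.2)]

end

/-! ### Steering, duality and reconstruction. -/

section

variable {P P₁ M M₁ : ℝ → ℝ} {p₀ : ℝ} {c : ℝ → ℝ} {c₀ : ℝ} {lam : ℕ → ℝ} {φ : ℕ → ℝ → ℝ}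

theorem norm_sq_sum_toLp {T : ℝ} (hT : 0 ≤ T) {ψ : ℕ → ℝ → ℝ}
    (hψ : ∀ n, MemLp (ψ n) 2 (timeMeasure T)) (F : Finset ℕ) (w : ℕ → ℝ) :
    ‖∑ n ∈ F, w n • (hψ n).toLp (ψ n)‖ ^ 2 =
      ∫ t in (0 : ℝ)..T, (∑ n ∈ F, w n * ψ n t) ^ 2 := by
  rw [← real_inner_self_eq_norm_sq, L2.inner_def, intervalIntegral.integral_of_le hT,
    integral_Ioc_eq_integral_Ioo]
  refine integral_congr_ae ?_
  have h1 : ∀ᵐ t ∂timeMeasure T, ∀ n,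
      (w n • (hψ n).toLp (ψ n) : Lp ℝ 2 (timeMeasure T)) t = w n * ψ n t := by
    refine ae_all_iff.2 fun n => ?_
    filter_upwards [Lp.coeFn_smul (w n) ((hψ n).toLp (ψ n)), (hψ n).coeFn_toLp] with t h2 h3
    rw [h2, Pi.smul_apply, h3, smul_eq_mul]
  filter_upwards [h1, Lp.coeFn_finsetSum F fun n => w n • (hψ n).toLp (ψ n)] with t h2 h3
  simp only [h3, Finset.sum_apply, h2, RCLike.inner_apply, conj_trivial, pow_two]

/-- Controllability of the state by the boundary control. -/
theorem IsDirichletEigensystem.exists_steering (ht : TimeData P P₁ M M₁ p₀) (hc₀ : 0 < c₀)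
    (hc : ContDiffOn ℝ 1 c (Icc 0 Real.pi)) (hcpos : ∀ ξ ∈ Icc 0 Real.pi, c₀ < c ξ)
    (hφ : IsDirichletEigensystem c lam φ) {T₀ T : ℝ} (hT₀ : 0 ≤ T₀) (hTT : T₀ ≤ T)
    (hTπ : (∫ s in (0 : ℝ)..T₀, √(P (T - s))) = ∫ ξ in (0 : ℝ)..Real.pi, 1 / √(spaceExt c ξ))
    {W : ℝ → ℝ} (hW : MemLp W 2 spaceMeasure) :
    ∃ f : ℝ → ℝ, MemLp f 2 (timeMeasure T) ∧ SteersTo P (memoryPrimitive M) lam φ T f W := by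
  have hT := hT₀.trans hTT
  have hsd := spaceData_of_contDiffOn hc₀ hc hcpos
  have hm := hφ.modes hc₀ hc hcpos
  have hon := hφ.isL2OrthonormalBasis hc₀ hc hcpos
  have h0 : (0 : ℝ) ∈ Icc 0 Real.pi := left_mem_Icc.2 Real.pi_pos.le
  obtain ⟨C, hC, hlow⟩ := exists_riesz_lower_bound ht hsd hm hT₀ hTT hTπ
  simp only [spaceExt_of_mem _ h0] at hlow
  choose Z hZc hZ using fun n => ht.exists_modalKernel_family (lam n) T hT
  have hZT := fun n => hZ n T ⟨hT, le_rfl⟩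
  have hNc := continuous_memoryPrimitive ht.contM
  have hzc := fun n => (hZT n).2.1.cont
  set ψ : ℕ → ℝ → ℝ := fun n t => spaceDeriv (φ n) 0 * conv (memoryPrimitive M) (Z n T) t with hψ
  have hψc : ∀ n, Continuous (ψ n) := fun n => (continuous_conv hNc (hzc n)).const_mul _
  have hψm : ∀ n, MemLp (ψ n) 2 (timeMeasure T₀) := fun n =>
    (memLp_two_of_continuous (hψc n) 0 T₀).mono_measure
      (Measure.restrict_mono Ioo_subset_Ioc_self le_rfl)
  obtain ⟨B, hB⟩ := hon.sum_sq_le hW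
  obtain ⟨g, hg⟩ := exists_moment_solution (H := Lp ℝ 2 (timeMeasure T₀))
    (ψ := fun n => (hψm n).toLp (ψ n))
    -- The factor c(0)² converts the flux trace c(0) φ_n'(0) of the Riesz bound into φ_n'(0).
    (α := fun n => innerL2 W (φ n)) (C := C * c 0 ^ 2) (mul_nonneg hC (sq_nonneg _)) (fun F w => by
      rw [norm_sq_sum_toLp hT₀ hψm]
      refine (hlow (fun n => Z n T) (fun n => (hZT n).2.1) (fun n => (hZT n).1) F w).trans_eq ?_
      rw [mul_assoc, ← intervalIntegral.integral_const_mul (c 0 ^ 2)]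
      congr 1
      refine intervalIntegral.integral_congr fun t _ => ?_
      simp only [hψ]
      rw [← mul_pow, Finset.mul_sum]
      congr 1
      exact Finset.sum_congr rfl fun n _ => by ring) hB
  -- The control t ↦ G(T - t) acts only during the last T₀ units of time and is zero before.
  set G : ℝ → ℝ := (Ioo 0 T₀).indicator g with hG
  have hGm : MemLp G 2 volume := (memLp_indicator_iff_restrict measurableSet_Ioo).2 (Lp.memLp g)
  refine ⟨fun t => G (T - t), (hGm.comp_measurePreserving
    (Measure.measurePreserving_sub_left volume T)).restrict _, ?_⟩
  have hcoef : controlCoeff P (memoryPrimitive M) lam φ T (fun t => G (T - t)) =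
      fun n => innerL2 (φ n) W := by
    funext n
    rw [innerL2_comm, ← hg n, L2.inner_def]
    have h1 : (∫ t in Ioo 0 T₀, inner ℝ (g t) ((hψm n).toLp (ψ n) t)) =
        ∫ t in Ioo 0 T₀, g t * ψ n t := by
      refine integral_congr_ae ?_
      filter_upwards [(hψm n).coeFn_toLp] with t h2
      rw [h2]
      simp only [RCLike.inner_apply, conj_trivial, mul_comm]
    have h3 : controlCoeff P (memoryPrimitive M) lam φ T (fun t => G (T - t)) n =
        ∫ s in (0 : ℝ)..T, (Ioo 0 T₀).indicator (fun t => g t * ψ n t) s := by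
      refine intervalIntegral.integral_congr fun s hs => ?_
      rw [uIcc_of_le hT] at hs
      have h4 : (∫ r in (0 : ℝ)..s, memoryPrimitive M (s - r) *
          modalKernel P (memoryPrimitive M) (lam n) T r) =
          conv (memoryPrimitive M) (Z n T) s :=
        conv_congr hs.1 (fun _ _ => rfl) fun r hr => (hZT n).2.2 r ⟨hr.1, hr.2.trans hs.2⟩
      simp only [sub_sub_cancel]
      rw [h4, indicator_mul_left]
    rw [h1, h3, intervalIntegral.integral_of_le hT, setIntegral_indicator measurableSet_Ioo,
      inter_eq_right.2 (Ioo_subset_Ioc_self.trans (Ioc_subset_Ioc_right hTT))]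
  rw [SteersTo, hcoef]
  exact hon.convergesInL2 hW

/-- Duality between the source and the boundary control. -/
theorem TimeData.mul_sourceCoeff_eq_controlCoeff (ht : TimeData P P₁ M M₁ p₀) {T : ℝ} (hT : 0 ≤ T)
    {f σ : ℝ → ℝ} (hf : MemLp f 2 (timeMeasure T))
    (hσ : ∀ t ∈ Icc 0 T, (∫ s in (0 : ℝ)..t, σ s) =
      ∫ s in (0 : ℝ)..t, memoryPrimitive M (t - s) * f s) (n : ℕ) :
    spaceDeriv (φ n) 0 * sourceCoeff P (memoryPrimitive M) lam σ T n =
      controlCoeff P (memoryPrimitive M) lam φ T f n := by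
  obtain ⟨Z, -, hZ⟩ := ht.exists_modalKernel_family (lam n) T hT
  have hNc := continuous_memoryPrimitive ht.contM
  have hZT := hZ T ⟨hT, le_rfl⟩
  have hzc := hZT.2.1.cont
  have h1 : sourceCoeff P (memoryPrimitive M) lam σ T n =
      conv (Z T) (conv (memoryPrimitive M) f) T := conv_congr hT hZT.2.2 hσ
  have h2 : controlCoeff P (memoryPrimitive M) lam φ T f n =
      spaceDeriv (φ n) 0 * conv f (conv (memoryPrimitive M) (Z T)) T := by
    rw [controlCoeff, conv, ← intervalIntegral.integral_const_mul]
    refine intervalIntegral.integral_congr fun s hs => ?_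
    rw [uIcc_of_le hT] at hs
    have h4 : (∫ r in (0 : ℝ)..s, memoryPrimitive M (s - r) *
        modalKernel P (memoryPrimitive M) (lam n) T r) = conv (memoryPrimitive M) (Z T) s :=
      conv_congr hs.1 (fun _ _ => rfl) fun r hr => hZT.2.2 r ⟨hr.1, hr.2.trans hs.2⟩
    rw [h4]
    ring
  -- The duality itself: z*(N*f) = (z*N)*f = f*(N*z).
  rw [h1, h2, conv_assoc hzc hNc hT (integrableOn_Icc_of_memLp_two hf), conv_comm f,
    funext fun s => conv_comm (Z T) (memoryPrimitive M) s]

/-- The output at the final time is a Fourier coefficient of the source. -/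
theorem IsDirichletEigensystem.output_eq_innerL2 (ht : TimeData P P₁ M M₁ p₀) (hc₀ : 0 < c₀)
    (hc : ContDiffOn ℝ 1 c (Icc 0 Real.pi)) (hcpos : ∀ ξ ∈ Icc 0 Real.pi, c₀ < c ξ)
    (hφ : IsDirichletEigensystem c lam φ) {T : ℝ} (hT : 0 ≤ T) {f σ e b : ℝ → ℝ}
    (hf : MemLp f 2 (timeMeasure T)) (he : MemLp e 2 spaceMeasure)
    (hfe : SteersTo P (memoryPrimitive M) lam φ T f e) (hσ : MemLp σ 2 (timeMeasure T))
    (hfσ : ∀ t ∈ Icc 0 T, (∫ s in (0 : ℝ)..t, σ s) =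
      ∫ s in (0 : ℝ)..t, memoryPrimitive M (t - s) * f s)
    (hb : MemLp b 2 spaceMeasure) :
    output P (memoryPrimitive M) lam φ b σ T = innerL2 e b := by
  have h1 := ((hφ.source_regularity ht hc₀ hc hcpos hT hσ hb).1 T ⟨hT, le_rfl⟩).2.2
  have h2 := ConvergesInL2.hasSum_innerL2 (fun n => (hφ.eigen n).memLp) he hb hfe
  rw [innerL2_comm e]
  -- One series is summed in two ways: by the output formula, and by pairing b with the expansion of
  -- the steered target.
  refine h1.unique ?_
  convert h2 using 2 with n
  rw [← ht.mul_sourceCoeff_eq_controlCoeff hT hf hfσ]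
  ring

end

end ViscoString

end

/-! ### The theorem for the original coefficients. -/

theorem mainTheorem3
    (P c M : ℝ → ℝ) (p₀ c₀ : ℝ)
    (hp₀ : 0 < p₀) (hP : ContDiffOn ℝ 1 P (Set.Ici 0)) (hPpos : ∀ t : ℝ, 0 ≤ t → p₀ < P t)
    (hc₀ : 0 < c₀) (hc : ContDiffOn ℝ 1 c (Set.Icc 0 Real.pi))
    (hcpos : ∀ ξ ∈ Set.Icc 0 Real.pi, c₀ < c ξ)
    (hM : ViscoString.IsW22Loc M)
    (N : ℝ → ℝ) (hN : N = ViscoString.memoryPrimitive M)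
    (lam : ℕ → ℝ) (φ : ℕ → ℝ → ℝ) (hφ : ViscoString.IsDirichletEigensystem c lam φ) :
    -- the output is well defined at every time and continuous
    (∀ S : ℝ, 0 ≤ S → ∀ σ : ℝ → ℝ, MemLp σ 2 (ViscoString.timeMeasure S) →
      ∀ b : ℝ → ℝ, MemLp b 2 ViscoString.spaceMeasure →
        (∀ t ∈ Set.Icc 0 S,
          (∀ ξ ∈ Set.Icc 0 Real.pi, Summable fun n =>
            φ n ξ * ViscoString.innerL2 b (φ n) * ViscoString.sourceCoeff P N lam σ t n) ∧
          DifferentiableWithinAt ℝ (ViscoString.sourceState P N lam φ b σ t)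
            (Set.Icc 0 Real.pi) 0 ∧
          HasSum (fun n => ViscoString.innerL2 b (φ n) * ViscoString.spaceDeriv (φ n) 0 *
            ViscoString.sourceCoeff P N lam σ t n) (ViscoString.output P N lam φ b σ t)) ∧
        ContinuousOn (ViscoString.output P N lam φ b σ) (Set.Icc 0 S)) ∧
    ∀ T₀ T : ℝ,
      (∫ s in (0 : ℝ)..T₀, √(P (T - s))) = (∫ ξ in (0 : ℝ)..Real.pi, 1 / √(c ξ)) → T₀ ≤ T →
      -- every target is reached by a boundary control
      (∀ W : ℝ → ℝ, MemLp W 2 ViscoString.spaceMeasure →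
        ∃ f : ℝ → ℝ, MemLp f 2 (ViscoString.timeMeasure T) ∧
          ViscoString.SteersTo P N lam φ T f W) ∧
      -- every control `f` gives an input `σ` whose primitive is `g = N * f`
      (∀ f : ℝ → ℝ, MemLp f 2 (ViscoString.timeMeasure T) →
        MemLp (ViscoString.inputSignal M f) 2 (ViscoString.timeMeasure T) ∧
        ∀ t ∈ Set.Icc 0 T, (∫ s in (0 : ℝ)..t, ViscoString.inputSignal M f s) =
          ∫ s in (0 : ℝ)..t, N (t - s) * f s) ∧
      -- reconstruction of `b` with respect to `φ`, or to any other orthonormal basis `e`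
      (∀ e : ℕ → ℝ → ℝ, (e = φ ∨ ViscoString.IsL2OrthonormalBasis e) →
        ∀ f σ : ℕ → ℝ → ℝ,
          (∀ k, MemLp (f k) 2 (ViscoString.timeMeasure T)) →
          (∀ k, ViscoString.SteersTo P N lam φ T (f k) (e k)) →
          (∀ k, MemLp (σ k) 2 (ViscoString.timeMeasure T)) →
          (∀ k, ∀ t ∈ Set.Icc 0 T, (∫ s in (0 : ℝ)..t, σ k s) =
            ∫ s in (0 : ℝ)..t, N (t - s) * f k s) →
          ∀ b : ℝ → ℝ, MemLp b 2 ViscoString.spaceMeasure →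
            (∀ k, ViscoString.output P N lam φ b (σ k) T = ViscoString.innerL2 (e k) b) ∧
            ViscoString.ConvergesInL2
              (fun k => ViscoString.output P N lam φ b (σ k) T) e b) := by
  subst hN
  obtain ⟨P₁, M₁, ht⟩ := ViscoString.exists_timeData hp₀ hP hPpos hM
  have hmem : ∀ e : ℕ → ℝ → ℝ, (e = φ ∨ ViscoString.IsL2OrthonormalBasis e) →
      ViscoString.IsL2OrthonormalBasis e := by
    rintro e (rfl | he)
    · exact hφ.isL2OrthonormalBasis hc₀ hc hcpos
    · exact he
  refine ⟨fun S hS σ hσ b hb => ?_, fun T₀ T hTπ hTT => ?_⟩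
  · rw [ViscoString.output_timeExt P M, ViscoString.sourceCoeff_timeExt P M,
      ViscoString.sourceState_timeExt P M]
    exact hφ.source_regularity ht hc₀ hc hcpos hS hσ hb
  have hT₀ : 0 ≤ T₀ := ViscoString.nonneg_of_integral_sqrt_eq
    (fun ξ hξ => hc₀.trans (hcpos ξ hξ)) hc.continuousOn hTπ
  have hT : 0 ≤ T := hT₀.trans hTT
  have hTπ' : (∫ s in (0 : ℝ)..T₀, √(ViscoString.timeExt P (T - s))) =
      ∫ ξ in (0 : ℝ)..Real.pi, 1 / √(ViscoString.spaceExt c ξ) := by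
    have h1 : (∫ s in (0 : ℝ)..T₀, √(ViscoString.timeExt P (T - s))) =
        ∫ s in (0 : ℝ)..T₀, √(P (T - s)) := by
      refine intervalIntegral.integral_congr fun s hs => ?_
      rw [Set.uIcc_of_le hT₀] at hs
      rw [ViscoString.timeExt_of_nonneg P (by linarith [hs.2])]
    rw [h1, hTπ]
    refine intervalIntegral.integral_congr fun ξ hξ => ?_
    rw [Set.uIcc_of_le Real.pi_pos.le] at hξ
    rw [ViscoString.spaceExt_of_mem c hξ]
  have hconv : ∀ f : ℝ → ℝ, ∀ t ∈ Set.Icc 0 T,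
      (∫ s in (0 : ℝ)..t, ViscoString.memoryPrimitive M (t - s) * f s) =
        ∫ s in (0 : ℝ)..t, ViscoString.memoryPrimitive (ViscoString.timeExt M) (t - s) * f s :=
    fun f t htt => ViscoString.conv_congr htt.1
      (fun s hs => ViscoString.memoryPrimitive_timeExt M hs.1) fun _ _ => rfl
  refine ⟨fun W hW => ?_, fun f hf => ⟨?_, fun t htt => ?_⟩,
    fun e he f σ hf hfe hσ hfσ b hb => ?_⟩
  · simp only [ViscoString.SteersTo, ViscoString.controlCoeff_timeExt P M lam φ hT]
    exact hφ.exists_steering ht hc₀ hc hcpos hT₀ hTT hTπ' hW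
  · refine (ht.memLp_inputSignal hf).ae_eq ?_
    filter_upwards [ae_restrict_mem measurableSet_Ioo] with t htt
      using (ViscoString.inputSignal_timeExt M f htt.1.le).symm
  · rw [hconv f t htt, ← ht.integral_inputSignal hf htt]
    refine intervalIntegral.integral_congr fun s hs => ?_
    rw [Set.uIcc_of_le htt.1] at hs
    exact ViscoString.inputSignal_timeExt M f hs.1
  · have hout : ∀ k, ViscoString.output P (ViscoString.memoryPrimitive M) lam φ b (σ k) T =
        ViscoString.innerL2 (e k) b := fun k => by
      have h1 := hfe k
      rw [ViscoString.SteersTo, ViscoString.controlCoeff_timeExt P M lam φ hT] at h1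
      rw [ViscoString.output_timeExt P M]
      exact hφ.output_eq_innerL2 ht hc₀ hc hcpos hT (hf k) ((hmem e he).memLp k) h1 (hσ k)
        (fun t htt => (hfσ k t htt).trans (hconv (f k) t htt)) hb
    refine ⟨hout, ?_⟩
    simp only [hout]
    exact (hmem e he).convergesInL2 hb
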